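/- Let $k$ be a field and let $A_{\mathbb R}=(\mathbb R,S,\preceq)$ be a continuous quiver of type $A$: $S\subset\mathbb R$ is a subset (possibly empty) without accumulation points, the elements of $\bar S=S\cup\{\pm\infty\}$ are indexed, in increasing order, as $s_n$ with $n$ running through a convex subset of $\mathbb Z\cup\{\pm\infty\}$ containing $0$, and $\preceq$ is the partial order for which, whenever $n\in\mathbb Z$ and $s_n,s_{n+1}\in\bar S$, two points $x\le y$ with $s_n\le x\le y\le s_{n+1}$ satisfy $x\preceq y$ if $n$ is even and $y\preceq x$ if $n$ is odd, while points with an element of $S$ strictly between them are unrelated. So $s_n$ is a sink for $n$ even and a source for $n$ odd. A representation $V$ assigns to each $x\in\mathbb R$ a $k$-vector space $V(x)$ and to each pair $y\preceq x$ a linear map $V(x,y)\colon V(x)\to V(y)$, functorially. For an interval $I\subseteq\mathbb R$ let $M_I$ be the representation with $M_I(x)=k$ for $x\in I$ and $0$ otherwise, and $M_I(x,y)=1_k$ for $y\preceq x$ in $I$. Let $\mathrm{Rep}^{\mathrm{pwf}}_k(A_{\mathbb R})$ be the category of representations with all $V(x)$ finite-dimensional, $\mathrm{Rep}^{\mathrm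 b}_k(A_{\mathbb R})$ its full subcategory of representations for which $\dim V(x)$ is bounded independently of $x$, and $\mathrm{rep}_k(A_{\mathbb R})$ its full subcategory of representations that are quotients of a finite direct sum of representations of the form $P_a,P_{a)},P_{(a}$ with $a\in\mathbb R\cup\{\pm\infty\}$; these are the $M_I$ with $I=\{x\in\mathbb R: x\preceq a\}$, $\{x\in\mathbb R: x\preceq a,\ x<a\}$, $\{x\in\mathbb R: x\preceq a,\ a<x\}$ respectively (where $\preceq$ is extended to $\pm\infty$ by the same rule). Then the following hold. 1. In each of the categories $\mathrm{Rep}^{\mathrm{pwf}}_k(A_{\mathbb R})$, $\mathrm{Rep}^{\mathrm b}_k(A_{\mathbb R})$, $\mathrm{rep}_k(A_{\mathbb R})$ the indecomposable objects are exactly the objects isomorphic to some $M_I$ with $I$ a nonempty interval, and for any two indecomposable objects $V,W$ we have $\mathrm{Hom}(V,W)\cong k$ or $\mathrm{Hom}(V,W)=0$. 2. In each of these three categories every morphism has a kernel, a cokernel, and coinciding image and coimage (so the three categories are abelian). 3. The category $\mathrm{rep}_k(A_{\mathbb R})$ is Krull–Schmidt (every object is a finite direct sum of objects with local endomorphism rings),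 but it is not artinian (not every object satisfies the descending chain condition on subobjects). 4. The global dimension of $\mathrm{rep}_k(A_{\mathbb R})$ is $1$. 5. In each of the three categories, for any two indecomposable objects $V,W$ the space $\mathrm{Ext}^1(V,W)$ is isomorphic to $k$ or is $0$. 6. Call a short exact sequence $0\to U\xrightarrow{f}V\xrightarrow{g}W\to0$ in $\mathrm{rep}_k(A_{\mathbb R})$ an Auslander–Reiten sequence if $f$ is not a section, $g$ is not a retraction, $U$ and $W$ are indecomposable, every nonzero morphism $U\to X$ with $X\not\cong U$ indecomposable factors through $f$, and every nonzero morphism $X\to W$ with $X\not\cong W$ indecomposable factors through $g$. Let $n\in\mathbb Z$ with $s_n,s_{n+1}\in\bar S$ and let $a,b\in\mathbb R$ with $s_n<a<b<s_{n+1}$. If $n$ is even, then $$0\to M_{[a,b)}\xrightarrow{\binom11}M_{[a,b]}\oplus M_{(a,b)}\xrightarrow{(1\ -1)}M_{(a,b]}\to0$$ is an Auslander–Reiten sequence in $\mathrm{rep}_k(A_{\mathbb R})$; if $n$ is odd, then $$0\to M_{(a,b]}\xrightarrow{\binom11}M_{(a,b)}\oplus M_{[a,b]}\xrightarrow{(1\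 -1)}M_{[a,b)}\to0$$ is one (here $1$ denotes the morphism $M_I\to M_J$ that is $1_k$ on $I\cap J$ and $0$ elsewhere). On the other hand, if $a\in\mathbb R\setminus S$ is neither a sink nor a source, then the simple representation $M_{\{a\}}$ lies in $\mathrm{rep}_k(A_{\mathbb R})$, and there is no Auslander–Reiten sequence in $\mathrm{rep}_k(A_{\mathbb R})$ of the form $0\to M_{\{a\}}\to B\to C\to0$ nor of the form $0\to A\to B\to M_{\{a\}}\to0$. -/

import Mathlib

open CategoryTheory CategoryTheory.Limits

universe u v w

/-- An additive category with finite products has finite biproducts. -/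
instance (priority := 50) hasFiniteBiproducts_of_hasFiniteProducts (C : Type v) [Category.{w} C]
    [Preadditive C] [HasFiniteProducts C] : HasFiniteBiproducts C :=
  HasFiniteBiproducts.of_hasFiniteProducts

/-- An additive category with finite products has binary biproducts. -/
instance (priority := 50) hasBinaryBiproducts_of_hasFiniteProducts (C : Type v) [Category.{w} C]
    [Preadditive C] [HasFiniteProducts C] : HasBinaryBiproducts C :=
  hasBinaryBiproducts_of_finite_biproducts C

/-! ### Continuous quivers of type `A` -/

/-- The integers together with `-∞` and `+∞`; these index the sinks and sources. -/
abbrev ExtInt : Type := WithBot (WithTop ℤ)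

/-- An integer regarded as an element of `ℤ ∪ {-∞, +∞}`. -/
abbrev ExtInt.ofInt (n : ℤ) : ExtInt := ((n : WithTop ℤ) : WithBot (WithTop ℤ))

/-- A continuous quiver of type `A`: a subset `S` of the real line without accumulation points
together with an order preserving indexing `n ↦ s n` of `S ∪ {-∞, +∞}` by a convex subset of
`ℤ ∪ {-∞, +∞}` that contains `0`. Elements with even index are sinks, those with odd index are
sources. -/
structure ContinuousQuiverA where
  /-- the set of sinks and sources in the real line -/
  S : Set ℝ
  /-- `S` is discrete and has no accumulation points -/
  no_accPt : ∀ x : ℝ, ¬ AccPt x (Filter.principal S)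
  /-- the set of indices -/
  index : Set ExtInt
  /-- the set of indices is convex -/
  index_ordConnected : index.OrdConnected
  /-- there is an element with index `0` -/
  zero_mem_index : ExtInt.ofInt 0 ∈ index
  /-- the indexing of `S ∪ {-∞, +∞}` -/
  s : index ≃o {x : EReal | x = ⊥ ∨ x = ⊤ ∨ ∃ r ∈ S, x = (r : EReal)}

namespace ContinuousQuiverA

variable (A : ContinuousQuiverA)

/-- The orientation `x ⪯ y`, on the extended real line: between the consecutive elements
`s n` and `s (n + 1)` it agrees with `≤` if `n` is even and it is the reverse of `≤` if `n` is odd;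
points with an element of `S` strictly between them are unrelated. -/
def le (x y : EReal) : Prop :=
  x = y ∨ ∃ (n : ℤ) (hn : ExtInt.ofInt n ∈ A.index) (hn' : ExtInt.ofInt (n + 1) ∈ A.index),
    x ∈ Set.Icc (A.s ⟨_, hn⟩ : EReal) (A.s ⟨_, hn'⟩) ∧
    y ∈ Set.Icc (A.s ⟨_, hn⟩ : EReal) (A.s ⟨_, hn'⟩) ∧
    ((Even n ∧ x ≤ y) ∨ (Odd n ∧ y ≤ x))

lemma s_le_s {m n : ℤ} (hm : ExtInt.ofInt m ∈ A.index) (hn : ExtInt.ofInt n ∈ A.index) :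
    (A.s ⟨_, hm⟩ : EReal) ≤ A.s ⟨_, hn⟩ ↔ m ≤ n := by
  rw [Subtype.coe_le_coe, A.s.le_iff_le, Subtype.mk_le_mk]
  simp [ExtInt.ofInt]

lemma le_refl (x : EReal) : A.le x x := Or.inl rfl

lemma le_trans {x y z : EReal} (hxy : A.le x y) (hyz : A.le y z) : A.le x z := by
  rcases hxy with rfl | ⟨n, hn, hn', hx, hy, h⟩
  · exact hyz
  rcases hyz with rfl | ⟨m, hm, hm', hy', hz, h'⟩
  · exact Or.inr ⟨n, hn, hn', hx, hy, h⟩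
  have h1 := (A.s_le_s hm hn').1 (hy'.1.trans hy.2)
  have h2 := (A.s_le_s hn hm').1 (hy.1.trans hy'.2)
  obtain rfl | rfl | rfl : m = n ∨ m = n + 1 ∨ n = m + 1 := by omega
  · refine Or.inr ⟨m, hm, hm', hx, hz, ?_⟩
    rcases h with ⟨e, h⟩ | ⟨e, h⟩ <;> rcases h' with ⟨e', h'⟩ | ⟨e', h'⟩
    · exact Or.inl ⟨e, h.trans h'⟩
    · exact absurd e (Int.not_even_iff_odd.2 e')
    · exact absurd e' (Int.not_even_iff_odd.2 e)
    · exact Or.inr ⟨e, h'.trans h⟩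
  · have hys := _root_.le_antisymm hy'.1 hy.2
    rcases h with ⟨e, h⟩ | ⟨e, h⟩ <;> rcases h' with ⟨e', h'⟩ | ⟨e', h'⟩
    · exact absurd e' (Int.not_even_iff_odd.2 e.add_one)
    · have : z = y := _root_.le_antisymm h' (hys ▸ hz.1)
      exact this ▸ Or.inr ⟨n, hn, hn', hx, hy, Or.inl ⟨e, h⟩⟩
    · have : x = y := _root_.le_antisymm (hys ▸ hx.2) h
      exact this ▸ Or.inr ⟨n + 1, hm, hm', hy', hz, Or.inl ⟨e', h'⟩⟩
    · exact absurd e.add_one (Int.not_even_iff_odd.2 e')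
  · have hys := _root_.le_antisymm hy.1 hy'.2
    rcases h with ⟨e, h⟩ | ⟨e, h⟩ <;> rcases h' with ⟨e', h'⟩ | ⟨e', h'⟩
    · exact absurd e (Int.not_even_iff_odd.2 e'.add_one)
    · have : x = y := _root_.le_antisymm h (hys ▸ hx.1)
      exact this ▸ Or.inr ⟨m, hm, hm', hy', hz, Or.inr ⟨e', h'⟩⟩
    · have : z = y := _root_.le_antisymm (hys ▸ hz.2) h'
      exact this ▸ Or.inr ⟨m + 1, hn, hn', hx, hy, Or.inr ⟨e, h⟩⟩
    · exact absurd e'.add_one (Int.not_even_iff_odd.2 e)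

lemma mem_uIcc_of_le {x y z : EReal} (hzy : A.le z y) (hyx : A.le y x) : y ∈ Set.uIcc z x := by
  rw [Set.mem_uIcc]
  rcases hzy with rfl | ⟨n, hn, hn', hz, hy, h⟩
  · exact (le_total z x).imp (fun h => ⟨_root_.le_refl _, h⟩) (fun h => ⟨h, _root_.le_refl _⟩)
  rcases hyx with rfl | ⟨m, hm, hm', hy', hx, h'⟩
  · exact (le_total z y).imp (fun h => ⟨h, _root_.le_refl _⟩) (fun h => ⟨_root_.le_refl _, h⟩)
  have h1 := (A.s_le_s hm hn').1 (hy'.1.trans hy.2)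
  have h2 := (A.s_le_s hn hm').1 (hy.1.trans hy'.2)
  obtain rfl | rfl | rfl : m = n ∨ m = n + 1 ∨ n = m + 1 := by omega
  · rcases h with ⟨e, h⟩ | ⟨e, h⟩ <;> rcases h' with ⟨e', h'⟩ | ⟨e', h'⟩
    · exact Or.inl ⟨h, h'⟩
    · exact absurd e (Int.not_even_iff_odd.2 e')
    · exact absurd e' (Int.not_even_iff_odd.2 e)
    · exact Or.inr ⟨h', h⟩
  · exact Or.inl ⟨hz.2.trans hy'.1, hy.2.trans hx.1⟩
  · exact Or.inr ⟨hx.2.trans hy.1, hy'.2.trans hz.1⟩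

lemma le_of_mem_uIcc {x y a : EReal} (hx : A.le x a) (hy : y ∈ Set.uIcc x a) : A.le y a := by
  rw [Set.mem_uIcc] at hy
  rcases hx with rfl | ⟨n, hn, hn', hx, ha, h⟩
  · rcases hy with hy | hy <;> exact Or.inl (_root_.le_antisymm (by tauto) (by tauto))
  refine Or.inr ⟨n, hn, hn', ?_, ha, ?_⟩
  · rcases hy with hy | hy
    · exact ⟨hx.1.trans hy.1, hy.2.trans ha.2⟩
    · exact ⟨ha.1.trans hy.1, hy.2.trans hx.2⟩
  · rcases h with ⟨e, h⟩ | ⟨e, h⟩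
    · exact Or.inl ⟨e, hy.elim (fun h' => h'.2) (fun h' => h'.2.trans h)⟩
    · exact Or.inr ⟨e, hy.elim (fun h' => h.trans h'.1) (fun h' => h'.1)⟩

/-- The support `{x | x ⪯ a}` of the projective representation `P_a`. -/
def supp (a : EReal) : Set ℝ := {x | A.le x a}

/-- The support `{x | x ⪯ a, x < a}` of the projective representation `P_{a)}`. -/
def suppLeft (a : EReal) : Set ℝ := {x | A.le x a ∧ (x : EReal) < a}

/-- The support `{x | x ⪯ a, a < x}` of the projective representation `P_{(a}`. -/
def suppRight (a : EReal) : Set ℝ := {x | A.le x a ∧ a < (x : EReal)}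

instance (a : EReal) : (A.supp a).OrdConnected := ⟨fun x hx z hz y hy => by
  rcases le_total (y : EReal) a with h | h
  · exact A.le_of_mem_uIcc hx (Set.mem_uIcc.2 (Or.inl ⟨EReal.coe_le_coe_iff.2 hy.1, h⟩))
  · exact A.le_of_mem_uIcc hz (Set.mem_uIcc.2 (Or.inr ⟨h, EReal.coe_le_coe_iff.2 hy.2⟩))⟩

instance (a : EReal) : (A.suppLeft a).OrdConnected := ⟨fun _ hx _ hz _ hy =>
  ⟨Set.OrdConnected.out (s := A.supp a) inferInstance hx.1 hz.1 hy,
    (EReal.coe_le_coe_iff.2 hy.2).trans_lt hz.2⟩⟩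

instance (a : EReal) : (A.suppRight a).OrdConnected := ⟨fun _ hx _ hz _ hy =>
  ⟨Set.OrdConnected.out (s := A.supp a) inferInstance hx.1 hz.1 hy,
    hx.2.trans_le (EReal.coe_le_coe_iff.2 hy.1)⟩⟩

/-- The vertices of the quiver: all real numbers. -/
def Vertex (_ : ContinuousQuiverA) : Type := ℝ

/-- The real number underlying a vertex. -/
def Vertex.val {A : ContinuousQuiverA} (x : A.Vertex) : ℝ := x

/-- The path category of the quiver: there is exactly one path from `x` to `y` if `y ⪯ x`, and
there is none otherwise. -/
instance : SmallCategory A.Vertex where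
  Hom x y := PLift (A.le y.val x.val)
  id x := ⟨A.le_refl _⟩
  comp f g := ⟨A.le_trans g.down f.down⟩

end ContinuousQuiverA

/-! ### Representations -/

/-- The category of all representations of `A` over `k`: a vector space `V(x)` for every real
number `x` and a linear map `V(x, y) : V(x) → V(y)` whenever `y ⪯ x`, compatible with
composition and identities. -/
abbrev QRep (k : Type u) [Field k] (A : ContinuousQuiverA) : Type (u + 1) :=
  A.Vertex ⥤ ModuleCat.{u} k

section Interval

variable (k : Type u) [Field k] (A : ContinuousQuiverA)

/-- The vector space which is `k` if `x ∈ I` and `0` otherwise. -/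
def intervalSpace (I : Set ℝ) (x : ℝ) : Submodule k k where
  carrier := {c | x ∉ I → c = 0}
  add_mem' ha hb hx := by rw [ha hx, hb hx, add_zero]
  zero_mem' _ := rfl
  smul_mem' r c hc hx := by rw [hc hx, smul_zero]

open Classical in
/-- The linear map which is the identity of `k` if source and target are both `k`, and `0`
otherwise. -/
noncomputable def intervalMap (I J : Set ℝ) (x y : ℝ) :
    intervalSpace k I x →ₗ[k] intervalSpace k J y where
  toFun c := ⟨if y ∈ J then c.1 else 0, fun hy => if_neg hy⟩
  map_add' a b := by ext; by_cases hy : y ∈ J <;> simp [hy]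
  map_smul' r a := by ext; by_cases hy : y ∈ J <;> simp [hy]

/-- The interval representation `M_I` of an interval `I`. -/
noncomputable def intervalRep (I : Set ℝ) [hI : I.OrdConnected] : QRep k A where
  obj x := ModuleCat.of k (intervalSpace k I x.val)
  map {x y} _ := ModuleCat.ofHom (intervalMap k I I x.val y.val)
  map_id x := by
    ext c
    by_cases hx : x.val ∈ I
    · simp [intervalMap, hx]
    · simpa [intervalMap, hx] using (c.2 hx).symm
  map_comp {x y z} f g := by
    ext c
    by_cases hz : z.val ∈ I
    · by_cases hy : y.val ∈ I
      · simp [intervalMap, hy, hz]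
      · have hx : x.val ∉ I := fun hx => by
          have h := A.mem_uIcc_of_le g.down f.down
          rw [Set.mem_uIcc] at h
          simp only [EReal.coe_le_coe_iff] at h
          exact hy (h.elim (fun h => hI.out hz hx h) (fun h => hI.out hx hz h))
        have hc : c.1 = 0 := c.2 hx
        simp [intervalMap, hy, hz, hc]
    · simp [intervalMap, hz]

variable {k A}

/-- A morphism `M_I ⟶ M_J` of interval representations is the canonical one (written `1`) if it
is the identity of `k` at all points of `I ∩ J`, and `0` elsewhere. -/
def IsCanonicalHom {I J : Set ℝ} [I.OrdConnected] [J.OrdConnected]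
    (f : intervalRep k A I ⟶ intervalRep k A J) : Prop :=
  ∀ x, f.app x = ModuleCat.ofHom (intervalMap k I J x.val x.val)

end Interval

/-- The listed indecomposable projectives `P_a`, `P_{a)}` and `P_{(a}`, up to isomorphism, where
`a` is real or `±∞`. (Some of them may be zero.) -/
def IsListedProjective {k : Type u} [Field k] {A : ContinuousQuiverA} (Q : QRep k A) : Prop :=
  ∃ a : EReal, Nonempty (Q ≅ intervalRep k A (A.supp a)) ∨
    Nonempty (Q ≅ intervalRep k A (A.suppLeft a)) ∨
    Nonempty (Q ≅ intervalRep k A (A.suppRight a))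

section Subcategories

variable (k : Type u) [Field k] (A : ContinuousQuiverA)

/-- Pointwise finite-dimensional representations. -/
def isPwf : ObjectProperty (QRep k A) := fun V => ∀ x, Module.Finite k (V.obj x)

/-- Bounded representations: the dimensions of the spaces `V(x)` are bounded. -/
def isBounded : ObjectProperty (QRep k A) := fun V =>
  isPwf k A V ∧ ∃ n : ℕ, ∀ x, Module.finrank k (V.obj x) < n

/-- Finitely generated representations: pointwise finite-dimensional representations that are
quotients of a finite direct sum of listed indecomposable projectives. -/
def isFG : ObjectProperty (QRep k A) := fun V =>
  isPwf k A V ∧ ∃ (ι : Type) (_ : Finite ι) (Q : ι → QRep k A),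
    (∀ i, IsListedProjective (Q i)) ∧ ∃ f : (⨁ Q) ⟶ V, Epi f

/-- The category of pointwise finite-dimensional representations. -/
abbrev RepPwf := (isPwf k A).FullSubcategory

/-- The category of bounded representations. -/
abbrev RepB := (isBounded k A).FullSubcategory

/-- The category of finitely generated representations. -/
abbrev RepFG := (isFG k A).FullSubcategory

end Subcategories

/-! ### Finite products in the three subcategories -/

lemma closedUnderFiniteProducts_of_biprod {C : Type v} [Category.{w} C] [Abelian C]
    (P : ObjectProperty C) [P.IsClosedUnderIsomorphisms] (h0 : ∀ X, IsZero X → P X)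
    (h : ∀ X Y, P X → P Y → P (X ⊞ Y)) : P.IsClosedUnderFiniteProducts := by
  have : P.ContainsZero := 
    ⟨⟨_, isZero_zero C, h0 _ (isZero_zero C)⟩⟩
  have : P.IsClosedUnderBinaryProducts := by
    refine ⟨?_⟩
    rintro X ⟨p⟩
    refine P.prop_of_iso ?_ (h _ _ (p.prop_diag_obj ⟨WalkingPair.left⟩)
      (p.prop_diag_obj ⟨WalkingPair.right⟩))
    exact biprod.isoProd _ _ ≪≫ (limit.isLimit _).conePointUniqueUpToIso
      ((IsLimit.postcomposeHomEquiv (diagramIsoPair p.diag) _).symm p.isLimit)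
  exact ObjectProperty.IsClosedUnderFiniteProducts.mk'

section FiniteProducts

variable (k : Type u) [Field k] (A : ContinuousQuiverA)

lemma subsingleton_obj_of_isZero {V : QRep k A} (hV : IsZero V) (x : A.Vertex) :
    Subsingleton (V.obj x) :=
  ModuleCat.subsingleton_of_isZero (hV.obj x)

lemma biprod_obj_injective (V W : QRep k A) (x : A.Vertex) :
    Function.Injective (((biprod.fst : V ⊞ W ⟶ V).app x).hom.prod
      ((biprod.snd : V ⊞ W ⟶ W).app x).hom) := by
  rw [injective_iff_map_eq_zero]
  intro c hc
  have h1 : ((biprod.fst : V ⊞ W ⟶ V).app x).hom c = 0 := congrArg Prod.fst hc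
  have h2 : ((biprod.snd : V ⊞ W ⟶ W).app x).hom c = 0 := congrArg Prod.snd hc
  have h : ((biprod.fst ≫ biprod.inl + biprod.snd ≫ biprod.inr : V ⊞ W ⟶ V ⊞ W).app x).hom c
      = c := by
    rw [biprod.total]
    rfl
  rw [← h]
  simp only [NatTrans.app_add, ModuleCat.hom_add, LinearMap.add_apply, NatTrans.comp_app,
    ModuleCat.hom_comp, LinearMap.comp_apply, h1, h2, map_zero, add_zero]

instance : (isPwf k A).IsClosedUnderIsomorphisms where
  of_iso {V W} e hV x := by
    have := hV x
    exact Module.Finite.equiv (e.app x).toLinearEquiv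

instance : (isBounded k A).IsClosedUnderIsomorphisms where
  of_iso {V W} e hV := by
    obtain ⟨h, n, hn⟩ := hV
    exact ⟨(isPwf k A).prop_of_iso e h, n, fun x =>
      (e.app x).toLinearEquiv.finrank_eq ▸ hn x⟩

instance : (isFG k A).IsClosedUnderIsomorphisms where
  of_iso {V W} e hV := by
    obtain ⟨h, ι, hι, Q, hQ, f, hf⟩ := hV
    exact ⟨(isPwf k A).prop_of_iso e h, ι, hι, Q, hQ, f ≫ e.hom, epi_comp _ _⟩

lemma isPwf_biprod (V W : QRep k A) (hV : isPwf k A V) (hW : isPwf k A W) :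
    isPwf k A (V ⊞ W) := fun x => by
  have := hV x
  have := hW x
  exact Module.Finite.of_injective _ (biprod_obj_injective k A V W x)

instance : (isPwf k A).IsClosedUnderFiniteProducts :=
  closedUnderFiniteProducts_of_biprod _
    (fun V hV x => by
      have := subsingleton_obj_of_isZero k A hV x
      infer_instance)
    (isPwf_biprod k A)

instance : (isBounded k A).IsClosedUnderFiniteProducts :=
  closedUnderFiniteProducts_of_biprod _
    (fun V hV => ⟨fun x => by
      have := subsingleton_obj_of_isZero k A hV x
      infer_instance, 1, fun x => by
      have := subsingleton_obj_of_isZero k A hV x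
      simp [Module.finrank_zero_of_subsingleton]⟩)
    (fun V W hV hW => by
      obtain ⟨hV, n, hn⟩ := hV
      obtain ⟨hW, m, hm⟩ := hW
      refine ⟨isPwf_biprod k A V W hV hW, n + m, fun x => ?_⟩
      have := hV x
      have := hW x
      have h := LinearMap.finrank_le_finrank_of_injective (biprod_obj_injective k A V W x)
      rw [Module.finrank_prod] at h
      have := hn x
      have := hm x
      omega)

instance : (isFG k A).IsClosedUnderFiniteProducts :=
  closedUnderFiniteProducts_of_biprod _
    (fun V hV => ⟨fun x => by
      have := subsingleton_obj_of_isZero k A hV x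
      infer_instance, Empty, inferInstance, Empty.elim, fun i => i.elim, 0,
      ⟨fun g h _ => hV.eq_of_src g h⟩⟩)
    (fun V W hV hW => by
      obtain ⟨hV, ι, hι, Q, hQ, f, hf⟩ := hV
      obtain ⟨hW, κ, hκ, R, hR, g, hg⟩ := hW
      refine ⟨isPwf_biprod k A V W hV hW, ι ⊕ κ, inferInstance, Sum.elim Q R,
        fun i => by cases i <;> simp [hQ, hR],
        biproduct.desc (fun i => match i with
          | Sum.inl i => biproduct.ι Q i ≫ f ≫ biprod.inl
          | Sum.inr i => biproduct.ι R i ≫ g ≫ biprod.inr), ⟨fun a b hab => ?_⟩⟩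
      apply biprod.hom_ext'
      · rw [← cancel_epi f]
        refine biproduct.hom_ext' _ _ fun i => ?_
        have h := biproduct.ι (Sum.elim Q R) (Sum.inl i) ≫= hab
        rw [biproduct.ι_desc_assoc, biproduct.ι_desc_assoc] at h
        simpa using h
      · rw [← cancel_epi g]
        refine biproduct.hom_ext' _ _ fun i => ?_
        have h := biproduct.ι (Sum.elim Q R) (Sum.inr i) ≫= hab
        rw [biproduct.ι_desc_assoc, biproduct.ι_desc_assoc] at h
        simpa using h)

end FiniteProducts

/-! ### Categorical notions -/

section Notions

/-- A vector space is isomorphic to `k` or is zero. -/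
def IsLineOrZero (k : Type u) [Field k] (X : Type v) [AddCommGroup X] [Module k X] : Prop :=
  Nonempty (X ≃ₗ[k] k) ∨ Subsingleton X

variable (C : Type v) [Category.{w} C] [Preadditive C]

/-- Every morphism has a kernel and a cokernel, and its image and its coimage coincide (that is,
the canonical morphism from the coimage to the image is an isomorphism). -/
def HasKernelsCokernelsImages : Prop :=
  ∃ (_ : HasKernels C) (_ : HasCokernels C),
    ∀ {X Y : C} (f : X ⟶ Y), IsIso (Abelian.coimageImageComparison f)

variable {C} in
/-- The abelian category structure (extending the given additive one) on an additive category in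
which kernels and cokernels exist and images and coimages coincide. -/
@[reducible]
noncomputable def HasKernelsCokernelsImages.abelian [HasFiniteProducts C]
    (h : HasKernelsCokernelsImages C) : Abelian C :=
  letI := h.choose
  letI := h.choose_spec.choose
  letI : ∀ {X Y : C} (f : X ⟶ Y), IsIso (Abelian.coimageImageComparison f) :=
    h.choose_spec.choose_spec
  Abelian.ofCoimageImageComparisonIsIso

/-- Krull-Schmidt category: every object is a finite direct sum of objects with local
endomorphism rings. -/
def IsKrullSchmidt [HasFiniteProducts C] : Prop :=
  ∀ X : C, ∃ (n : ℕ) (F : Fin n → C),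
    (∀ i, IsLocalRing (End (F i))) ∧ Nonempty (X ≅ ⨁ F)

/-- A category is artinian if every object satisfies the descending chain condition on
subobjects. -/
def IsArtinianCategory : Prop := ∀ X : C, IsArtinianObject X

/-- All Hom spaces between indecomposable objects are `k` or `0`. -/
def HomLineOrZero (k : Type u) [Field k] [Linear k C] [HasFiniteProducts C] : Prop :=
  ∀ X Y : C, Indecomposable X → Indecomposable Y → IsLineOrZero k (X ⟶ Y)

/-- Auslander-Reiten (almost split) sequences. -/
structure IsARSequence {C : Type v} [Category.{w} C] [Preadditive C] [HasFiniteProducts C]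
    (T : ShortComplex C) : Prop where
  shortExact : T.ShortExact
  not_section : ¬ IsSplitMono T.f
  not_retraction : ¬ IsSplitEpi T.g
  indecomposable_left : Indecomposable T.X₁
  indecomposable_right : Indecomposable T.X₃
  left_almost_split : ∀ (X : C) (h : T.X₁ ⟶ X), Indecomposable X → h ≠ 0 →
    ¬ Nonempty (T.X₁ ≅ X) → ∃ h' : T.X₂ ⟶ X, T.f ≫ h' = h
  right_almost_split : ∀ (X : C) (h : X ⟶ T.X₃), Indecomposable X → h ≠ 0 →
    ¬ Nonempty (X ≅ T.X₃) → ∃ h' : X ⟶ T.X₂, h' ≫ T.g = h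

end Notions

section AbelianNotions

variable (C : Type v) [Category.{w} C] [Abelian C]

/-- The global dimension of an abelian category. -/
noncomputable def globalDimension : WithBot ℕ∞ := ⨆ X : C, projectiveDimension X

/-- All first Ext spaces between indecomposable objects are `k` or `0`. -/
def ExtLineOrZero (k : Type u) [Field k] [Linear k C] : Prop :=
  letI := HasExt.standard C
  ∀ X Y : C, Indecomposable X → Indecomposable Y →
    IsLineOrZero k (Abelian.Ext.{max v w} X Y 1)

end AbelianNotions

section Particular

variable (k : Type u) [Field k] (A : ContinuousQuiverA)

/-- The indecomposable objects of a subcategory of representations are exactly its objects that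
are isomorphic to an interval representation `M_I` with `I` a nonempty interval. -/
def IndecomposablesAreIntervals (P : ObjectProperty (QRep k A))
    [HasFiniteProducts P.FullSubcategory] : Prop :=
  ∀ V : P.FullSubcategory, Indecomposable V ↔
    ∃ (I : Set ℝ) (_ : I.OrdConnected), I.Nonempty ∧ Nonempty (V.obj ≅ intervalRep k A I)

/-- For intervals `I₁, I₂, J, I₃` the sequence
`0 ⟶ M_{I₁} ⟶ M_{I₂} ⊕ M_J ⟶ M_{I₃} ⟶ 0`, with the maps given by the canonical matrices
`(1, 1)` and `(1, -1)`, lies in the category of finitely generated representations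
and is an Auslander-Reiten sequence there. -/
def IsIntervalARSequence (I₁ I₂ J I₃ : Set ℝ) [I₁.OrdConnected] [I₂.OrdConnected]
    [J.OrdConnected] [I₃.OrdConnected] : Prop :=
  ∃ (h₁ : isFG k A (intervalRep k A I₁)) (h₂ : isFG k A (intervalRep k A I₂))
    (h : isFG k A (intervalRep k A J)) (h₃ : isFG k A (intervalRep k A I₃))
    (f : (⟨_, h₁⟩ : RepFG k A) ⟶ ⟨_, h₂⟩) (f' : (⟨_, h₁⟩ : RepFG k A) ⟶ ⟨_, h⟩)
    (g : (⟨_, h₂⟩ : RepFG k A) ⟶ ⟨_, h₃⟩) (g' : (⟨_, h⟩ : RepFG k A) ⟶ ⟨_, h₃⟩)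
    (zero : biprod.lift f f' ≫ biprod.desc g (-g') = 0),
    IsCanonicalHom f.hom ∧ IsCanonicalHom f'.hom ∧ IsCanonicalHom g.hom ∧
    IsCanonicalHom g'.hom ∧
    IsARSequence (ShortComplex.mk (biprod.lift f f') (biprod.desc g (-g')) zero)

/-- The interval representation `M_I` lies in the category of finitely generated
representations, and no Auslander-Reiten sequence of that category starts or ends in it. -/
def NoARSequence (I : Set ℝ) [I.OrdConnected] : Prop :=
  isFG k A (intervalRep k A I) ∧
  ∀ T : ShortComplex (RepFG k A), IsARSequence T →
    ¬ Nonempty (T.X₁.obj ≅ intervalRep k A I) ∧ ¬ Nonempty (T.X₃.obj ≅ intervalRep k A I)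

end Particular

/-! ### Segments between consecutive sinks and sources, and zigzag induction -/

namespace ContinuousQuiverA

variable (A : ContinuousQuiverA)

lemma finite_inter_Icc (a b : ℝ) : (A.S ∩ Set.Icc a b).Finite := by
  by_contra h
  obtain ⟨x, -, hx⟩ := Set.Infinite.exists_accPt_of_subset_isCompact h isCompact_Icc
    Set.inter_subset_right
  exact A.no_accPt x (hx.mono (Filter.principal_mono.2 Set.inter_subset_left))

lemma exists_greatest_le (y : ℝ) :
    ∃ u : {x : EReal | x = ⊥ ∨ x = ⊤ ∨ ∃ r ∈ A.S, x = (r : EReal)}, (u : EReal) ≤ y ∧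
      ∀ w : {x : EReal | x = ⊥ ∨ x = ⊤ ∨ ∃ r ∈ A.S, x = (r : EReal)}, (w : EReal) ≤ y → w ≤ u := by
  by_cases h : ∃ r ∈ A.S, r ≤ y
  · obtain ⟨r, hr, hry⟩ := h
    obtain ⟨m, hm, hmax⟩ := Set.exists_max_image (A.S ∩ Set.Icc r y) id (A.finite_inter_Icc r y)
      ⟨r, hr, le_rfl, hry⟩
    refine ⟨⟨m, Or.inr (Or.inr ⟨m, hm.1, rfl⟩)⟩, EReal.coe_le_coe_iff.2 hm.2.2, ?_⟩
    rintro ⟨w, rfl | rfl | ⟨t, ht, rfl⟩⟩ hw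
    · exact bot_le (a := (m : EReal))
    · exact absurd hw (not_le.2 (EReal.coe_lt_top y))
    · refine EReal.coe_le_coe_iff.2 ?_
      rcases le_total r t with h | h
      · exact hmax t ⟨ht, h, EReal.coe_le_coe_iff.1 hw⟩
      · exact h.trans hm.2.1
  · refine ⟨⟨⊥, Or.inl rfl⟩, bot_le, ?_⟩
    rintro ⟨w, rfl | rfl | ⟨t, ht, rfl⟩⟩ hw
    · exact le_rfl
    · exact absurd hw (not_le.2 (EReal.coe_lt_top y))
    · exact absurd ⟨t, ht, EReal.coe_le_coe_iff.1 hw⟩ h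

lemma exists_least_gt (y : ℝ) :
    ∃ u : {x : EReal | x = ⊥ ∨ x = ⊤ ∨ ∃ r ∈ A.S, x = (r : EReal)}, (y : EReal) < u ∧
      ∀ w : {x : EReal | x = ⊥ ∨ x = ⊤ ∨ ∃ r ∈ A.S, x = (r : EReal)}, (y : EReal) < w → u ≤ w := by
  by_cases h : ∃ r ∈ A.S, y < r
  · obtain ⟨r, hr, hry⟩ := h
    obtain ⟨m, hm, hmin⟩ := Set.exists_min_image ((A.S ∩ Set.Icc y r) \ {y}) id
      ((A.finite_inter_Icc y r).subset Set.sdiff_subset) ⟨r, ⟨hr, hry.le, le_rfl⟩, hry.ne'⟩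
    have hym : y < m := lt_of_le_of_ne hm.1.2.1 (Ne.symm hm.2)
    refine ⟨⟨m, Or.inr (Or.inr ⟨m, hm.1.1, rfl⟩)⟩, EReal.coe_lt_coe_iff.2 hym, ?_⟩
    rintro ⟨w, rfl | rfl | ⟨t, ht, rfl⟩⟩ hw
    · exact absurd hw not_lt_bot
    · exact le_top (a := (m : EReal))
    · refine EReal.coe_le_coe_iff.2 ?_
      have hyt := EReal.coe_lt_coe_iff.1 hw
      rcases le_total t r with h | h
      · exact hmin t ⟨⟨ht, hyt.le, h⟩, hyt.ne'⟩
      · exact hm.1.2.2.trans h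
  · refine ⟨⟨⊤, Or.inr (Or.inl rfl)⟩, EReal.coe_lt_top y, ?_⟩
    rintro ⟨w, rfl | rfl | ⟨t, ht, rfl⟩⟩ hw
    · exact absurd hw not_lt_bot
    · exact le_rfl
    · exact absurd ⟨t, ht, EReal.coe_lt_coe_iff.1 hw⟩ h

lemma ofInt_lt_ofInt {m n : ℤ} : ExtInt.ofInt m < ExtInt.ofInt n ↔ m < n := by
  rw [ExtInt.ofInt, ExtInt.ofInt, WithBot.coe_lt_coe, WithTop.coe_lt_coe]

lemma extInt_cases (i : ExtInt) : i = ⊥ ∨ i = ⊤ ∨ ∃ n, i = ExtInt.ofInt n := by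
  induction i using WithBot.recBotCoe with
  | bot => exact Or.inl rfl
  | coe i =>
    induction i using WithTop.recTopCoe with
    | top => exact Or.inr (Or.inl rfl)
    | coe n => exact Or.inr (Or.inr ⟨n, rfl⟩)

lemma bot_lt_ofInt (n : ℤ) : ⊥ < ExtInt.ofInt n := WithBot.bot_lt_coe _

lemma ofInt_lt_top (n : ℤ) : ExtInt.ofInt n < ⊤ := WithBot.coe_lt_coe.2 (WithTop.coe_lt_top n)

/-- Convexity leaves no gap in X, while infinitely many integers lie between an integer and an
infinite index. The remaining pair of indices -∞, +∞ is excluded because 0 belongs to X. -/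
lemma exists_consecutive_of_ordConnected {X : Set ExtInt} (hX : X.OrdConnected)
    (h0 : ExtInt.ofInt 0 ∈ X) {i j : ExtInt} (hi : i ∈ X) (hj : j ∈ X) (hij : i < j)
    (h : ∀ l ∈ X, l ≤ i ∨ j ≤ l) : ∃ n : ℤ, i = ExtInt.ofInt n ∧ j = ExtInt.ofInt (n + 1) := by
  have key : ∀ l : ExtInt, i < l → l < j → False := fun l h1 h2 =>
    (h l (hX.out hi hj ⟨h1.le, h2.le⟩)).elim (not_le.2 h1) (not_le.2 h2)
  rcases extInt_cases i with rfl | rfl | ⟨n, rfl⟩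
  · exfalso
    rcases h _ h0 with h0 | h0
    · exact not_le.2 (bot_lt_ofInt 0) h0
    rcases extInt_cases j with rfl | rfl | ⟨m, rfl⟩
    · exact lt_irrefl _ hij
    · exact not_le.2 (ofInt_lt_top 0) h0
    · exact key (ExtInt.ofInt (m - 1)) (bot_lt_ofInt _) (ofInt_lt_ofInt.2 (by omega))
  · exact absurd hij not_top_lt
  · refine ⟨n, rfl, ?_⟩
    rcases extInt_cases j with rfl | rfl | ⟨m, rfl⟩
    · exact absurd hij not_lt_bot
    · exact (key (ExtInt.ofInt (n + 1)) (ofInt_lt_ofInt.2 (by omega)) (ofInt_lt_top _)).elim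
    · rw [ofInt_lt_ofInt] at hij
      by_contra hne
      have hne' : m ≠ n + 1 := fun h => hne (by rw [h])
      exact key (ExtInt.ofInt (n + 1)) (ofInt_lt_ofInt.2 (by omega)) (ofInt_lt_ofInt.2 (by omega))

/-- Every real number lies in a segment between two consecutive elements. -/
lemma exists_segment (y : ℝ) :
    ∃ (n : ℤ) (hn : ExtInt.ofInt n ∈ A.index) (hn' : ExtInt.ofInt (n + 1) ∈ A.index),
      (A.s ⟨_, hn⟩ : EReal) ≤ y ∧ (y : EReal) < A.s ⟨_, hn'⟩ := by
  obtain ⟨u, hu, humax⟩ := A.exists_greatest_le y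
  obtain ⟨v, hv, hvmin⟩ := A.exists_least_gt y
  have huv : u < v := Subtype.coe_lt_coe.1 (hu.trans_lt hv)
  obtain ⟨n, h1, h2⟩ := exists_consecutive_of_ordConnected A.index_ordConnected A.zero_mem_index
    (A.s.symm u).2 (A.s.symm v).2 (by simpa using huv) (by
      intro l hl
      rcases le_or_gt (A.s ⟨l, hl⟩ : EReal) y with h | h
      · left
        have := humax _ h
        rw [← A.s.le_symm_apply] at this
        exact this
      · right
        have := hvmin _ h
        rw [← A.s.symm_apply_le] at this
        exact this)
  have hn : ExtInt.ofInt n ∈ A.index := h1 ▸ (A.s.symm u).2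
  have hn' : ExtInt.ofInt (n + 1) ∈ A.index := h2 ▸ (A.s.symm v).2
  refine ⟨n, hn, hn', ?_, ?_⟩
  · have : A.s ⟨_, hn⟩ = u := by
      rw [← A.s.apply_symm_apply u]
      congr 1
      exact Subtype.ext h1.symm
    rw [this]; exact hu
  · have : A.s ⟨_, hn'⟩ = v := by
      rw [← A.s.apply_symm_apply v]
      congr 1
      exact Subtype.ext h2.symm
    rw [this]; exact hv

lemma mem_S_of_s_eq {i : A.index} {y : ℝ} (h : (A.s i : EReal) = y) : y ∈ A.S := by
  rcases (A.s i).2 with h' | h' | ⟨r, hr, h'⟩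
  · rw [h] at h'; simp at h'
  · rw [h] at h'; simp at h'
  · rw [h] at h'
    exact EReal.coe_eq_coe_iff.1 h' ▸ hr

/-- There is no element of `S` strictly between `s n` and `s (n + 1)`. -/
lemma notMem_S_of_mem_segment {n : ℤ} {hn : ExtInt.ofInt n ∈ A.index}
    {hn' : ExtInt.ofInt (n + 1) ∈ A.index} {y : ℝ} (h1 : (A.s ⟨_, hn⟩ : EReal) < y)
    (h2 : (y : EReal) < A.s ⟨_, hn'⟩) : y ∉ A.S := by
  intro hy
  set v : {x : EReal | x = ⊥ ∨ x = ⊤ ∨ ∃ r ∈ A.S, x = (r : EReal)} :=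
    ⟨y, Or.inr (Or.inr ⟨y, hy, rfl⟩)⟩
  have h1' : A.s ⟨_, hn⟩ < v := h1
  have h2' : v < A.s ⟨_, hn'⟩ := h2
  rw [← A.s.lt_symm_apply] at h1'
  rw [← A.s.symm_apply_lt] at h2'
  have h1'' : ExtInt.ofInt n < (A.s.symm v : ExtInt) := h1'
  have h2'' : (A.s.symm v : ExtInt) < ExtInt.ofInt (n + 1) := h2'
  rcases extInt_cases (A.s.symm v) with h | h | ⟨m, h⟩
  · rw [h] at h1''; exact not_lt_bot h1''
  · rw [h] at h2''; exact not_top_lt h2''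
  · rw [h, ofInt_lt_ofInt] at h1'' h2''
    omega

lemma exists_open_segment {y : ℝ} (hy : y ∉ A.S) :
    ∃ (n : ℤ) (hn : ExtInt.ofInt n ∈ A.index) (hn' : ExtInt.ofInt (n + 1) ∈ A.index),
      (A.s ⟨_, hn⟩ : EReal) < y ∧ (y : EReal) < A.s ⟨_, hn'⟩ := by
  obtain ⟨n, hn, hn', h1, h2⟩ := A.exists_segment y
  exact ⟨n, hn, hn', lt_of_le_of_ne h1 fun h => hy (A.mem_S_of_s_eq h), h2⟩

/-- Points without an element of `S` strictly between them lie in a common segment. -/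
lemma exists_common_segment {x y : ℝ} (hxy : x < y) (h : ∀ z ∈ A.S, x < z → z < y → False) :
    ∃ (n : ℤ) (hn : ExtInt.ofInt n ∈ A.index) (hn' : ExtInt.ofInt (n + 1) ∈ A.index),
      (A.s ⟨_, hn⟩ : EReal) ≤ x ∧ (y : EReal) ≤ A.s ⟨_, hn'⟩ := by
  -- Any m strictly between x and y is off S. The open segment around m reaches both x and y, since
  -- an end strictly inside would be an element of S between them.
  obtain ⟨m, hxm, hmy⟩ := exists_between hxy
  obtain ⟨n, hn, hn', h1, h2⟩ := A.exists_open_segment (fun hm => h m hm hxm hmy)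
  refine ⟨n, hn, hn', ?_, ?_⟩
  · rcases (A.s ⟨_, hn⟩).2 with h' | h' | ⟨r, hr, h'⟩
    · rw [h']; exact bot_le
    · rw [h'] at h1; simp at h1
    · rw [h'] at h1 ⊢
      rw [EReal.coe_le_coe_iff]
      by_contra hlt
      exact h r hr (not_le.1 hlt) ((EReal.coe_lt_coe_iff.1 h1).trans hmy)
  · rcases (A.s ⟨_, hn'⟩).2 with h' | h' | ⟨r, hr, h'⟩
    · rw [h'] at h2; simp at h2
    · rw [h']; exact le_top
    · rw [h'] at h2 ⊢
      rw [EReal.coe_le_coe_iff]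
      by_contra hlt
      exact h r hr (hxm.trans (EReal.coe_lt_coe_iff.1 h2)) (not_le.1 hlt)

lemma le_of_mem_segment {n : ℤ} {hn : ExtInt.ofInt n ∈ A.index}
    {hn' : ExtInt.ofInt (n + 1) ∈ A.index} {x y : EReal} (hx : (A.s ⟨_, hn⟩ : EReal) ≤ x)
    (hxy : x ≤ y) (hy : y ≤ A.s ⟨_, hn'⟩) : (Even n → A.le x y) ∧ (Odd n → A.le y x) :=
  ⟨fun e => Or.inr ⟨n, hn, hn', ⟨hx, hxy.trans hy⟩, ⟨hx.trans hxy, hy⟩, Or.inl ⟨e, hxy⟩⟩,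
    fun e => Or.inr ⟨n, hn, hn', ⟨hx.trans hxy, hy⟩, ⟨hx, hxy.trans hy⟩, Or.inr ⟨e, hxy⟩⟩⟩

lemma comparable_of_lt {x y : ℝ} (hxy : x < y) (h : ∀ z ∈ A.S, x < z → z < y → False) :
    A.le x y ∨ A.le y x := by
  obtain ⟨n, hn, hn', h1, h2⟩ := A.exists_common_segment hxy h
  have := A.le_of_mem_segment h1 (EReal.coe_le_coe_iff.2 hxy.le) h2
  rcases Int.even_or_odd n with e | e
  · exact Or.inl (this.1 e)
  · exact Or.inr (this.2 e)

lemma comparable_of_uIcc {x y : ℝ} (h : ∀ z ∈ A.S, z ∉ Set.uIcc x y) :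
    A.le x y ∨ A.le y x := by
  rcases lt_trichotomy x y with hxy | rfl | hxy
  · exact A.comparable_of_lt hxy fun z hz h1 h2 => h z hz (Set.mem_uIcc.2 (Or.inl ⟨h1.le, h2.le⟩))
  · exact Or.inl (A.le_refl _)
  · exact (A.comparable_of_lt hxy fun z hz h1 h2 =>
      h z hz (Set.mem_uIcc.2 (Or.inr ⟨h1.le, h2.le⟩))).symm

lemma le_antisymm {x y : EReal} (h : A.le x y) (h' : A.le y x) : x = y := by
  have := A.mem_uIcc_of_le h h'
  rw [Set.uIcc_self] at this
  exact (Set.mem_singleton_iff.1 this).symm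

lemma mem_uIcc_of_le_real {x y z : ℝ} (hzy : A.le z y) (hyx : A.le y x) : y ∈ Set.uIcc z x := by
  have := A.mem_uIcc_of_le hzy hyx
  rw [Set.mem_uIcc] at this ⊢
  simpa only [EReal.coe_le_coe_iff] using this

lemma le_left_of_mem_uIcc {x y a : EReal} (hx : A.le x a) (hy : y ∈ Set.uIcc x a) : A.le x y := by
  rw [Set.mem_uIcc] at hy
  rcases hx with rfl | ⟨n, hn, hn', hx, ha, h⟩
  · rcases hy with hy | hy <;> exact Or.inl (_root_.le_antisymm (by tauto) (by tauto))
  refine Or.inr ⟨n, hn, hn', hx, ?_, ?_⟩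
  · rcases hy with hy | hy
    · exact ⟨hx.1.trans hy.1, hy.2.trans ha.2⟩
    · exact ⟨ha.1.trans hy.1, hy.2.trans hx.2⟩
  · rcases h with ⟨e, h⟩ | ⟨e, h⟩
    · exact Or.inl ⟨e, hy.elim (fun h' => h'.1) (fun h' => h.trans h'.1)⟩
    · exact Or.inr ⟨e, hy.elim (fun h' => h'.2.trans h) (fun h' => h'.2)⟩

lemma uIcc_coe {x y z : ℝ} : (y : EReal) ∈ Set.uIcc (x : EReal) z ↔ y ∈ Set.uIcc x z := by
  simp only [Set.mem_uIcc, EReal.coe_le_coe_iff]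

lemma le_of_mem_uIcc_real {x y a : ℝ} (hx : A.le x a) (hy : y ∈ Set.uIcc x a) :
    A.le x y ∧ A.le y a :=
  ⟨A.le_left_of_mem_uIcc hx (uIcc_coe.2 hy), A.le_of_mem_uIcc hx (uIcc_coe.2 hy)⟩

/-- Induction along the zigzag, with steps that contain no element of the finite set `Y`. -/
lemma zigzag_induction {Q : ℝ → ℝ → Prop} {Y : Set ℝ} (hY : Y.Finite)
    (hle : ∀ x y : ℝ, A.le x y → (∀ z ∈ Y, z ∈ Set.uIcc x y → z = x ∨ z = y) → Q x y)
    (hge : ∀ x y : ℝ, A.le y x → (∀ z ∈ Y, z ∈ Set.uIcc x y → z = x ∨ z = y) → Q x y)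
    (htrans : ∀ x y z, y ∈ Set.uIcc x z → Q x y → Q y z → Q x z) (x y : ℝ) : Q x y := by
  have hfin' : ∀ a b : ℝ, ((A.S ∪ Y) ∩ Set.Icc a b).Finite := fun a b => by
    rw [Set.union_inter_distrib_right]
    exact (A.finite_inter_Icc a b).union (hY.subset Set.inter_subset_left)
  -- Induction on the number of points of S ∪ Y strictly between x and y. With none, x and y are
  -- comparable and form a single step; otherwise cutting at such a point lowers the count on both
  -- sides.
  have key : ∀ N : ℕ, ∀ x y : ℝ, ((A.S ∪ Y) ∩ Set.Ioo (min x y) (max x y)).ncard ≤ N → Q x y := by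
    intro N
    induction N with
    | zero =>
      intro x y h
      have hfin : ((A.S ∪ Y) ∩ Set.Ioo (min x y) (max x y)).Finite :=
        (hfin' _ _).subset (Set.inter_subset_inter_right _ Set.Ioo_subset_Icc_self)
      have h0 : (A.S ∪ Y) ∩ Set.Ioo (min x y) (max x y) = ∅ := (Set.ncard_eq_zero hfin).1 (by omega)
      have hS : ∀ z ∈ A.S ∪ Y, min x y < z → z < max x y → False := fun z hz h1 h2 => by
        have : z ∈ (A.S ∪ Y) ∩ Set.Ioo (min x y) (max x y) := ⟨hz, h1, h2⟩
        simp [h0] at this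
      have hY' : ∀ z ∈ Y, z ∈ Set.uIcc x y → z = x ∨ z = y := fun z hz hz' => by
        have h1 := hS z (Or.inr hz)
        have h2 := hz'.1
        have h3 := hz'.2
        grind
      rcases lt_trichotomy x y with hxy | rfl | hxy
      · rw [min_eq_left hxy.le, max_eq_right hxy.le] at hS
        exact (A.comparable_of_lt hxy fun z hz => hS z (Or.inl hz)).elim
          (fun h => hle _ _ h hY') (fun h => hge _ _ h hY')
      · exact hle _ _ (A.le_refl _) hY'
      · rw [min_eq_right hxy.le, max_eq_left hxy.le] at hS
        exact (A.comparable_of_lt hxy fun z hz => hS z (Or.inl hz)).elim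
          (fun h => hge _ _ h hY') (fun h => hle _ _ h hY')
    | succ N ih =>
      intro x y h
      have hfin : ((A.S ∪ Y) ∩ Set.Ioo (min x y) (max x y)).Finite :=
        (hfin' _ _).subset (Set.inter_subset_inter_right _ Set.Ioo_subset_Icc_self)
      by_cases h0 : ((A.S ∪ Y) ∩ Set.Ioo (min x y) (max x y)) = ∅
      · exact ih x y (by rw [h0]; simp)
      obtain ⟨z, hzS, hz1, hz2⟩ := Set.nonempty_iff_ne_empty.2 h0
      have hz : z ∈ Set.uIcc x y := ⟨hz1.le, hz2.le⟩
      have hsub : ∀ x' y', min x y ≤ min x' y' → max x' y' ≤ max x y →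
          (max x' y' ≤ z ∨ z ≤ min x' y') → Q x' y' := by
        intro x' y' h1 h2 h3
        apply ih
        have : ((A.S ∪ Y) ∩ Set.Ioo (min x' y') (max x' y')).ncard <
            ((A.S ∪ Y) ∩ Set.Ioo (min x y) (max x y)).ncard := by
          refine Set.ncard_lt_ncard ⟨?_, fun hss => ?_⟩ hfin
          · exact Set.inter_subset_inter_right _ (Set.Ioo_subset_Ioo h1 h2)
          · have := (hss ⟨hzS, hz1, hz2⟩).2
            rcases h3 with h3 | h3
            · exact absurd this.2 (not_lt.2 h3)
            · exact absurd this.1 (not_lt.2 h3)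
        omega
      rcases le_total x y with hxy | hxy
      · rw [min_eq_left hxy] at hz1
        rw [max_eq_right hxy] at hz2
        refine htrans x z y hz (hsub x z ?_ ?_ ?_) (hsub z y ?_ ?_ ?_) <;>
        simp [hxy, hz1.le, hz2.le]
      · rw [min_eq_right hxy] at hz1
        rw [max_eq_left hxy] at hz2
        refine htrans x z y hz (hsub x z ?_ ?_ ?_) (hsub z y ?_ ?_ ?_) <;>
        simp [hxy, hz1.le, hz2.le]
  exact key _ x y le_rfl

end ContinuousQuiverA

/-! ### Betweenness of vertices -/

namespace ContinuousQuiverA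

variable {A : ContinuousQuiverA}

/-- The vertices between two given ones. -/
def between (x y : A.Vertex) : Set A.Vertex := {z | z.val ∈ Set.uIcc x.val y.val}

lemma mem_between {x y z : A.Vertex} : z ∈ between x y ↔ z.val ∈ Set.uIcc x.val y.val := Iff.rfl

lemma left_mem_between (x y : A.Vertex) : x ∈ between x y := Set.left_mem_uIcc (a := x.val)

lemma right_mem_between (x y : A.Vertex) : y ∈ between x y := Set.right_mem_uIcc (b := y.val)

lemma between_comm (x y : A.Vertex) : between x y = between y x := by
  ext z; rw [mem_between, mem_between, Set.uIcc_comm]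

lemma hom_of_mem_between {x y z : A.Vertex} (h : x ⟶ z) (hy : y ∈ between x z) :
    Nonempty (x ⟶ y) ∧ Nonempty (y ⟶ z) := by
  have := A.le_of_mem_uIcc_real h.down (by rw [Set.uIcc_comm]; exact hy)
  exact ⟨⟨⟨this.2⟩⟩, ⟨⟨this.1⟩⟩⟩

lemma mem_between_of_hom {x y z : A.Vertex} (h : x ⟶ y) (h' : y ⟶ z) : y ∈ between x z := by
  rw [between_comm]
  exact A.mem_uIcc_of_le_real h'.down h.down

lemma between_eq_union {x y z : A.Vertex} (hy : y ∈ between x z) :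
    between x z = between x y ∪ between y z := by
  ext t
  simp only [between, Set.mem_union, Set.mem_ofPred_eq, Set.mem_uIcc] at *
  grind

/-- A point common to the two parts of an interval separates these parts. -/
lemma mem_between_of_mem {x y z s t : A.Vertex} (hy : y ∈ between x z) (hs : s ∈ between x y)
    (ht : t ∈ between y z) : y ∈ between s t := by
  simp only [between, Set.mem_ofPred_eq, Set.mem_uIcc] at *
  grind

lemma vertex_zigzag_induction_of_finite {Q : A.Vertex → A.Vertex → Prop} {Y : Set A.Vertex}
    (hY : Y.Finite)
    (hle : ∀ x y, (x ⟶ y) → (∀ z ∈ Y, z ∈ between x y → z = x ∨ z = y) → Q x y)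
    (hge : ∀ x y, (y ⟶ x) → (∀ z ∈ Y, z ∈ between x y → z = x ∨ z = y) → Q x y)
    (htrans : ∀ x y z, y ∈ between x z → Q x y → Q y z → Q x z) (x y : A.Vertex) : Q x y :=
  A.zigzag_induction (Q := Q) (Y := Y) hY (fun x y h => hge x y ⟨h⟩) (fun x y h => hle x y ⟨h⟩)
    htrans x y

lemma vertex_zigzag_induction {Q : A.Vertex → A.Vertex → Prop} (hle : ∀ x y, (x ⟶ y) → Q x y)
    (hge : ∀ x y, (y ⟶ x) → Q x y)
    (htrans : ∀ x y z, y ∈ between x z → Q x y → Q y z → Q x z) (x y : A.Vertex) : Q x y :=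
  vertex_zigzag_induction_of_finite Set.finite_empty (fun x y h _ => hle x y h)
    (fun x y h _ => hge x y h) htrans x y

end ContinuousQuiverA

/-! ### Down-sets and the supports of the listed projectives -/

namespace ContinuousQuiverA

variable (A : ContinuousQuiverA)

lemma index_eq_of_mem_segments {m n : ℤ} {hm : ExtInt.ofInt m ∈ A.index}
    {hm' : ExtInt.ofInt (m + 1) ∈ A.index} {hn : ExtInt.ofInt n ∈ A.index}
    {hn' : ExtInt.ofInt (n + 1) ∈ A.index} {c : EReal}
    (h1 : (A.s ⟨_, hn⟩ : EReal) < c) (h2 : c < A.s ⟨_, hn'⟩)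
    (h : c ∈ Set.Icc (A.s ⟨_, hm⟩ : EReal) (A.s ⟨_, hm'⟩)) : m = n := by
  by_contra hne
  rcases lt_or_gt_of_ne hne with h' | h'
  · have := (A.s_le_s hm' hn).2 (by omega)
    exact absurd (h.2.trans this) (not_le.2 h1)
  · have := (A.s_le_s hn' hm).2 (by omega)
    exact absurd (this.trans h.1) (not_le.2 h2)

/-- The points below an interior point of a segment. -/
lemma le_iff_of_mem_segment {n : ℤ} {hn : ExtInt.ofInt n ∈ A.index}
    {hn' : ExtInt.ofInt (n + 1) ∈ A.index} {c z : EReal}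
    (h1 : (A.s ⟨_, hn⟩ : EReal) < c) (h2 : c < A.s ⟨_, hn'⟩) :
    A.le z c ↔ (Even n ∧ (A.s ⟨_, hn⟩ : EReal) ≤ z ∧ z ≤ c) ∨
      (Odd n ∧ c ≤ z ∧ z ≤ A.s ⟨_, hn'⟩) := by
  constructor
  · rintro (rfl | ⟨m, hm, hm', hz, hc, h⟩)
    · exact (Int.even_or_odd n).imp (fun h => ⟨h, h1.le, le_rfl⟩) (fun h => ⟨h, le_rfl, h2.le⟩)
    · obtain rfl := A.index_eq_of_mem_segments h1 h2 hc
      exact h.imp (fun h => ⟨h.1, hz.1, h.2⟩) (fun h => ⟨h.1, h.2, hz.2⟩)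
  · rintro (⟨e, h, h'⟩ | ⟨e, h, h'⟩)
    · exact (A.le_of_mem_segment h h' h2.le).1 e
    · exact (A.le_of_mem_segment h1.le h h').2 e

/-- The points above an interior point of a segment. -/
lemma ge_iff_of_mem_segment {n : ℤ} {hn : ExtInt.ofInt n ∈ A.index}
    {hn' : ExtInt.ofInt (n + 1) ∈ A.index} {c z : EReal}
    (h1 : (A.s ⟨_, hn⟩ : EReal) < c) (h2 : c < A.s ⟨_, hn'⟩) :
    A.le c z ↔ (Even n ∧ c ≤ z ∧ z ≤ A.s ⟨_, hn'⟩) ∨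
      (Odd n ∧ (A.s ⟨_, hn⟩ : EReal) ≤ z ∧ z ≤ c) := by
  constructor
  · rintro (rfl | ⟨m, hm, hm', hc, hz, h⟩)
    · exact (Int.even_or_odd n).imp (fun h => ⟨h, le_rfl, h2.le⟩) (fun h => ⟨h, h1.le, le_rfl⟩)
    · obtain rfl := A.index_eq_of_mem_segments h1 h2 hc
      exact h.imp (fun h => ⟨h.1, h.2, hz.2⟩) (fun h => ⟨h.1, hz.1, h.2⟩)
  · rintro (⟨e, h, h'⟩ | ⟨e, h, h'⟩)
    · exact (A.le_of_mem_segment h1.le h h').1 e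
    · exact (A.le_of_mem_segment h h' h2.le).2 e

/-- The sets of points below the listed projectives. -/
def IsListed (J : Set ℝ) : Prop := ∃ a : EReal, J = A.supp a ∨ J = A.suppLeft a ∨ J = A.suppRight a

variable {A} in
lemma IsListed.ordConnected {J : Set ℝ} (h : A.IsListed J) : J.OrdConnected := by
  obtain ⟨a, rfl | rfl | rfl⟩ := h <;> infer_instance

/-- Points below a on one side of it share a segment with a. Of two elements of S on that side, the
one nearer to a would be interior to the segment; so each side contributes at most one. -/
lemma finite_inter_supp (a : EReal) : (A.S ∩ A.supp a).Finite := by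
  have h1 : (A.S ∩ A.suppLeft a).Subsingleton := by
    have key : ∀ x ∈ A.S ∩ A.suppLeft a, ∀ y ∈ A.S ∩ A.suppLeft a, ¬ x < y := by
      intro x hx y hy hxy
      rcases hx.2.1 with h | ⟨n, hn, hn', h, h', -⟩
      · exact absurd h hx.2.2.ne
      · exact A.notMem_S_of_mem_segment (h.1.trans_lt (EReal.coe_lt_coe_iff.2 hxy))
          (hy.2.2.trans_le h'.2) hy.1
    exact fun x hx y hy => _root_.le_antisymm (not_lt.1 (key y hy x hx)) (not_lt.1 (key x hx y hy))
  have h2 : (A.S ∩ A.suppRight a).Subsingleton := by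
    have key : ∀ x ∈ A.S ∩ A.suppRight a, ∀ y ∈ A.S ∩ A.suppRight a, ¬ x < y := by
      intro x hx y hy hxy
      rcases hy.2.1 with h | ⟨n, hn, hn', h, h', -⟩
      · exact absurd h hy.2.2.ne'
      · exact A.notMem_S_of_mem_segment (h'.1.trans_lt hx.2.2)
          ((EReal.coe_lt_coe_iff.2 hxy).trans_le h.2) hx.1
    exact fun x hx y hy => _root_.le_antisymm (not_lt.1 (key y hy x hx)) (not_lt.1 (key x hx y hy))
  have h3 : {x : ℝ | (x : EReal) = a}.Subsingleton := fun x hx y hy =>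
    EReal.coe_eq_coe_iff.1 (Eq.trans hx (Eq.symm hy))
  refine ((h1.finite.union h2.finite).union h3.finite).subset ?_
  rintro x ⟨hx, hxa⟩
  rcases lt_trichotomy (x : EReal) a with h | h | h
  · exact Or.inl (Or.inl ⟨hx, hxa, h⟩)
  · exact Or.inr h
  · exact Or.inl (Or.inr ⟨hx, hxa, h⟩)

variable {A} in
lemma IsListed.finite_inter {J : Set ℝ} (h : A.IsListed J) : (A.S ∩ J).Finite := by
  obtain ⟨a, rfl | rfl | rfl⟩ := h
  · exact A.finite_inter_supp a
  · exact (A.finite_inter_supp a).subset (Set.inter_subset_inter_right _ fun x hx => hx.1)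
  · exact (A.finite_inter_supp a).subset (Set.inter_subset_inter_right _ fun x hx => hx.1)

/-- The set of points below a point of a given set. -/
def lowerSet (C : Set ℝ) : Set ℝ := {z | ∃ c ∈ C, A.le z c}

lemma lowerSet_singleton (c : ℝ) : A.lowerSet {c} = A.supp c := by
  ext z
  simp [lowerSet, supp]

/-- The lower set of a chain that does not meet `S` is listed. -/
lemma isListed_lowerSet {C : Set ℝ} (hC : ∀ x ∈ C, ∀ y ∈ C, A.le x y ∨ A.le y x)
    (hS : ∀ x ∈ C, x ∉ A.S) : A.IsListed (A.lowerSet C) := by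
  rcases C.eq_empty_or_nonempty with rfl | ⟨c, hc⟩
  -- No real number exceeds ⊤, so this listed support is empty.
  · refine ⟨⊤, Or.inr (Or.inr ?_)⟩
    ext z
    simp [lowerSet, suppRight]
  obtain ⟨n, hn, hn', h1, h2⟩ := A.exists_open_segment (hS c hc)
  have hseg : ∀ x ∈ C, (A.s ⟨_, hn⟩ : EReal) < x ∧ (x : EReal) < A.s ⟨_, hn'⟩ := by
    intro x hx
    have : (A.s ⟨_, hn⟩ : EReal) ≤ x ∧ (x : EReal) ≤ A.s ⟨_, hn'⟩ := by
      rcases hC x hx c hc with h | h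
      · rw [A.le_iff_of_mem_segment h1 h2] at h
        rcases h with ⟨-, h, h'⟩ | ⟨-, h, h'⟩
        · exact ⟨h, h'.trans h2.le⟩
        · exact ⟨h1.le.trans h, h'⟩
      · rw [A.ge_iff_of_mem_segment h1 h2] at h
        rcases h with ⟨-, h, h'⟩ | ⟨-, h, h'⟩
        · exact ⟨h1.le.trans h, h'⟩
        · exact ⟨h, h'.trans h2.le⟩
    exact ⟨lt_of_le_of_ne this.1 fun h => hS x hx (A.mem_S_of_s_eq h),
      lt_of_le_of_ne this.2 fun h => hS x hx (A.mem_S_of_s_eq h.symm)⟩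
  rcases Int.even_or_odd n with e | e
  · have hle : ∀ x ∈ C, ∀ z : EReal, A.le z x ↔ (A.s ⟨_, hn⟩ : EReal) ≤ z ∧ z ≤ x := by
      intro x hx z
      rw [A.le_iff_of_mem_segment (hseg x hx).1 (hseg x hx).2]
      simp [e, Int.not_odd_iff_even.2 e]
    -- The supremum is taken in the extended reals, so b may be the end of the segment and even
    -- infinite. Whether it is attained in C decides between the supports with and without the point
    -- b.
    set b : EReal := sSup ((↑) '' C) with hb
    have hxb : ∀ x ∈ C, (x : EReal) ≤ b := fun x hx => le_sSup (Set.mem_image_of_mem _ hx)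
    have hbs : b ≤ A.s ⟨_, hn'⟩ := sSup_le (by
      rintro _ ⟨x, hx, rfl⟩; exact (hseg x hx).2.le)
    have hleb : ∀ x ∈ C, A.le x b := fun x hx =>
      (A.le_of_mem_segment (hseg x hx).1.le (hxb x hx) hbs).1 e
    by_cases hbC : ∃ x ∈ C, (x : EReal) = b
    · obtain ⟨x, hx, hxb'⟩ := hbC
      refine ⟨b, Or.inl ?_⟩
      ext z
      exact ⟨fun ⟨y, hy, hzy⟩ => A.le_trans hzy (hleb y hy), fun hz => ⟨x, hx, hxb' ▸ hz⟩⟩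
    · push Not at hbC
      refine ⟨b, Or.inr (Or.inl ?_)⟩
      ext z
      constructor
      · rintro ⟨y, hy, hzy⟩
        exact ⟨A.le_trans hzy (hleb y hy),
          ((hle y hy z).1 hzy).2.trans_lt (lt_of_le_of_ne (hxb y hy) (hbC y hy))⟩
      · rintro ⟨hz, hzb⟩
        obtain ⟨_, ⟨y, hy, rfl⟩, hzy⟩ := lt_sSup_iff.1 hzb
        exact ⟨y, hy, A.le_left_of_mem_uIcc hz (Set.mem_uIcc.2 (Or.inl ⟨hzy.le, hxb y hy⟩))⟩
  · have hle : ∀ x ∈ C, ∀ z : EReal, A.le z x ↔ x ≤ z ∧ z ≤ A.s ⟨_, hn'⟩ := by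
      intro x hx z
      rw [A.le_iff_of_mem_segment (hseg x hx).1 (hseg x hx).2]
      simp [e, Int.not_even_iff_odd.2 e]
    set b : EReal := sInf ((↑) '' C) with hb
    have hxb : ∀ x ∈ C, b ≤ (x : EReal) := fun x hx => sInf_le (Set.mem_image_of_mem _ hx)
    have hbs : A.s ⟨_, hn⟩ ≤ b := le_sInf (by
      rintro _ ⟨x, hx, rfl⟩; exact (hseg x hx).1.le)
    have hleb : ∀ x ∈ C, A.le x b := fun x hx =>
      (A.le_of_mem_segment hbs (hxb x hx) (hseg x hx).2.le).2 e
    by_cases hbC : ∃ x ∈ C, (x : EReal) = b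
    · obtain ⟨x, hx, hxb'⟩ := hbC
      refine ⟨b, Or.inl ?_⟩
      ext z
      exact ⟨fun ⟨y, hy, hzy⟩ => A.le_trans hzy (hleb y hy), fun hz => ⟨x, hx, hxb' ▸ hz⟩⟩
    · push Not at hbC
      refine ⟨b, Or.inr (Or.inr ?_)⟩
      ext z
      constructor
      · rintro ⟨y, hy, hzy⟩
        exact ⟨A.le_trans hzy (hleb y hy),
          (lt_of_le_of_ne (hxb y hy) (hbC y hy).symm).trans_le ((hle y hy z).1 hzy).1⟩
      · rintro ⟨hz, hzb⟩
        obtain ⟨_, ⟨y, hy, rfl⟩, hzy⟩ := sInf_lt_iff.1 hzb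
        exact ⟨y, hy, A.le_left_of_mem_uIcc hz (Set.mem_uIcc.2 (Or.inr ⟨hxb y hy, hzy.le⟩))⟩

end ContinuousQuiverA

open ContinuousQuiverA

/-! ### Compactness: natural transformations from finite sets of vertices -/

section Compactness

variable {k : Type u} [Field k] {A : ContinuousQuiverA}

/-- A system of linear equations for a functional is solvable if its finite subsystems are. -/
lemma exists_functional_of_finite {J : Type*} {D : Type*} [AddCommGroup D] [Module k D]
    (d : J → D) (b : J → k) (h : ∀ s : Finset J, ∃ Φ : D →ₗ[k] k, ∀ j ∈ s, Φ (d j) = b j) :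
    ∃ Φ : D →ₗ[k] k, ∀ j, Φ (d j) = b j := by
  -- A relation among the vectors d j involves finitely many indices, and a solution of those
  -- equations shows that the same relation holds among the b j. Hence the prescription factors
  -- through D.
  have hβ : Finsupp.linearCombination k b ∈
      (LinearMap.ker (Finsupp.linearCombination k d)).dualAnnihilator := by
    rw [Submodule.mem_dualAnnihilator]
    intro c hc
    obtain ⟨Φ, hΦ⟩ := h c.support
    have h1 : Φ (Finsupp.linearCombination k d c) = Finsupp.linearCombination k b c := by
      rw [Finsupp.linearCombination_apply, Finsupp.linearCombination_apply, Finsupp.sum,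
        Finsupp.sum, map_sum]
      exact Finset.sum_congr rfl fun j hj => by rw [map_smul, hΦ j hj]
    rw [← h1, LinearMap.mem_ker.1 hc, map_zero]
  rw [← LinearMap.range_dualMap_eq_dualAnnihilator_ker] at hβ
  obtain ⟨Φ, hΦ⟩ := hβ
  refine ⟨Φ, fun j => ?_⟩
  have := LinearMap.congr_fun hΦ (Finsupp.single j 1)
  simpa using this

/-- A family of linear maps that is compatible with the structure maps between points of `X`. -/
def NatOn {M V : QRep k A} (f : ∀ x, M.obj x →ₗ[k] V.obj x) (X : Set A.Vertex) : Prop :=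
  ∀ ⦃x y : A.Vertex⦄ (h : x ⟶ y), x ∈ X → y ∈ X →
    ∀ m, f y ((M.map h).hom m) = (V.map h).hom (f x m)

lemma NatOn.mono {M V : QRep k A} {f : ∀ x, M.obj x →ₗ[k] V.obj x} {X Y : Set A.Vertex}
    (h : NatOn f Y) (hXY : X ⊆ Y) : NatOn f X := fun _ _ g hx hy => h g (hXY hx) (hXY hy)

lemma NatOn.congr {M V : QRep k A} {f g : ∀ x, M.obj x →ₗ[k] V.obj x} {X : Set A.Vertex}
    (h : NatOn f X) (hfg : ∀ x ∈ X, f x = g x) : NatOn g X := fun x y a hx hy m => by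
  rw [← hfg x hx, ← hfg y hy, h a hx hy]

lemma natOn_app {M V : QRep k A} (F : M ⟶ V) (X : Set A.Vertex) :
    NatOn (fun x => (F.app x).hom) X := fun x y h _ _ m => by
  have := F.naturality h
  exact LinearMap.congr_fun (congrArg ModuleCat.Hom.hom this) m

/-- The natural transformation given by a family of linear maps. -/
def NatOn.toHom {M V : QRep k A} {f : ∀ x, M.obj x →ₗ[k] V.obj x} (h : NatOn f Set.univ) :
    M ⟶ V where
  app x := ModuleCat.ofHom (f x)
  naturality x y g := by
    ext m
    exact h g trivial trivial m

@[simp] lemma NatOn.toHom_app {M V : QRep k A} {f : ∀ x, M.obj x →ₗ[k] V.obj x}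
    (h : NatOn f Set.univ) (x : A.Vertex) : (h.toHom.app x).hom = f x := rfl

lemma map_comp_apply (V : QRep k A) {x y z : A.Vertex} (f : x ⟶ y) (g : y ⟶ z) (v : V.obj x) :
    (V.map g).hom ((V.map f).hom v) = (V.map (f ≫ g)).hom v := by
  rw [V.map_comp]; rfl

lemma map_id_apply (V : QRep k A) {x : A.Vertex} (f : x ⟶ x) (v : V.obj x) :
    (V.map f).hom v = v := by
  have : f = 𝟙 x := rfl
  rw [this, V.map_id]; rfl

/-- Gluing of families at a common point. -/
lemma NatOn.glue {M V : QRep k A} {f g : ∀ x, M.obj x →ₗ[k] V.obj x} {x y z : A.Vertex}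
    {X₁ X₂ : Set A.Vertex} (hf : NatOn f X₁) (hg : NatOn g X₂) (hfg : f y = g y)
    (hy : y ∈ between x z) (h₁ : X₁ ⊆ between x y) (h₂ : X₂ ⊆ between y z) (hy₁ : y ∈ X₁)
    (hy₂ : y ∈ X₂) :
    ∃ e : ∀ x, M.obj x →ₗ[k] V.obj x, NatOn e (X₁ ∪ X₂) ∧
      (∀ t ∈ X₁, e t = f t) ∧ ∀ t ∈ X₂, e t = g t := by
  classical
  let e : ∀ x, M.obj x →ₗ[k] V.obj x := fun t => if t ∈ X₁ then f t else g t
  have k1 : ∀ t ∈ X₁, e t = f t := fun t ht => if_pos ht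
  have k2 : ∀ t ∈ X₂, e t = g t := fun t ht => by
    by_cases h : t ∈ X₁
    · have : t.val = y.val := by
        have := mem_between_of_mem hy (h₁ h) (h₂ ht)
        simp only [between, Set.mem_ofPred_eq, Set.uIcc_self, Set.mem_singleton_iff] at this
        exact this.symm
      have : t = y := this
      rw [k1 t h, this, hfg]
    · exact if_neg h
  have e1 := hf.congr fun t ht => (k1 t ht).symm
  have e2 := hg.congr fun t ht => (k2 t ht).symm
  refine ⟨e, ?_, k1, k2⟩
  intro s t a hs ht m
  have key : ∀ (hys : y ∈ between s t),
      (∀ b : s ⟶ y, ∀ m, e y ((M.map b).hom m) = (V.map b).hom (e s m)) →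
      (∀ b : y ⟶ t, ∀ m, e t ((M.map b).hom m) = (V.map b).hom (e y m)) →
      e t ((M.map a).hom m) = (V.map a).hom (e s m) := by
    intro hys k1 k2
    obtain ⟨⟨b⟩, ⟨c⟩⟩ := hom_of_mem_between a hys
    have : a = b ≫ c := rfl
    rw [this, ← map_comp_apply, ← map_comp_apply, k2, k1]
  rcases hs with hs | hs <;> rcases ht with ht | ht
  · exact e1 a hs ht m
  · exact key (mem_between_of_mem hy (h₁ hs) (h₂ ht))
      (fun b m => e1 b hs hy₁ m) (fun b m => e2 b hy₂ ht m)
  · refine key (by rw [between_comm]; exact mem_between_of_mem hy (h₁ ht) (h₂ hs))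
      (fun b m => e2 b hs hy₂ m) (fun b m => e1 b hy₁ ht m)
  · exact e2 a hs ht m

/-- A natural transformation between pointwise finite-dimensional representations subject to
affine conditions at the vertices exists if it exists on each finite set of vertices. -/
theorem exists_hom_of_finite {M V : QRep k A} (hM : isPwf k A M) (hV : isPwf k A V)
    (t : ∀ x, M.obj x →ₗ[k] V.obj x) (N : ∀ x, Submodule k (M.obj x →ₗ[k] V.obj x))
    (h : ∀ Y : Finset A.Vertex, ∃ f : ∀ x, M.obj x →ₗ[k] V.obj x,
      NatOn f Y ∧ ∀ x ∈ Y, f x - t x ∈ N x) :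
    ∃ F : M ⟶ V, ∀ x, (F.app x).hom - t x ∈ N x := by
  classical
  have hMx : ∀ x, Module.Finite k (M.obj x) := hM
  have hVx : ∀ x, Module.Finite k (V.obj x) := hV
  let ev : ∀ {x y : A.Vertex} (_ : M.obj x) (_ : V.obj x →ₗ[k] V.obj y)
      (_ : Module.Dual k (V.obj y)), Module.Dual k (M.obj x →ₗ[k] V.obj x) := fun m a l =>
    l ∘ₗ a ∘ₗ LinearMap.applyₗ m
  -- J1 lists the naturality equations, tested on vectors and functionals; J2 lists the affine
  -- conditions, tested on annihilators. The unknown is a functional on the direct sum of the duals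
  -- of the Hom spaces.
  let J1 := Σ (x : A.Vertex) (y : A.Vertex), (x ⟶ y) × M.obj x × Module.Dual k (V.obj y)
  let J2 := Σ (x : A.Vertex), (N x).dualAnnihilator
  let d : J1 ⊕ J2 → Π₀ x, Module.Dual k (M.obj x →ₗ[k] V.obj x) := Sum.elim
    (fun j => DFinsupp.single j.2.1 (ev ((M.map j.2.2.1).hom j.2.2.2.1) LinearMap.id j.2.2.2.2)
      + DFinsupp.single j.1 (ev j.2.2.2.1 (-(V.map j.2.2.1).hom) j.2.2.2.2))
    (fun j => DFinsupp.single j.1 j.2.1)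
  let b : J1 ⊕ J2 → k := Sum.elim (fun _ => 0) (fun j => j.2.1 (t j.1))
  obtain ⟨Φ, hΦ⟩ := exists_functional_of_finite d b (by
    intro s
    obtain ⟨f, hf, hft⟩ := h (s.biUnion fun j => Sum.elim (fun j : J1 => {j.1, j.2.1})
      (fun j : J2 => {j.1}) j)
    refine ⟨DFinsupp.lsum ℕ (fun x => Module.Dual.eval k _ (f x)), ?_⟩
    rintro (⟨x, y, a, m, l⟩ | ⟨x, l, hl⟩) hj
    · have := hf a (by
        simp only [Finset.coe_biUnion, Set.mem_iUnion]
        exact ⟨_, hj, by simp⟩) (by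
        simp only [Finset.coe_biUnion, Set.mem_iUnion]
        exact ⟨_, hj, by simp⟩) m
      simp only [d, b, Sum.elim_inl, map_add, DFinsupp.lsum_single]
      simp [ev, this]
    · have h1 := hft x (by
        simp only [Finset.mem_biUnion]
        exact ⟨_, hj, by simp⟩)
      have h2 := (Submodule.mem_dualAnnihilator l).1 hl _ h1
      rw [map_sub, sub_eq_zero] at h2
      simp only [d, b, Sum.elim_inr, DFinsupp.lsum_single]
      simpa using h2)
  -- Reflexivity of the finite-dimensional Hom spaces turns the functional back into a family of
  -- linear maps.
  let F : ∀ x, M.obj x →ₗ[k] V.obj x := fun x =>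
    (Module.evalEquiv k (M.obj x →ₗ[k] V.obj x)).symm (Φ ∘ₗ
      DFinsupp.lsingle (M := fun x => Module.Dual k (M.obj x →ₗ[k] V.obj x)) x)
  have hF : ∀ x (l : Module.Dual k (M.obj x →ₗ[k] V.obj x)), l (F x) = Φ (DFinsupp.single x l) :=
    fun x l => by simp [F]
  have hn : NatOn F Set.univ := by
    intro x y a _ _ m
    rw [← sub_eq_zero, ← Module.forall_dual_apply_eq_zero_iff k]
    intro l
    have := hΦ (Sum.inl ⟨x, y, a, m, l⟩)
    simp only [d, b, Sum.elim_inl, map_add, ← hF] at this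
    simpa [ev, sub_eq_add_neg] using this
  refine ⟨hn.toHom, fun x => ?_⟩
  rw [NatOn.toHom_app, ← Subspace.forall_mem_dualAnnihilator_apply_eq_zero_iff]
  intro l hl
  have := hΦ (Sum.inr ⟨x, l, hl⟩)
  simp only [d, b, Sum.elim_inr, ← hF] at this
  rw [map_sub, this, sub_self]

/-- A natural transformation with prescribed value at a vertex exists if it exists on all
finite sets of vertices. -/
theorem exists_hom_of_finite_of_app_eq {M V : QRep k A} (hM : isPwf k A M) (hV : isPwf k A V)
    (p : A.Vertex) (e : M.obj p →ₗ[k] V.obj p)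
    (h : ∀ Y : Finset A.Vertex, ∃ f : ∀ x, M.obj x →ₗ[k] V.obj x, NatOn f Y ∧ f p = e) :
    ∃ F : M ⟶ V, (F.app p).hom = e := by
  classical
  -- The value 0 away from p is arbitrary, because there the condition is modulo the whole Hom
  -- space.
  let t : ∀ x, M.obj x →ₗ[k] V.obj x := fun x => if hx : x = p then hx ▸ e else 0
  have htp : t p = e := by simp [t]
  obtain ⟨F, hF⟩ := exists_hom_of_finite hM hV t (fun x => if x = p then ⊥ else ⊤) (by
    intro Y
    obtain ⟨f, hf, hfp⟩ := h Y
    refine ⟨f, hf, fun x _ => ?_⟩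
    by_cases hx : x = p
    · subst hx
      simp [htp, hfp]
    · simp [hx])
  refine ⟨F, ?_⟩
  have := hF p
  simp only [htp, ↓reduceIte, Submodule.mem_bot] at this
  exact sub_eq_zero.1 this

/-- The vertices of a finite set lie between two vertices. -/
lemma exists_subset_between (Y : Finset A.Vertex) :
    ∃ x y : A.Vertex, (Y : Set A.Vertex) ⊆ between x y := by
  classical
  obtain ⟨b, hb⟩ := (Y.image fun y => |y.val|).bddAbove
  exact ⟨show A.Vertex from (-b : ℝ), show A.Vertex from b, fun y hy =>
    Set.mem_uIcc.2 (Or.inl (abs_le.1 (hb (Finset.mem_coe.2 (Finset.mem_image_of_mem _ hy)))))⟩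

end Compactness

/-! ### Chains of subspaces and adapted rank-one pairs -/

section Chains

variable {k : Type u} [Field k]

lemma IsChain.exists_least_submodule {W : Type*} [AddCommGroup W] [Module k W]
    [FiniteDimensional k W] {𝒞 : Set (Submodule k W)} (h : IsChain (· ≤ ·) 𝒞) (hne : 𝒞.Nonempty) :
    ∃ m ∈ 𝒞, ∀ x ∈ 𝒞, m ≤ x := by
  obtain ⟨m, hm, hmin⟩ := WellFounded.has_min (wellFounded_lt (α := Submodule k W)) 𝒞 hne
  refine ⟨m, hm, fun x hx => ?_⟩
  rcases h.total hm hx with h | h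
  · exact h
  · exact (eq_of_le_of_not_lt h (hmin x hx)).ge

lemma IsChain.exists_greatest_submodule {W : Type*} [AddCommGroup W] [Module k W]
    [FiniteDimensional k W] {𝒞 : Set (Submodule k W)} (h : IsChain (· ≤ ·) 𝒞) (hne : 𝒞.Nonempty) :
    ∃ m ∈ 𝒞, ∀ x ∈ 𝒞, x ≤ m := by
  obtain ⟨m, hm, hmin⟩ := WellFounded.has_min (wellFounded_gt (α := Submodule k W)) 𝒞 hne
  refine ⟨m, hm, fun x hx => ?_⟩
  rcases h.total hm hx with h | h
  · exact (eq_of_le_of_not_lt h (hmin x hx)).ge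
  · exact h

lemma isChain_insert_bot {W : Type*} [AddCommGroup W] [Module k W] {𝒞 : Set (Submodule k W)}
    (h : IsChain (· ≤ ·) 𝒞) : IsChain (· ≤ ·) (insert ⊥ 𝒞) :=
  h.insert fun _ _ _ => Or.inl bot_le

lemma isChain_insert_top {W : Type*} [AddCommGroup W] [Module k W] {𝒞 : Set (Submodule k W)}
    (h : IsChain (· ≤ ·) 𝒞) : IsChain (· ≤ ·) (insert ⊤ 𝒞) :=
  h.insert fun _ _ _ => Or.inr le_top

/-- The pair consisting of a vector and a functional is adapted to a set of subspaces: the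
endomorphism of rank one that they define preserves these subspaces in the strong sense that
each of them contains the vector or is annihilated by the functional. -/
def IsAdapted {W : Type*} [AddCommGroup W] [Module k W] (𝒞 : Set (Submodule k W)) (w : W)
    (φ : Module.Dual k W) : Prop := ∀ G ∈ 𝒞, w ∈ G ∨ G ≤ LinearMap.ker φ

/-- Let F be the least nonzero member of the first chain, G the least member of the second that
meets F nontrivially, and H the largest that does not (with ⊤ or ⊥ added so that these exist). A
nonzero w in F ∩ G lies outside H, so some φ vanishes on H but not at w. Members of the first chain
are zero or contain F; members of the second contain G or lie in H. -/
lemma exists_isAdapted {W : Type*} [AddCommGroup W] [Module k W] [FiniteDimensional k W]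
    [Nontrivial W] {𝒞 𝒟 : Set (Submodule k W)} (h𝒞 : IsChain (· ≤ ·) 𝒞)
    (h𝒟 : IsChain (· ≤ ·) 𝒟) : ∃ (w : W) (φ : Module.Dual k W), φ w = 1 ∧ IsAdapted 𝒞 w φ ∧
      IsAdapted 𝒟 w φ := by
  obtain ⟨F, ⟨hF, hF0⟩, hFmin⟩ := ((isChain_insert_top h𝒞).mono
    (Set.sep_subset (insert ⊤ 𝒞) fun F => F ≠ ⊥)).exists_least_submodule
      ⟨⊤, Set.mem_insert _ _, top_ne_bot⟩
  obtain ⟨G, ⟨hG, hG0⟩, hGmin⟩ := ((isChain_insert_top h𝒟).mono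
    (Set.sep_subset (insert ⊤ 𝒟) fun G => F ⊓ G ≠ ⊥)).exists_least_submodule
      ⟨⊤, Set.mem_insert _ _, by simpa using hF0⟩
  obtain ⟨H, ⟨hH, hH0⟩, hHmax⟩ := ((isChain_insert_bot h𝒟).mono
    (Set.sep_subset (insert ⊥ 𝒟) fun G => F ⊓ G = ⊥)).exists_greatest_submodule
      ⟨⊥, Set.mem_insert _ _, by simp⟩
  obtain ⟨w, hw, hw0⟩ := Submodule.exists_mem_ne_zero_of_ne_bot hG0
  have hwH : w ∉ H := fun hwH => hw0 (by
    have : w ∈ F ⊓ H := ⟨hw.1, hwH⟩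
    rwa [hH0, Submodule.mem_bot] at this)
  obtain ⟨φ, hφw, hφ⟩ := Submodule.exists_le_ker_of_notMem hwH
  refine ⟨w, (φ w)⁻¹ • φ, by simp [hφw], fun C hC => ?_, fun D hD => ?_⟩
  · by_cases h : C = ⊥
    · right; rw [h]; exact bot_le
    · left; exact hFmin C ⟨Set.mem_insert_of_mem _ hC, h⟩ hw.1
  · by_cases h : F ⊓ D = ⊥
    · right
      intro x hx
      have := hφ (hHmax D ⟨Set.mem_insert_of_mem _ hD, h⟩ hx)
      simp [LinearMap.mem_ker.1 this]
    · left; exact hGmin D ⟨Set.mem_insert_of_mem _ hD, h⟩ hw.2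

lemma exists_factor_of_ker_le {V W : Type*} [AddCommGroup V] [Module k V] [AddCommGroup W]
    [Module k W] (f : V →ₗ[k] W) (φ : Module.Dual k V) (h : LinearMap.ker f ≤ LinearMap.ker φ) :
    ∃ ψ : Module.Dual k W, ψ ∘ₗ f = φ := by
  have : φ ∈ LinearMap.range f.dualMap := by
    rw [LinearMap.range_dualMap_eq_dualAnnihilator_ker, Submodule.mem_dualAnnihilator]
    exact fun x hx => h hx
  obtain ⟨ψ, hψ⟩ := this
  exact ⟨ψ, hψ⟩

/-- Continuation along a map out of V. If G is the largest member missing f v, its preimage misses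
v, so φ vanishes on that preimage and factors through W / G. Adding ⊥ guarantees that G exists and
accounts for the kernel of f. -/
lemma IsAdapted.of_comap {V W : Type*} [AddCommGroup V] [Module k V] [AddCommGroup W] [Module k W]
    [FiniteDimensional k W] (f : V →ₗ[k] W) {𝒢 : Set (Submodule k W)} (h𝒢 : IsChain (· ≤ ·) 𝒢)
    {v : V} {φ : Module.Dual k V} (h : IsAdapted (Submodule.comap f '' insert ⊥ 𝒢) v φ)
    (hv : f v ≠ 0) : ∃ ψ : Module.Dual k W, ψ ∘ₗ f = φ ∧ IsAdapted 𝒢 (f v) ψ := by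
  obtain ⟨G, ⟨hG, hG0⟩, hGmax⟩ := ((isChain_insert_bot h𝒢).mono
    (Set.sep_subset (insert ⊥ 𝒢) fun G => f v ∉ G)).exists_greatest_submodule
      ⟨⊥, Set.mem_insert _ _, by simpa using hv⟩
  obtain ⟨ψ, hψ⟩ := exists_factor_of_ker_le (G.mkQ ∘ₗ f) φ (by
    rw [LinearMap.ker_comp, Submodule.ker_mkQ]
    exact (h _ ⟨G, hG, rfl⟩).resolve_left hG0)
  refine ⟨ψ ∘ₗ G.mkQ, by rw [LinearMap.comp_assoc, hψ], fun C hC => ?_⟩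
  by_cases hvC : f v ∈ C
  · exact Or.inl hvC
  · right
    intro x hx
    have : G.mkQ x = 0 := (Submodule.Quotient.mk_eq_zero G).2
      (hGmax C ⟨Set.mem_insert_of_mem _ hC, hvC⟩ hx)
    rw [LinearMap.mem_ker, LinearMap.comp_apply, this, map_zero]

/-- Continuation against a map into V. If G is the least member not killed by φ ∘ g, its image is
not killed by φ and so contains v, which can thus be lifted inside G. Adding ⊤ guarantees that G
exists and accounts for the range of g. -/
lemma IsAdapted.of_map {V W : Type*} [AddCommGroup V] [Module k V] [AddCommGroup W] [Module k W]
    [FiniteDimensional k W] (g : W →ₗ[k] V) {𝒢 : Set (Submodule k W)} (h𝒢 : IsChain (· ≤ ·) 𝒢)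
    {v : V} {φ : Module.Dual k V} (h : IsAdapted (Submodule.map g '' insert ⊤ 𝒢) v φ)
    (hv : φ ∘ₗ g ≠ 0) : ∃ w, g w = v ∧ IsAdapted 𝒢 w (φ ∘ₗ g) := by
  obtain ⟨G, ⟨hG, hG0⟩, hGmin⟩ := ((isChain_insert_top h𝒢).mono
    (Set.sep_subset (insert ⊤ 𝒢) fun G => ¬ G ≤ LinearMap.ker (φ ∘ₗ g))).exists_least_submodule
      ⟨⊤, Set.mem_insert _ _, fun h => hv (by rwa [top_le_iff, LinearMap.ker_eq_top] at h)⟩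
  obtain ⟨w, hw, hwv⟩ := (h _ ⟨G, hG, rfl⟩).resolve_right (fun h => hG0 (by
    rw [LinearMap.ker_comp]; exact Submodule.map_le_iff_le_comap.1 h))
  refine ⟨w, hwv, fun C hC => ?_⟩
  by_cases hvC : C ≤ LinearMap.ker (φ ∘ₗ g)
  · exact Or.inr hvC
  · exact Or.inl (hGmin C ⟨Set.mem_insert_of_mem _ hC, hvC⟩ hw)

lemma isAdapted_zero {W : Type*} [AddCommGroup W] [Module k W] (𝒢 : Set (Submodule k W)) :
    IsAdapted 𝒢 0 0 := fun G _ => Or.inl G.zero_mem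

end Chains

/-! ### Endomorphisms of rank one at a vertex, and Fitting's decomposition -/

section RankOne

variable {k : Type u} [Field k] {A : ContinuousQuiverA}

lemma hom_eq {x y : A.Vertex} (a b : x ⟶ y) : a = b :=
  Subsingleton.elim (α := PLift (A.le y.val x.val)) a b

lemma natOn_pair {M V : QRep k A} {e : ∀ x, M.obj x →ₗ[k] V.obj x} {x z : A.Vertex}
    (h : ∀ a : x ⟶ z, ∀ m, e z ((M.map a).hom m) = (V.map a).hom (e x m))
    (h' : ∀ a : z ⟶ x, ∀ m, e x ((M.map a).hom m) = (V.map a).hom (e z m)) : NatOn e {x, z} := by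
  rintro s t a (rfl | rfl) (rfl | rfl) m
  · rw [map_id_apply, map_id_apply]
  · exact h a m
  · exact h' a m
  · rw [map_id_apply, map_id_apply]

lemma vertex_eq_of_hom {x z : A.Vertex} (a : x ⟶ z) (b : z ⟶ x) : x = z :=
  EReal.coe_eq_coe_iff.1 (A.le_antisymm b.down a.down)

lemma exists_family {M V : QRep k A} {x z : A.Vertex} (hxz : x ≠ z)
    (a : M.obj x →ₗ[k] V.obj x) (b : M.obj z →ₗ[k] V.obj z) :
    ∃ e : ∀ x, M.obj x →ₗ[k] V.obj x, e x = a ∧ e z = b := by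
  classical
  exact ⟨Function.update (Function.update (fun _ => 0) x a) z b, by
    rw [Function.update_of_ne hxz, Function.update_self], by rw [Function.update_self]⟩

/-- Propagation of endomorphisms of rank one. -/
lemma exists_chain_forall_isAdapted {V : QRep k A} (hV : isPwf k A V) (Y : Finset A.Vertex)
    (x z : A.Vertex) (𝒢 : Set (Submodule k (V.obj z))) (h𝒢 : IsChain (· ≤ ·) 𝒢) :
    ∃ 𝓕 : Set (Submodule k (V.obj x)), IsChain (· ≤ ·) 𝓕 ∧ ∀ v φ, IsAdapted 𝓕 v φ →
      ∃ w ψ, IsAdapted 𝒢 w ψ ∧ ∃ e : ∀ x, V.obj x →ₗ[k] V.obj x,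
        NatOn e (between x z ∩ (Y ∪ {x, z})) ∧ e x = φ.smulRight v ∧ e z = ψ.smulRight w := by
  have hfin : ∀ x, Module.Finite k (V.obj x) := hV
  have hrefl : ∀ x (𝒢 : Set (Submodule k (V.obj x))), IsChain (· ≤ ·) 𝒢 →
      ∃ 𝓕 : Set (Submodule k (V.obj x)), IsChain (· ≤ ·) 𝓕 ∧ ∀ v φ, IsAdapted 𝓕 v φ →
      ∃ w ψ, IsAdapted 𝒢 w ψ ∧ ∃ e : ∀ x, V.obj x →ₗ[k] V.obj x,
        NatOn e (between x x ∩ (Y ∪ {x, x})) ∧ e x = φ.smulRight v ∧ e x = ψ.smulRight w := by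
    classical
    intro x 𝒢 h𝒢
    refine ⟨𝒢, h𝒢, fun v φ h => ⟨v, φ, h,
      Function.update (fun _ => 0) x (φ.smulRight v), ?_, by simp, by simp⟩⟩
    refine NatOn.mono (Y := {x, x}) (natOn_pair ?_ ?_) ?_
    · intro a m; rw [map_id_apply, map_id_apply]
    · intro a m; rw [map_id_apply, map_id_apply]
    · intro y hy
      have := hy.1
      simp only [between, Set.mem_ofPred_eq, Set.uIcc_self, Set.mem_singleton_iff] at this
      exact Or.inl this
  have hsub : ∀ x z : A.Vertex, (∀ y ∈ (Y : Set A.Vertex), y ∈ between x z → y = x ∨ y = z) →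
      between x z ∩ (Y ∪ {x, z}) ⊆ {x, z} := by
    rintro x z h y ⟨hy, hy' | hy'⟩
    · exact h y hy' hy
    · exact hy'
  refine vertex_zigzag_induction_of_finite (Y := (Y : Set A.Vertex)) (Q := fun x z =>
    ∀ (𝒢 : Set (Submodule k (V.obj z))), IsChain (· ≤ ·) 𝒢 →
      ∃ 𝓕 : Set (Submodule k (V.obj x)), IsChain (· ≤ ·) 𝓕 ∧ ∀ v φ, IsAdapted 𝓕 v φ →
      ∃ w ψ, IsAdapted 𝒢 w ψ ∧ ∃ e : ∀ x, V.obj x →ₗ[k] V.obj x,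
        NatOn e (between x z ∩ (Y ∪ {x, z})) ∧ e x = φ.smulRight v ∧ e z = ψ.smulRight w)
    Y.finite_toSet ?_ ?_ ?_ x z 𝒢 h𝒢
  · intro x z a hY 𝒢 h𝒢
    by_cases hxz : x = z
    · subst hxz; exact hrefl x 𝒢 h𝒢
    refine ⟨Submodule.comap (V.map a).hom '' insert ⊥ 𝒢,
      Monotone.isChain_image (fun _ _ h => Submodule.comap_mono h) (isChain_insert_bot h𝒢),
      fun v φ h => ?_⟩
    -- If the vector dies along the arrow, zero continues the endomorphism; otherwise its functional
    -- must factor through the arrow.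
    by_cases hv : (V.map a).hom v = 0
    · obtain ⟨e, he1, he2⟩ := exists_family (M := V) (V := V) hxz (φ.smulRight v) 0
      refine ⟨0, 0, isAdapted_zero 𝒢, e, (natOn_pair ?_ ?_).mono (hsub x z hY), he1, ?_⟩
      · intro b m
        have : b = a := hom_eq b a
        simp [he1, he2, this, hv]
      · intro b m
        exact absurd (vertex_eq_of_hom a b) hxz
      · rw [he2]; ext; simp
    · obtain ⟨ψ, hψ, had⟩ := h.of_comap _ h𝒢 hv
      obtain ⟨e, he1, he2⟩ := exists_family (M := V) (V := V) hxz (φ.smulRight v)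
        (ψ.smulRight ((V.map a).hom v))
      refine ⟨_, ψ, had, e, (natOn_pair ?_ ?_).mono (hsub x z hY), he1, he2⟩
      · intro b m
        have : b = a := hom_eq b a
        simp [he1, he2, this, ← hψ]
      · intro b m
        exact absurd (vertex_eq_of_hom a b) hxz
  · intro x z a hY 𝒢 h𝒢
    by_cases hxz : x = z
    · subst hxz; exact hrefl x 𝒢 h𝒢
    refine ⟨Submodule.map (V.map a).hom '' insert ⊤ 𝒢,
      Monotone.isChain_image (fun _ _ h => Submodule.map_mono h) (isChain_insert_top h𝒢),
      fun v φ h => ?_⟩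
    -- If the functional dies when restricted along the arrow, zero continues the endomorphism;
    -- otherwise its vector must be lifted.
    by_cases hv : φ ∘ₗ (V.map a).hom = 0
    · obtain ⟨e, he1, he2⟩ := exists_family (M := V) (V := V) hxz (φ.smulRight v) 0
      refine ⟨0, 0, isAdapted_zero 𝒢, e, (natOn_pair ?_ ?_).mono (hsub x z hY), he1, ?_⟩
      · intro b m
        exact absurd (vertex_eq_of_hom b a) hxz
      · intro b m
        have : b = a := hom_eq b a
        have := LinearMap.congr_fun hv m
        simp only [LinearMap.comp_apply, LinearMap.zero_apply] at this
        simp [*]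
      · rw [he2]; ext; simp
    · obtain ⟨w, hw, had⟩ := h.of_map _ h𝒢 hv
      obtain ⟨e, he1, he2⟩ := exists_family (M := V) (V := V) hxz (φ.smulRight v)
        ((φ ∘ₗ (V.map a).hom).smulRight w)
      refine ⟨w, _, had, e, (natOn_pair ?_ ?_).mono (hsub x z hY), he1, he2⟩
      · intro b m
        exact absurd (vertex_eq_of_hom b a) hxz
      · intro b m
        have : b = a := hom_eq b a
        simp [he1, he2, this, hw]
  · intro x y z hy h1 h2 𝒢 h𝒢
    obtain ⟨𝓕, h𝓕, H2⟩ := h2 𝒢 h𝒢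
    obtain ⟨𝓔, h𝓔, H1⟩ := h1 𝓕 h𝓕
    refine ⟨𝓔, h𝓔, fun v φ h => ?_⟩
    obtain ⟨w, ψ, h', e, he, hex, hey⟩ := H1 v φ h
    obtain ⟨u, χ, h'', f, hf, hfy, hfz⟩ := H2 w ψ h'
    obtain ⟨g, hg, hge, hgf⟩ := NatOn.glue he hf (hey.trans hfy.symm) hy Set.inter_subset_left
      Set.inter_subset_left ⟨right_mem_between x y, by simp⟩ ⟨left_mem_between y z, by simp⟩
    refine ⟨u, χ, h'', g, hg.mono ?_, ?_, ?_⟩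
    · rintro t ⟨ht1, ht2⟩
      have hx : x ∈ between x y := left_mem_between x y
      have hz : z ∈ between y z := right_mem_between y z
      rw [between_eq_union hy] at ht1
      simp only [Set.mem_union, Set.mem_inter_iff, Set.mem_insert_iff, Set.mem_singleton_iff]
        at ht1 ht2 ⊢
      grind
    · rw [hge x ⟨left_mem_between x y, by simp⟩, hex]
    · rw [hgf z ⟨right_mem_between y z, by simp⟩, hfz]

/-- On each finite set of vertices a representation has an endomorphism that is an idempotent of
rank one at a given vertex of its support. -/
lemma exists_natOn_rank_one {V : QRep k A} (hV : isPwf k A V) (p : A.Vertex)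
    [Nontrivial (V.obj p)] (Y : Finset A.Vertex) :
    ∃ (v : V.obj p) (φ : Module.Dual k (V.obj p)), φ v = 1 ∧
      ∃ e : ∀ x, V.obj x →ₗ[k] V.obj x, NatOn e Y ∧ e p = φ.smulRight v := by
  classical
  have hfin : ∀ x, Module.Finite k (V.obj x) := hV
  obtain ⟨a, b, hab⟩ := exists_subset_between (insert p Y)
  have hp : p ∈ between a b := hab (by simp)
  obtain ⟨𝓕, h𝓕, H𝓕⟩ := exists_chain_forall_isAdapted hV (insert p Y) p a ∅ (by simp)
  obtain ⟨𝓖, h𝓖, H𝓖⟩ := exists_chain_forall_isAdapted hV (insert p Y) p b ∅ (by simp)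
  -- A line has only two directions away from p, so only two chains of conditions have to be met at
  -- once.
  obtain ⟨v, φ, hφ, h1, h2⟩ := exists_isAdapted h𝓕 h𝓖
  obtain ⟨-, -, -, e, he, hep, -⟩ := H𝓕 v φ h1
  obtain ⟨-, -, -, f, hf, hfp, -⟩ := H𝓖 v φ h2
  obtain ⟨g, hg, hge, hgf⟩ := NatOn.glue he hf (hep.trans hfp.symm) hp
    (by rw [between_comm a p]; exact Set.inter_subset_left) Set.inter_subset_left
    ⟨left_mem_between p a, by simp⟩ ⟨left_mem_between p b, by simp⟩
  refine ⟨v, φ, hφ, g, hg.mono fun y hy => ?_, ?_⟩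
  · have := hab (Finset.mem_coe.2 (Finset.mem_insert_of_mem hy))
    rw [between_eq_union hp, between_comm a p] at this
    rcases this with h | h
    · exact Or.inl ⟨h, Or.inl (by simp [Finset.mem_coe.1 hy])⟩
    · exact Or.inr ⟨h, Or.inl (by simp [Finset.mem_coe.1 hy])⟩
  · rw [hge p ⟨left_mem_between p a, by simp⟩, hep]

/-- A pointwise finite-dimensional representation has an endomorphism that is an idempotent of
rank one at a given vertex of its support. -/
theorem exists_end_rank_one {V : QRep k A} (hV : isPwf k A V) (p : A.Vertex)
    [Nontrivial (V.obj p)] :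
    ∃ (v : V.obj p) (φ : Module.Dual k (V.obj p)), φ v = 1 ∧
      ∃ F : V ⟶ V, (F.app p).hom = φ.smulRight v := by
  classical
  have hfin : ∀ x, Module.Finite k (V.obj x) := hV
  -- E Y consists of the endomorphisms of V(p) that continue naturally over Y; it shrinks as Y
  -- grows.
  let E : Finset A.Vertex → Submodule k (V.obj p →ₗ[k] V.obj p) := fun Y =>
    { carrier := {e | ∃ f : ∀ x, V.obj x →ₗ[k] V.obj x, NatOn f Y ∧ f p = e}
      add_mem' := by
        rintro _ _ ⟨f, hf, rfl⟩ ⟨g, hg, rfl⟩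
        exact ⟨f + g, fun x y a hx hy m => by simp [hf a hx hy, hg a hx hy], rfl⟩
      zero_mem' := ⟨0, fun x y a hx hy m => by simp, rfl⟩
      smul_mem' := by
        rintro c _ ⟨f, hf, rfl⟩
        exact ⟨c • f, fun x y a hx hy m => by simp [hf a hx hy], rfl⟩ }
  have hE : ∀ Y Y', Y ⊆ Y' → E Y' ≤ E Y := by
    rintro Y Y' h _ ⟨f, hf, rfl⟩
    exact ⟨f, hf.mono (by exact_mod_cast h), rfl⟩
  -- The idempotent obtained over Y depends on Y. Choosing E Y minimal removes this dependence: what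
  -- continues over Y then continues over every larger finite set.
  obtain ⟨_, ⟨Y, rfl⟩, hmin⟩ := WellFounded.has_min
    (wellFounded_lt (α := Submodule k (V.obj p →ₗ[k] V.obj p))) (Set.range E) ⟨_, ∅, rfl⟩
  obtain ⟨v, φ, hφ, e, he, hep⟩ := exists_natOn_rank_one hV p Y
  refine ⟨v, φ, hφ, exists_hom_of_finite_of_app_eq hV hV p _ fun Z => ?_⟩
  have h1 : E (Y ∪ Z) = E Y := eq_of_le_of_not_lt (hE _ _ Finset.subset_union_left)
    (hmin _ ⟨_, rfl⟩)
  have h2 : φ.smulRight v ∈ E (Y ∪ Z) := h1 ▸ ⟨e, he, hep⟩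
  exact hE _ _ Finset.subset_union_right h2

/-- All idempotent endomorphisms are trivial. -/
def HasTrivialIdempotents {C : Type v} [Category.{w} C] [HasZeroMorphisms C] (X : C) : Prop :=
  ∀ e : X ⟶ X, e ≫ e = e → e = 0 ∨ e = 𝟙 X

lemma qrep_hom_ext {M V : QRep k A} {F G : M ⟶ V}
    (h : ∀ x, (F.app x).hom = (G.app x).hom) : F = G := by
  ext x : 2
  exact ModuleCat.hom_ext (h x)

/-- The Fitting decomposition of an endomorphism: the projection onto the part where it is
invertible. -/
theorem exists_fitting_idempotent {V : QRep k A} (hV : isPwf k A V) (F : V ⟶ V) :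
    ∃ P : V ⟶ V, P ≫ P = P ∧ ∀ x, (∀ v, (P.app x).hom v = v →
      v ∈ ⨅ n, LinearMap.range ((F.app x).hom ^ n)) ∧
      ∀ v, (P.app x).hom v = 0 → v ∈ ⨆ n, LinearMap.ker ((F.app x).hom ^ n) := by
  have hfin : ∀ x, Module.Finite k (V.obj x) := hV
  let f : ∀ x, V.obj x →ₗ[k] V.obj x := fun x => (F.app x).hom
  have hf : NatOn f Set.univ := natOn_app F _
  -- F commutes with the structure maps, so these preserve the stable ranges and the stable kernels;
  -- the pointwise projections are therefore natural.
  let R : ∀ x, Submodule k (V.obj x) := fun x => ⨅ n, LinearMap.range (f x ^ n)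
  let K : ∀ x, Submodule k (V.obj x) := fun x => ⨆ n, LinearMap.ker (f x ^ n)
  have hc : ∀ x, IsCompl (R x) (K x) := fun x =>
    (LinearMap.isCompl_iSup_ker_pow_iInf_range_pow (f x)).symm
  have hpow : ∀ n {x y : A.Vertex} (a : x ⟶ y) m,
      (f y ^ n) ((V.map a).hom m) = (V.map a).hom ((f x ^ n) m) := by
    intro n x y a
    induction n with
    | zero => intro m; simp
    | succ n ih => intro m; rw [pow_succ, pow_succ, Module.End.mul_apply, Module.End.mul_apply,
        hf a trivial trivial, ih]
  have hR : ∀ {x y : A.Vertex} (a : x ⟶ y) m, m ∈ R x → (V.map a).hom m ∈ R y := by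
    intro x y a m hm
    rw [Submodule.mem_iInf] at hm ⊢
    intro n
    obtain ⟨u, rfl⟩ := hm n
    exact ⟨(V.map a).hom u, hpow n a u⟩
  have hK : ∀ {x y : A.Vertex} (a : x ⟶ y) m, m ∈ K x → (V.map a).hom m ∈ K y := by
    intro x y a m hm
    have : K x ≤ (K y).comap (V.map a).hom := by
      refine iSup_le fun n u hu => ?_
      refine Submodule.mem_iSup_of_mem n ?_
      rw [LinearMap.mem_ker] at hu ⊢
      rw [hpow, hu, map_zero]
    exact this hm
  let π : ∀ x, V.obj x →ₗ[k] V.obj x := fun x => (R x).projection (K x) (hc x)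
  have hπ : NatOn π Set.univ := by
    intro x y a _ _ m
    obtain ⟨r, hr, s, hs, rfl⟩ := Submodule.mem_sup.1
      (show m ∈ R x ⊔ K x by rw [(hc x).sup_eq_top]; trivial)
    simp only [map_add, π, Submodule.projection_apply_of_mem_left _ hr,
      Submodule.projection_apply_of_mem_left _ (hR a r hr),
      Submodule.projection_apply_of_mem_right _ hs,
      Submodule.projection_apply_of_mem_right _ (hK a s hs), map_zero]
  refine ⟨hπ.toHom, qrep_hom_ext fun x => ?_, fun x => ⟨fun v hv => ?_, fun v hv => ?_⟩⟩
  · ext v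
    exact Submodule.projection_apply_of_mem_left _ (Submodule.projection_apply_mem _ v)
  · rw [← hv]
    exact Submodule.projection_apply_mem (hc x) v
  · exact (Submodule.projection_apply_eq_zero_iff (hc x)).1 hv

/-- The spaces of a pointwise finite-dimensional representation with trivial idempotents are at
most one-dimensional. -/
theorem exists_forall_eq_smul_of_hasTrivialIdempotents {V : QRep k A} (hV : isPwf k A V)
    (h : HasTrivialIdempotents V) (p : A.Vertex) : ∃ v : V.obj p, ∀ w, ∃ c : k, w = c • v := by
  rcases subsingleton_or_nontrivial (V.obj p) with hs | hs
  · exact ⟨0, fun w => ⟨0, Subsingleton.elim _ _⟩⟩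
  obtain ⟨v, φ, hφ, F, hF⟩ := exists_end_rank_one hV p
  obtain ⟨P, hP, hPF⟩ := exists_fitting_idempotent hV F
  refine ⟨v, fun w => ?_⟩
  rcases h P hP with rfl | rfl
  -- P = 0 would put v in the stable kernel of F at p, but F fixes v there.
  · exfalso
    have h1 := (hPF p).2 v rfl
    have hn : ∀ n, ((F.app p).hom ^ n) v = v := by
      intro n
      induction n with
      | zero => simp
      | succ n ih => rw [pow_succ, Module.End.mul_apply, hF, LinearMap.smulRight_apply, hφ,
          one_smul, ← hF, ih]
    have hmono : Monotone fun n => LinearMap.ker ((F.app p).hom ^ n) := by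
      intro a b hab u hu
      simp only [LinearMap.mem_ker] at hu ⊢
      rw [← Nat.sub_add_cancel hab, pow_add, Module.End.mul_apply, hu, map_zero]
    obtain ⟨n, hn'⟩ := (Submodule.mem_iSup_of_directed _ hmono.directed_le).1 h1
    rw [LinearMap.mem_ker, hn n] at hn'
    rw [hn', map_zero] at hφ
    exact zero_ne_one hφ
  -- P = 1 puts every w in the range of F at p, which is spanned by v.
  · have := (Submodule.mem_iInf _).1 ((hPF p).1 w rfl) 1
    rw [pow_one, hF] at this
    obtain ⟨u, hu⟩ := this
    exact ⟨φ u, by rw [← hu, LinearMap.smulRight_apply]⟩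

end RankOne

/-! ### Cocycles on convex sets of vertices -/

section Integration

variable {A : ContinuousQuiverA}

/-- Convex sets of vertices. -/
def IsConvexSet (L : Set A.Vertex) : Prop := ∀ ⦃x⦄, x ∈ L → ∀ ⦃y⦄, y ∈ L → between x y ⊆ L

lemma isConvexSet_val (I : Set ℝ) [hI : I.OrdConnected] :
    IsConvexSet {x : A.Vertex | x.val ∈ I} := fun _ hx _ hy _ hz => hI.uIcc_subset hx hy hz

/-- The zigzag joining two points of a convex set stays inside it. -/
lemma IsConvexSet.eq_of_forall_hom {L : Set A.Vertex} (hL : IsConvexSet L) {α : Type*}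
    {h : A.Vertex → α} (hh : ∀ x ∈ L, ∀ y ∈ L, (x ⟶ y) → h x = h y) {x y : A.Vertex}
    (hx : x ∈ L) (hy : y ∈ L) : h x = h y := by
  refine vertex_zigzag_induction (Q := fun x y => x ∈ L → y ∈ L → h x = h y) ?_ ?_ ?_ x y hx hy
  · exact fun x y a hx hy => hh x hx y hy a
  · exact fun x y a hx hy => (hh y hy x hx a).symm
  · exact fun x y z hy h1 h2 hx hz => (h1 hx (hL hx hz hy)).trans (h2 (hL hx hz hy) hz)

lemma exists_between_of_three (p s t : A.Vertex) : ∃ a ∈ ({p, s, t} : Set A.Vertex),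
    ∃ b ∈ ({p, s, t} : Set A.Vertex), p ∈ between a b ∧ s ∈ between a b ∧ t ∈ between a b := by
  have key : ∀ x y z : A.Vertex, y ∈ between x z →
      x ∈ between x z ∧ y ∈ between x z ∧ z ∈ between x z := fun x y z h =>
    ⟨left_mem_between _ _, h, right_mem_between _ _⟩
  have : s ∈ between p t ∨ t ∈ between p s ∨ p ∈ between s t := by
    simp only [between, Set.mem_ofPred_eq, Set.mem_uIcc]
    grind
  rcases this with h | h | h
  · obtain ⟨h1, h2, h3⟩ := key _ _ _ h
    exact ⟨p, by simp, t, by simp, h1, h2, h3⟩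
  · obtain ⟨h1, h2, h3⟩ := key _ _ _ h
    exact ⟨p, by simp, s, by simp, h1, h3, h2⟩
  · obtain ⟨h1, h2, h3⟩ := key _ _ _ h
    exact ⟨s, by simp, t, by simp, h2, h1, h3⟩

/-- Cocycles on a convex set of vertices are coboundaries. -/
theorem IsConvexSet.exists_coboundary {L : Set A.Vertex} (hL : IsConvexSet L) {G : Type*}
    [CommGroup G] (d : A.Vertex → A.Vertex → G)
    (hd : ∀ x ∈ L, ∀ y ∈ L, ∀ z ∈ L, (x ⟶ y) → (y ⟶ z) → d x z = d x y * d y z) :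
    ∃ h : A.Vertex → G, ∀ x ∈ L, ∀ y ∈ L, (x ⟶ y) → d x y = h x / h y := by
  classical
  -- Along a single arrow, the values of the cocycle towards the lower end or from the upper end
  -- provide a potential. Potentials on adjacent stretches are glued after multiplying one by a
  -- constant.
  have local_exists : ∀ x y : A.Vertex, x ∈ L → y ∈ L → ∃ h : A.Vertex → G,
      ∀ s ∈ between x y, ∀ t ∈ between x y, (s ⟶ t) → d s t = h s / h t := by
    refine vertex_zigzag_induction ?_ ?_ ?_
    · intro x y a hx hy
      refine ⟨fun s => d s y, fun s hs t ht b => ?_⟩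
      obtain ⟨-, ⟨c⟩⟩ := hom_of_mem_between a ht
      dsimp only
      rw [hd s (hL hx hy hs) t (hL hx hy ht) y hy b c, mul_div_cancel_right]
    · intro x y a hx hy
      refine ⟨fun s => (d y s)⁻¹, fun s hs t ht b => ?_⟩
      rw [between_comm] at hs
      obtain ⟨⟨c⟩, -⟩ := hom_of_mem_between a hs
      dsimp only
      rw [hd y hy s (hL hy hx hs) t (hL hx hy ht) c b, inv_div_inv,
        mul_div_cancel_left]
    · intro x y z hy h1 h2 hx hz
      have hyL := hL hx hz hy
      obtain ⟨h₁, H1⟩ := h1 hx hyL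
      obtain ⟨h₂, H2⟩ := h2 hyL hz
      let h : A.Vertex → G := fun t => if t ∈ between x y then h₁ t else h₂ t * (h₁ y / h₂ y)
      have k1 : ∀ t ∈ between x y, h t = h₁ t := fun t ht => if_pos ht
      have k2 : ∀ t ∈ between y z, h t = h₂ t * (h₁ y / h₂ y) := fun t ht => by
        by_cases h' : t ∈ between x y
        · have : t.val = y.val := by
            have := mem_between_of_mem hy h' ht
            simp only [between, Set.mem_ofPred_eq, Set.uIcc_self, Set.mem_singleton_iff] at this
            exact this.symm
          have : t = y := this
          rw [k1 t h', this, mul_div_cancel]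
        · exact if_neg h'
      have e1 : ∀ s ∈ between x y, ∀ t ∈ between x y, (s ⟶ t) → d s t = h s / h t :=
        fun s hs t ht a => by rw [k1 s hs, k1 t ht, H1 s hs t ht a]
      have e2 : ∀ s ∈ between y z, ∀ t ∈ between y z, (s ⟶ t) → d s t = h s / h t :=
        fun s hs t ht a => by rw [k2 s hs, k2 t ht, H2 s hs t ht a, mul_div_mul_right_eq_div]
      refine ⟨h, fun s hs t ht a => ?_⟩
      have key : y ∈ between s t → ((s ⟶ y) → d s y = h s / h y) →
          ((y ⟶ t) → d y t = h y / h t) → d s t = h s / h t := by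
        intro hys k1 k2
        obtain ⟨⟨b⟩, ⟨c⟩⟩ := hom_of_mem_between a hys
        rw [hd s (hL hx hz hs) y hyL t (hL hx hz ht) b c, k1 b, k2 c, div_mul_div_cancel]
      rw [between_eq_union hy] at hs ht
      rcases hs with hs | hs <;> rcases ht with ht | ht
      · exact e1 s hs t ht a
      · exact key (mem_between_of_mem hy hs ht) (e1 s hs y (right_mem_between _ _))
          (e2 y (left_mem_between _ _) t ht)
      · exact key (by rw [between_comm]; exact mem_between_of_mem hy ht hs)
          (e2 s hs y (left_mem_between _ _)) (e1 y (right_mem_between _ _) t ht)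
      · exact e2 s hs t ht a
  rcases L.eq_empty_or_nonempty with rfl | ⟨p, hp⟩
  · exact ⟨fun _ => 1, fun x hx => hx.elim⟩
  choose! H hH using fun (q : A.Vertex) (hq : q ∈ L) => local_exists p q hp hq
  have hconv : ∀ a b : A.Vertex, IsConvexSet (between a b) := fun a b x hx y hy =>
    Set.uIcc_subset_uIcc (a₂ := a.val) (b₂ := b.val) hx hy
  -- Potentials on the same stretch differ by a constant factor, so the quotient H q q / H q p is
  -- independent of the choice of H q. Hence potentials normalised to 1 at p agree on overlaps.
  refine ⟨fun q => H q q / H q p, fun s hs t ht a => ?_⟩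
  obtain ⟨x, hx, y, hy, h1, h2, h3⟩ := exists_between_of_three p s t
  have hxL : x ∈ L := by rcases hx with rfl | rfl | rfl <;> assumption
  have hyL : y ∈ L := by rcases hy with rfl | rfl | rfl <;> assumption
  obtain ⟨h, hh⟩ := local_exists x y hxL hyL
  have key : ∀ q ∈ L, q ∈ between x y → H q q / H q p = h q / h p := by
    intro q hq hqxy
    have := (hconv p q).eq_of_forall_hom (h := fun s => H q s / h s) (fun s hs t ht a => by
      have e1 := hH q hq s hs t ht a
      have e2 := hh s (hconv _ _ h1 hqxy hs) t (hconv _ _ h1 hqxy ht) a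
      rw [e1] at e2
      rw [div_eq_div_iff_mul_eq_mul] at e2 ⊢
      rw [e2, mul_comm]) (right_mem_between p q) (left_mem_between p q)
    rw [div_eq_div_iff_mul_eq_mul] at this ⊢
    rw [this, mul_comm]
  dsimp only
  rw [key s hs h2, key t ht h3, div_div_div_cancel_right]
  exact hh s h2 t h3 a

end Integration

/-! ### Interval representations and their morphisms -/

section IntervalRep

variable {k : Type u} [Field k] {A : ContinuousQuiverA}

lemma qrep_isIso {M V : QRep k A} (F : M ⟶ V) (h : ∀ x, Function.Bijective (F.app x).hom) :
    IsIso F := by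
  have : ∀ x, IsIso (F.app x) := fun x => by
    rw [ConcreteCategory.isIso_iff_bijective]
    exact h x
  exact (NatTrans.isIso_iff_isIso_app F).2 this

variable {I J : Set ℝ} [hI : I.OrdConnected] [hJ : J.OrdConnected]

/-- The coordinate of an element of a space of an interval representation. -/
def coord (I : Set ℝ) [I.OrdConnected] (x : A.Vertex) : (intervalRep k A I).obj x →ₗ[k] k :=
  (intervalSpace k I x.val).subtype

lemma coord_injective (x : A.Vertex) :
    Function.Injective (coord I x : (intervalRep k A I).obj x →ₗ[k] k) :=
  Subtype.val_injective

lemma coord_of_notMem {x : A.Vertex} (hx : x.val ∉ I) (m : (intervalRep k A I).obj x) :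
    coord I x m = 0 := m.2 hx

open Classical in
lemma coord_map {x y : A.Vertex} (a : x ⟶ y) (m : (intervalRep k A I).obj x) :
    coord I y (((intervalRep k A I).map a).hom m) = if y.val ∈ I then coord I x m else 0 := rfl

open Classical in
/-- The standard generator of a space of an interval representation. -/
noncomputable def stdVec (k : Type u) [Field k] (I : Set ℝ) [I.OrdConnected] (x : A.Vertex) :
    (intervalRep k A I).obj x :=
  show intervalSpace k I x.val from ⟨if x.val ∈ I then 1 else 0, fun h => if_neg h⟩

lemma coord_stdVec {x : A.Vertex} (hx : x.val ∈ I) : coord I x (stdVec k I x) = 1 := if_pos hx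

lemma stdVec_of_notMem {x : A.Vertex} (hx : x.val ∉ I) : stdVec k I x = 0 :=
  coord_injective x (by rw [coord_of_notMem hx, map_zero])

lemma coord_smul_stdVec {x : A.Vertex} (m : (intervalRep k A I).obj x) :
    coord I x m • stdVec k I x = m := by
  apply coord_injective x
  rw [map_smul]
  by_cases hx : x.val ∈ I
  · rw [coord_stdVec hx, smul_eq_mul, mul_one]
  · rw [coord_of_notMem hx, zero_smul]

lemma map_stdVec {x y : A.Vertex} (a : x ⟶ y) (hx : x.val ∈ I) (hy : y.val ∈ I) :
    ((intervalRep k A I).map a).hom (stdVec k I x) = stdVec k I y :=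
  coord_injective y (by rw [coord_map, if_pos hy, coord_stdVec hx, coord_stdVec hy])

lemma map_stdVec_of_notMem {x y : A.Vertex} (a : x ⟶ y) (hy : y.val ∉ I) :
    ((intervalRep k A I).map a).hom (stdVec k I x) = 0 :=
  coord_injective y (by rw [coord_map, if_neg hy, map_zero])

lemma isPwf_intervalRep (I : Set ℝ) [I.OrdConnected] : isPwf k A (intervalRep k A I) := fun x =>
  Module.Finite.of_injective (coord I x) (coord_injective x)

open Classical in
/-- A morphism from an interval representation, given by the images of the generators. -/
noncomputable def homOfSection {V : QRep k A} (v : ∀ x, V.obj x)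
    (h : ∀ (x y : A.Vertex) (a : x ⟶ y), x.val ∈ I →
      (V.map a).hom (v x) = if y.val ∈ I then v y else 0) : intervalRep k A I ⟶ V :=
  NatOn.toHom (f := fun x => (coord I x).smulRight (v x)) (by
    intro x y a _ _ m
    simp only [LinearMap.smulRight_apply, coord_map, map_smul]
    by_cases hx : x.val ∈ I
    · rw [h x y a hx]
      split_ifs <;> simp
    · simp [coord_of_notMem hx])

lemma homOfSection_app {V : QRep k A} (v : ∀ x, V.obj x)
    (h : ∀ (x y : A.Vertex) (a : x ⟶ y), x.val ∈ I →
      (V.map a).hom (v x) = open Classical in if y.val ∈ I then v y else 0) (x : A.Vertex)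
    (m : (intervalRep k A I).obj x) :
    ((homOfSection v h).app x).hom m = coord I x m • v x := rfl

lemma homOfSection_stdVec {V : QRep k A} (v : ∀ x, V.obj x)
    (h : ∀ (x y : A.Vertex) (a : x ⟶ y), x.val ∈ I →
      (V.map a).hom (v x) = open Classical in if y.val ∈ I then v y else 0) {x : A.Vertex}
    (hx : x.val ∈ I) : ((homOfSection v h).app x).hom (stdVec k I x) = v x := by
  rw [homOfSection_app, coord_stdVec hx, one_smul]

open Classical in
/-- A morphism to an interval representation, given by functionals. -/
noncomputable def homOfCosection {V : QRep k A} (φ : ∀ x, V.obj x →ₗ[k] k)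
    (h : ∀ (x y : A.Vertex) (a : x ⟶ y), y.val ∈ I → ∀ v,
      φ y ((V.map a).hom v) = if x.val ∈ I then φ x v else 0) : V ⟶ intervalRep k A I :=
  NatOn.toHom (f := fun x => (φ x).smulRight (stdVec k I x)) (by
    intro x y a _ _ m
    apply coord_injective
    rw [coord_map]
    simp only [LinearMap.smulRight_apply, map_smul, smul_eq_mul]
    by_cases hy : y.val ∈ I
    · rw [h x y a hy, if_pos hy, coord_stdVec hy]
      by_cases hx : x.val ∈ I
      · simp [coord_stdVec hx, hx]
      · simp [coord_of_notMem hx, hx]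
    · simp [coord_of_notMem hy, hy])

lemma coord_homOfCosection {V : QRep k A} (φ : ∀ x, V.obj x →ₗ[k] k)
    (h : ∀ (x y : A.Vertex) (a : x ⟶ y), y.val ∈ I → ∀ v,
      φ y ((V.map a).hom v) = open Classical in if x.val ∈ I then φ x v else 0)
    {x : A.Vertex} (hx : x.val ∈ I) (v : V.obj x) :
    coord I x (((homOfCosection φ h).app x).hom v) = φ x v := by
  change coord I x (φ x v • stdVec k I x) = φ x v
  rw [map_smul, coord_stdVec hx, smul_eq_mul, mul_one]

lemma app_eq_coord_smul {V : QRep k A} (f : intervalRep k A I ⟶ V) (x : A.Vertex)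
    (m : (intervalRep k A I).obj x) :
    (f.app x).hom m = coord I x m • (f.app x).hom (stdVec k I x) := by
  conv_lhs => rw [← coord_smul_stdVec m]
  rw [map_smul]

lemma intervalRep_hom_ext {V : QRep k A} {f g : intervalRep k A I ⟶ V}
    (h : ∀ x : A.Vertex, x.val ∈ I →
      (f.app x).hom (stdVec k I x) = (g.app x).hom (stdVec k I x)) : f = g := by
  refine qrep_hom_ext fun x => LinearMap.ext fun m => ?_
  rw [app_eq_coord_smul f, app_eq_coord_smul g]
  by_cases hx : x.val ∈ I
  · rw [h x hx]
  · rw [coord_of_notMem hx, zero_smul, zero_smul]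

lemma nat_apply {M V : QRep k A} (F : M ⟶ V) {x y : A.Vertex} (a : x ⟶ y) (m : M.obj x) :
    (F.app y).hom ((M.map a).hom m) = (V.map a).hom ((F.app x).hom m) :=
  natOn_app F Set.univ a trivial trivial m

/-- A morphism between interval representations is determined by its value at a point of the
intersection of the intervals. -/
lemma intervalRep_hom_eq_zero {f : intervalRep k A I ⟶ intervalRep k A J} {p : A.Vertex}
    (hpI : p.val ∈ I) (hpJ : p.val ∈ J) (h : (f.app p).hom (stdVec k I p) = 0) : f = 0 := by
  refine intervalRep_hom_ext fun x hxI => ?_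
  change _ = (0 : (intervalRep k A J).obj x)
  apply coord_injective x
  rw [map_zero]
  by_cases hxJ : x.val ∈ J
  · have := (isConvexSet_val (A := A) (I ∩ J)).eq_of_forall_hom
      (h := fun x => coord J x ((f.app x).hom (stdVec k I x))) (by
        intro x hx y hy a
        rw [← map_stdVec a hx.1 hy.1, nat_apply, coord_map, if_pos hy.2])
      (x := x) (y := p) ⟨hxI, hxJ⟩ ⟨hpI, hpJ⟩
    rw [this, h, map_zero]
  · exact coord_of_notMem hxJ _

lemma exists_mem_of_ne_zero {f : intervalRep k A I ⟶ intervalRep k A J} (hf : f ≠ 0) :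
    ∃ p : A.Vertex, p.val ∈ I ∧ p.val ∈ J ∧ coord J p ((f.app p).hom (stdVec k I p)) ≠ 0 := by
  by_contra! h
  refine hf (intervalRep_hom_ext fun x hx => coord_injective x ?_)
  change _ = coord J x 0
  rw [map_zero]
  by_cases hxJ : x.val ∈ J
  · exact h x hx hxJ
  · exact coord_of_notMem hxJ _

lemma qrep_smul_app {M V : QRep k A} (c : k) (f : M ⟶ V) (x : A.Vertex) (m : M.obj x) :
    ((c • f).app x).hom m = c • (f.app x).hom m := rfl

lemma qrep_sub_app {M V : QRep k A} (f g : M ⟶ V) (x : A.Vertex) (m : M.obj x) :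
    ((f - g).app x).hom m = (f.app x).hom m - (g.app x).hom m := rfl

lemma qrep_add_app {M V : QRep k A} (f g : M ⟶ V) (x : A.Vertex) (m : M.obj x) :
    ((f + g).app x).hom m = (f.app x).hom m + (g.app x).hom m := rfl

lemma qrep_comp_app {M V W : QRep k A} (f : M ⟶ V) (g : V ⟶ W) (x : A.Vertex) (m : M.obj x) :
    ((f ≫ g).app x).hom m = (g.app x).hom ((f.app x).hom m) := rfl

/-- Choose a point of I ∩ J where g does not vanish. Some multiple of g agrees with f there, and
their difference vanishes at a point of I ∩ J, hence everywhere. -/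
theorem exists_eq_smul_intervalRep_hom (f : intervalRep k A I ⟶ intervalRep k A J)
    {g : intervalRep k A I ⟶ intervalRep k A J} (hg : g ≠ 0) : ∃ c : k, f = c • g := by
  obtain ⟨p, hI, hJ, hp⟩ := exists_mem_of_ne_zero hg
  refine ⟨coord J p ((f.app p).hom (stdVec k I p)) / coord J p ((g.app p).hom (stdVec k I p)), ?_⟩
  rw [← sub_eq_zero]
  refine intervalRep_hom_eq_zero hI hJ (coord_injective p ?_)
  rw [qrep_sub_app, qrep_smul_app, map_sub, map_smul, smul_eq_mul, div_mul_cancel₀ _ hp, sub_self,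
    map_zero]

lemma intervalRep_id_ne_zero (h : I.Nonempty) : 𝟙 (intervalRep k A I) ≠ 0 := by
  obtain ⟨p, hp⟩ := h
  intro h0
  let q : A.Vertex := p
  have h1 : ((𝟙 (intervalRep k A I) : intervalRep k A I ⟶ _).app q).hom (stdVec k I q) = 0 := by
    rw [h0]; rfl
  have h2 : stdVec k I q = 0 := h1
  have := coord_stdVec (k := k) (I := I) (x := q) hp
  rw [h2, map_zero] at this
  exact zero_ne_one this

/-- Endomorphisms are scalars, and a scalar with c² = c is 0 or 1. -/
lemma hasTrivialIdempotents_intervalRep (h : I.Nonempty) :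
    HasTrivialIdempotents (intervalRep k A I) := by
  intro e he
  obtain ⟨c, rfl⟩ := exists_eq_smul_intervalRep_hom e (intervalRep_id_ne_zero h)
  rw [Linear.smul_comp, Category.id_comp, smul_smul] at he
  have h0 : (c * c - c) • 𝟙 (intervalRep k A I) = 0 := by rw [sub_smul, he, sub_self]
  rcases smul_eq_zero.1 h0 with h1 | h1
  · have : c * (c - 1) = 0 := by rw [← h1]; ring
    rcases mul_eq_zero.1 this with h2 | h2
    · left; rw [h2, zero_smul]
    · right; rw [sub_eq_zero.1 h2, one_smul]
  · exact absurd h1 (intervalRep_id_ne_zero h)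

end IntervalRep

/-! ### Thin representations are interval representations -/

section Thin

variable {k : Type u} [Field k] {A : ContinuousQuiverA}

/-- A nonzero pointwise finite-dimensional representation with trivial idempotents is an interval
representation. -/
theorem exists_iso_intervalRep {V : QRep k A} (hV : isPwf k A V) (h : HasTrivialIdempotents V)
    (h0 : 𝟙 V ≠ 0) :
    ∃ (I : Set ℝ) (_ : I.OrdConnected), I.Nonempty ∧ Nonempty (V ≅ intervalRep k A I) := by
  classical
  choose v hv using exists_forall_eq_smul_of_hasTrivialIdempotents hV h
  obtain ⟨p, hp⟩ : ∃ p, v p ≠ 0 := by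
    by_contra! hall
    refine h0 (qrep_hom_ext fun x => LinearMap.ext fun m => ?_)
    obtain ⟨c, hc⟩ := hv x m
    rw [hc, hall x, smul_zero, map_zero, map_zero]
  -- Vertices are connected if no structure map on the stretch joining them kills a generator.
  -- Identities count as structure maps, so no generator on the stretch is zero.
  let conn : A.Vertex → A.Vertex → Prop := fun x y => ∀ s ∈ between x y, ∀ t ∈ between x y,
    ∀ a : s ⟶ t, (V.map a).hom (v s) ≠ 0
  have conn_symm : ∀ {x y}, conn x y → conn y x := fun {x y} h => by
    intro s hs t ht
    rw [between_comm] at hs ht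
    exact h s hs t ht
  have conn_mono : ∀ {x y z}, y ∈ between x z → conn x z → conn x y := fun {x y z} hy h s hs t ht =>
    h s (by rw [between_eq_union hy]; exact Or.inl hs) t
      (by rw [between_eq_union hy]; exact Or.inl ht)
  have comp_ne : ∀ {x y z : A.Vertex} (a : x ⟶ y) (b : y ⟶ z) (c : x ⟶ z),
      (V.map c).hom (v x) ≠ 0 ↔ (V.map a).hom (v x) ≠ 0 ∧ (V.map b).hom (v y) ≠ 0 := by
    intro x y z a b c
    have : c = a ≫ b := hom_eq _ _
    rw [this, ← map_comp_apply]
    obtain ⟨r, hr⟩ := hv y ((V.map a).hom (v x))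
    constructor
    · intro h
      refine ⟨fun h' => h (by rw [h', map_zero]), fun h' => h (by rw [hr, map_smul, h', smul_zero])⟩
    · rintro ⟨h1, h2⟩
      rw [hr, map_smul]
      refine smul_ne_zero (fun h' => h1 ?_) h2
      rw [hr, h', zero_smul]
  have conn_trans : ∀ {x y z}, y ∈ between x z → conn x y → conn y z → conn x z := by
    intro x y z hy h1 h2 s hs t ht a
    have key : y ∈ between s t → (∀ b : s ⟶ y, (V.map b).hom (v s) ≠ 0) →
        (∀ b : y ⟶ t, (V.map b).hom (v y) ≠ 0) → (V.map a).hom (v s) ≠ 0 := by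
      intro hys k1 k2
      obtain ⟨⟨b⟩, ⟨c⟩⟩ := hom_of_mem_between a hys
      exact (comp_ne b c a).2 ⟨k1 b, k2 c⟩
    rw [between_eq_union hy] at hs ht
    rcases hs with hs | hs <;> rcases ht with ht | ht
    · exact h1 s hs t ht a
    · exact key (mem_between_of_mem hy hs ht) (h1 s hs y (right_mem_between _ _))
        (h2 y (left_mem_between _ _) t ht)
    · exact key (by rw [between_comm]; exact mem_between_of_mem hy ht hs)
        (h2 s hs y (left_mem_between _ _)) (h1 y (right_mem_between _ _) t ht)
    · exact h2 s hs t ht a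
  have conn_trans' : ∀ {x y z}, conn x y → conn y z → conn x z := by
    intro x y z h1 h2
    have : y ∈ between x z ∨ z ∈ between y x ∨ x ∈ between z y := by
      simp only [between, Set.mem_ofPred_eq, Set.mem_uIcc]
      grind
    rcases this with h | h | h
    · exact conn_trans h h1 h2
    · rw [between_comm] at h
      exact conn_mono h h1
    · exact conn_symm (conn_mono h (conn_symm h2))
  have conn_of_ne : ∀ {s t : A.Vertex} (a : s ⟶ t), (V.map a).hom (v s) ≠ 0 → conn s t := by
    intro s t a ha s' hs t' ht c
    obtain ⟨⟨b⟩, ⟨b'⟩⟩ := hom_of_mem_between a hs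
    obtain ⟨-, ⟨d⟩⟩ := hom_of_mem_between a ht
    exact ((comp_ne c d b').1 ((comp_ne b b' a).1 ha).2).1
  have hzero : ∀ {s t : A.Vertex} (a : s ⟶ t), (V.map a).hom (v s) = 0 →
      ∀ m, (V.map a).hom m = 0 := by
    intro s t a ha m
    obtain ⟨c, rfl⟩ := hv s m
    rw [map_smul, ha, smul_zero]
  -- The projection to the component of p is natural because structure maps between different
  -- components vanish. As idempotents are trivial, the support is one component.
  let f : ∀ x, V.obj x →ₗ[k] V.obj x := fun x => if conn p x then LinearMap.id else 0
  have hf : NatOn f Set.univ := by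
    intro s t a _ _ m
    by_cases ha : (V.map a).hom (v s) = 0
    · by_cases h1 : conn p s <;> by_cases h2 : conn p t <;>
        simp [f, h1, h2, hzero a ha]
    · have hst := conn_of_ne a ha
      have : conn p s ↔ conn p t :=
        ⟨fun h => conn_trans' h hst, fun h => conn_trans' h (conn_symm hst)⟩
      by_cases h1 : conn p s
      · have h2 := this.1 h1
        simp [f, h1, h2]
      · have h2 : ¬ conn p t := fun h => h1 (this.2 h)
        simp [f, h1, h2]
  have hpp : conn p p := conn_of_ne (𝟙 p) (by rw [map_id_apply]; exact hp)
  have hall : ∀ x, v x ≠ 0 → conn p x := by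
    rcases h hf.toHom (qrep_hom_ext fun x => by
      change f x ∘ₗ f x = f x
      by_cases h1 : conn p x <;> simp only [f, h1, if_true, if_false] <;> ext <;> simp) with h' | h'
    · exfalso
      have : f p = 0 := by
        have := congrArg (fun F : V ⟶ V => (F.app p).hom) h'
        exact this
      have := LinearMap.congr_fun this (v p)
      simp only [f, hpp, if_true] at this
      exact hp this
    · intro x hx
      by_contra hc
      have : f x = LinearMap.id := congrArg (fun F : V ⟶ V => (F.app x).hom) h'
      have := LinearMap.congr_fun this (v x)
      simp only [f, hc, if_false] at this
      exact hx this.symm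
  have hconn : ∀ x y, v x ≠ 0 → v y ≠ 0 → conn x y := fun x y hx hy =>
    conn_trans' (conn_symm (hall x hx)) (hall y hy)
  let I : Set ℝ := {x | v (show A.Vertex from x) ≠ 0}
  have hmemI : ∀ x : A.Vertex, x.val ∈ I ↔ v x ≠ 0 := fun x => Iff.rfl
  have hI : I.OrdConnected := by
    refine ⟨fun x hx y hy z hz => ?_⟩
    have := hconn x y hx hy (show A.Vertex from z) (Set.mem_uIcc.2 (Or.inl hz)) _
      (Set.mem_uIcc.2 (Or.inl hz)) (𝟙 _)
    rw [map_id_apply] at this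
    exact this
  -- On the support a structure map multiplies generators by a unit. These units form a cocycle, and
  -- a potential for it rescales the generators so that all the units become 1.
  have hd : ∀ x y : A.Vertex, ∃ c : kˣ, v x ≠ 0 → v y ≠ 0 → ∀ a : x ⟶ y,
      (V.map a).hom (v x) = (c : k) • v y := by
    intro x y
    by_cases hxy : v x ≠ 0 ∧ v y ≠ 0 ∧ Nonempty (x ⟶ y)
    · obtain ⟨hx, hy, ⟨a⟩⟩ := hxy
      obtain ⟨c, hc⟩ := hv y ((V.map a).hom (v x))
      have hne := hconn x y hx hy x (left_mem_between _ _) y (right_mem_between _ _) a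
      have hc0 : c ≠ 0 := fun h' => hne (by rw [hc, h', zero_smul])
      exact ⟨Units.mk0 c hc0, fun _ _ b => by rw [hom_eq b a]; exact hc⟩
    · exact ⟨1, fun hx hy a => (hxy ⟨hx, hy, ⟨a⟩⟩).elim⟩
  choose d hd using hd
  obtain ⟨c, hc⟩ := (isConvexSet_val (A := A) I).exists_coboundary d (by
    intro x hx y hy z hz a b
    have e1 := hd x y hx hy a
    have e2 := hd y z hy hz b
    have e3 := hd x z hx hz (a ≫ b)
    rw [← map_comp_apply, e1, map_smul, e2, smul_smul] at e3
    ext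
    exact (smul_left_injective k hz e3).symm)
  refine ⟨I, hI, ⟨p, hp⟩, ⟨?_⟩⟩
  let F : intervalRep k A I ⟶ V := homOfSection (fun x => ((c x)⁻¹ : kˣ) • v x) (by
    intro x y a hx
    split_ifs with hy
    · rw [Units.smul_def, map_smul, hd x y hx hy a, hc x hx y hy a, smul_smul, Units.smul_def,
        ← Units.val_mul]
      congr 2
      rw [div_eq_mul_inv, inv_mul_cancel_left]
    · obtain ⟨r, hr⟩ := hv y ((V.map a).hom (((c x)⁻¹ : kˣ) • v x))
      rw [hr, show v y = 0 from not_not.1 hy, smul_zero])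
  have : IsIso F := by
    refine qrep_isIso F fun x => ⟨?_, ?_⟩
    · rw [injective_iff_map_eq_zero]
      intro m hm
      rw [homOfSection_app] at hm
      apply coord_injective
      rw [map_zero]
      by_cases hx : x.val ∈ I
      · exact (smul_eq_zero.1 hm).resolve_right
          (by rw [Units.smul_def]; exact smul_ne_zero (Units.ne_zero _) hx)
      · exact coord_of_notMem hx _
    · intro m
      obtain ⟨r, rfl⟩ := hv x m
      by_cases hx : x.val ∈ I
      · refine ⟨(r * c x) • stdVec k I x, ?_⟩
        rw [map_smul, homOfSection_stdVec _ _ hx, Units.smul_def, smul_smul, mul_assoc,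
          ← Units.val_mul, mul_inv_cancel, Units.val_one, mul_one]
      · exact ⟨0, by rw [map_zero, show v x = 0 from not_not.1 hx, smul_zero]⟩
  exact (asIso F).symm

end Thin

/-! ### Pointwise criteria for exactness, and closure properties -/

section Pointwise

open ZeroObject

variable {k : Type u} [Field k] {A : ContinuousQuiverA}

lemma qrep_mono_iff {M V : QRep k A} (f : M ⟶ V) :
    Mono f ↔ ∀ x, Function.Injective (f.app x).hom := by
  rw [NatTrans.mono_iff_mono_app]
  exact forall_congr' fun x => ModuleCat.mono_iff_injective _

lemma qrep_epi_iff {M V : QRep k A} (f : M ⟶ V) :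
    Epi f ↔ ∀ x, Function.Surjective (f.app x).hom := by
  rw [NatTrans.epi_iff_epi_app]
  exact forall_congr' fun x => ModuleCat.epi_iff_surjective _

/-- Evaluation at a vertex commutes with homology, and a functor is zero exactly when all its values
are. -/
lemma qrep_exact_iff (T : ShortComplex (QRep k A)) :
    T.Exact ↔ ∀ x, ∀ v, (T.g.app x).hom v = 0 → ∃ u, (T.f.app x).hom u = v := by
  have h1 : T.Exact ↔ ∀ x : A.Vertex, (T.map ((evaluation _ _).obj x)).Exact := by
    simp only [ShortComplex.exact_iff_isZero_homology]
    rw [Functor.isZero_iff]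
    exact forall_congr' fun x =>
      ((T.mapHomologyIso ((evaluation A.Vertex (ModuleCat.{u} k)).obj x)).isZero_iff).symm
  rw [h1]
  refine forall_congr' fun x => ?_
  rw [ShortComplex.moduleCat_exact_iff]
  rfl

lemma isPwf_of_mono {M V : QRep k A} (f : M ⟶ V) [Mono f] (hV : isPwf k A V) : isPwf k A M :=
  fun x => by
    have := hV x
    exact Module.Finite.of_injective _ ((qrep_mono_iff f).1 inferInstance x)

lemma isPwf_of_epi {M V : QRep k A} (f : M ⟶ V) [Epi f] (hM : isPwf k A M) : isPwf k A V :=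
  fun x => by
    have := hM x
    exact Module.Finite.of_surjective _ ((qrep_epi_iff f).1 inferInstance x)

instance : (isPwf k A).IsClosedUnderSubobjects where
  prop_of_mono f _ h := isPwf_of_mono f h

instance : (isPwf k A).IsClosedUnderQuotients where
  prop_of_epi f _ h := isPwf_of_epi f h

instance : (isBounded k A).IsClosedUnderSubobjects where
  prop_of_mono {M V} f _ h := by
    obtain ⟨h, n, hn⟩ := h
    refine ⟨isPwf_of_mono f h, n, fun x => lt_of_le_of_lt ?_ (hn x)⟩
    have := h x
    exact LinearMap.finrank_le_finrank_of_injective ((qrep_mono_iff f).1 inferInstance x)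

instance : (isBounded k A).IsClosedUnderQuotients where
  prop_of_epi {M V} f _ h := by
    obtain ⟨h, n, hn⟩ := h
    refine ⟨isPwf_of_epi f h, n, fun x => lt_of_le_of_lt ?_ (hn x)⟩
    have := h x
    exact LinearMap.finrank_le_finrank_of_surjective ((qrep_epi_iff f).1 inferInstance x)

instance : (isBounded k A).ContainsZero := ⟨⟨0, isZero_zero _, fun x => by
    have := subsingleton_obj_of_isZero k A (isZero_zero _) x
    infer_instance, 1, fun x => by
    have := subsingleton_obj_of_isZero k A (isZero_zero _) x
    simp [Module.finrank_zero_of_subsingleton]⟩⟩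

instance : (isPwf k A).ContainsZero :=
  ⟨⟨0, isZero_zero _, ((isBounded k A).prop_of_isZero (isZero_zero _)).1⟩⟩

instance : (isFG k A).ContainsZero := ⟨⟨0, isZero_zero _,
    (isPwf k A).prop_of_isZero (isZero_zero _),
    Empty, inferInstance, Empty.elim, fun i => i.elim, 0,
      ⟨fun g h _ => (isZero_zero (QRep k A)).eq_of_src g h⟩⟩⟩

end Pointwise

/-! ### Idempotents and indecomposable objects -/

section Categories

variable {C : Type v} [Category.{w} C]

/-- A nontrivial idempotent splits an object. -/
lemma exists_split [Preadditive C] [IsIdempotentComplete C] {X : C}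
    {e : X ⟶ X} (he : e ≫ e = e) : ∃ (Y Z : C) (i : Y ⟶ X) (p : X ⟶ Y) (j : Z ⟶ X)
      (q : X ⟶ Z), i ≫ p = 𝟙 Y ∧ j ≫ q = 𝟙 Z ∧ i ≫ q = 0 ∧ j ≫ p = 0 ∧ p ≫ i = e ∧
      p ≫ i + q ≫ j = 𝟙 X := by
  obtain ⟨Y, i, p, h1, h3⟩ := IsIdempotentComplete.idempotents_split X e he
  obtain ⟨Z, j, q, h2, h4⟩ := IsIdempotentComplete.idempotents_split X (𝟙 X - e)
    (by simp [he])
  have h5 : e = 𝟙 X - q ≫ j := by rw [h4]; abel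
  refine ⟨Y, Z, i, p, j, q, h1, h2, ?_, ?_, h3, by rw [h3, h4]; abel⟩
  · have : Mono j := SplitMono.mono ⟨q, h2⟩
    rw [← cancel_mono j, Category.assoc, h4, ← h3, Preadditive.comp_sub, reassoc_of% h1]
    simp
  · have : Mono i := SplitMono.mono ⟨p, h1⟩
    rw [← cancel_mono i, Category.assoc, h3, h5, Preadditive.comp_sub, reassoc_of% h2]
    simp

/-- An object of a category with split idempotents is indecomposable if and only if it is nonzero
and has only trivial idempotents. -/
theorem indecomposable_iff [Preadditive C] [HasBinaryBiproducts C] [IsIdempotentComplete C]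
    (X : C) : Indecomposable X ↔ 𝟙 X ≠ 0 ∧ HasTrivialIdempotents X := by
  constructor
  · rintro ⟨h0, h⟩
    refine ⟨fun h1 => h0 ((IsZero.iff_id_eq_zero X).2 h1), fun e he => ?_⟩
    obtain ⟨Y, Z, i, p, j, q, h1, h2, hiq, hjp, h3, h4⟩ := exists_split he
    have hiso : X ≅ Y ⊞ Z :=
      { hom := biprod.lift p q
        inv := biprod.desc i j
        hom_inv_id := by rw [biprod.lift_desc, h4]
        inv_hom_id := by ext <;> simp [h1, h2, hiq, hjp] }
    rcases h Y Z hiso with hY | hZ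
    · left
      rw [← h3, hY.eq_zero_of_src i, comp_zero]
    · right
      rw [hZ.eq_zero_of_src j, comp_zero, add_zero, h3] at h4
      exact h4
  · rintro ⟨h0, h⟩
    refine ⟨fun hX => h0 ((IsZero.iff_id_eq_zero X).1 hX), fun Y Z φ => ?_⟩
    rcases h (φ.hom ≫ biprod.fst ≫ biprod.inl ≫ φ.inv) (by simp) with h' | h'
    · left
      rw [IsZero.iff_id_eq_zero]
      have : biprod.inl ≫ φ.inv ≫ (φ.hom ≫ biprod.fst ≫ biprod.inl ≫ φ.inv) ≫ φ.hom ≫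
        biprod.fst = 𝟙 Y := by simp
      rw [← this, h']
      simp
    · right
      rw [IsZero.iff_id_eq_zero]
      have : biprod.inr ≫ φ.inv ≫ (φ.hom ≫ biprod.fst ≫ biprod.inl ≫ φ.inv) ≫ φ.hom ≫
        biprod.snd = (0 : Z ⟶ Z) := by simp
      rw [← this, h']
      simp

lemma hasKernelsCokernelsImages_of_isClosed [Abelian C] (P : ObjectProperty C) [P.ContainsZero]
    [P.IsClosedUnderKernels] [P.IsClosedUnderCokernels] [P.IsClosedUnderFiniteProducts] :
    HasKernelsCokernelsImages P.FullSubcategory :=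
  ⟨inferInstance, inferInstance, fun _ => inferInstance⟩

lemma hasTrivialIdempotents_obj_iff [HasZeroMorphisms C] (P : ObjectProperty C)
    (X : P.FullSubcategory) : HasTrivialIdempotents X.obj ↔ HasTrivialIdempotents X := by
  constructor
  · intro h e he
    rcases h e.hom (by rw [← ObjectProperty.FullSubcategory.comp_hom, he]) with h | h
    · exact Or.inl (P.hom_ext h)
    · exact Or.inr (P.hom_ext h)
  · intro h e he
    rcases h (P.homMk e) (P.hom_ext he) with h | h
    · exact Or.inl (congrArg (fun f => f.hom) h)
    · exact Or.inr (congrArg (fun f => f.hom) h)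

lemma HasTrivialIdempotents.of_iso [HasZeroMorphisms C] {X Y : C} (φ : X ≅ Y)
    (h : HasTrivialIdempotents Y) : HasTrivialIdempotents X := by
  intro e he
  rcases h (φ.inv ≫ e ≫ φ.hom) (by simp [reassoc_of% he]) with h | h
  · left
    have : φ.hom ≫ (φ.inv ≫ e ≫ φ.hom) ≫ φ.inv = e := by simp
    rw [← this, h]; simp
  · right
    have : φ.hom ≫ (φ.inv ≫ e ≫ φ.hom) ≫ φ.inv = e := by simp
    rw [← this, h]; simp

end Categories

/-! ### Indecomposables and Hom spaces in the three categories -/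

section Indecomposables

variable {k : Type u} [Field k] {A : ContinuousQuiverA}

/-- The closure properties make the subcategory abelian, so idempotents split in it and
indecomposability amounts to being nonzero with trivial idempotents. Fullness allows these to be
computed among all representations. -/
theorem indecomposablesAreIntervals (P : ObjectProperty (QRep k A)) [P.ContainsZero]
    [P.IsClosedUnderKernels] [P.IsClosedUnderCokernels] [P.IsClosedUnderFiniteProducts]
    (hP : ∀ V, P V → isPwf k A V) : IndecomposablesAreIntervals k A P := by
  intro V
  have h1 : 𝟙 V = 0 ↔ 𝟙 V.obj = 0 :=
    ⟨fun h => congrArg (fun f => f.hom) h, fun h => P.hom_ext h⟩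
  rw [indecomposable_iff, ← hasTrivialIdempotents_obj_iff, Ne, h1]
  constructor
  · rintro ⟨h0, h⟩
    exact exists_iso_intervalRep (hP _ V.property) h h0
  · rintro ⟨I, _, hI, ⟨φ⟩⟩
    refine ⟨fun h0 => intervalRep_id_ne_zero (k := k) (A := A) hI ?_,
      (hasTrivialIdempotents_intervalRep hI).of_iso φ⟩
    have : φ.inv ≫ 𝟙 V.obj ≫ φ.hom = 𝟙 _ := by simp
    rw [← this, h0]
    simp

/-- Hom and Ext are both bounded through proportionality of elements, without exhibiting a
generator. -/
lemma isLineOrZero_of_forall {X : Type v} [AddCommGroup X] [Module k X]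
    (h : ∀ f g : X, g ≠ 0 → ∃ c : k, f = c • g) : IsLineOrZero k X := by
  by_cases h0 : ∃ g : X, g ≠ 0
  · obtain ⟨g, hg⟩ := h0
    left
    refine ⟨(LinearEquiv.ofBijective (LinearMap.toSpanSingleton k X g) ⟨?_, fun f => ?_⟩).symm⟩
    · rw [← LinearMap.ker_eq_bot, LinearMap.ker_toSpanSingleton k hg]
    · obtain ⟨c, rfl⟩ := h f g hg
      exact ⟨c, rfl⟩
  · right
    push Not at h0
    exact ⟨fun f g => by rw [h0 f, h0 g]⟩

theorem homLineOrZero (P : ObjectProperty (QRep k A)) [P.ContainsZero]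
    [P.IsClosedUnderKernels] [P.IsClosedUnderCokernels] [P.IsClosedUnderFiniteProducts]
    (hP : ∀ V, P V → isPwf k A V) : HomLineOrZero P.FullSubcategory k := by
  intro X Y hX hY
  obtain ⟨I, _, -, ⟨φ⟩⟩ := (indecomposablesAreIntervals P hP X).1 hX
  obtain ⟨J, _, -, ⟨ψ⟩⟩ := (indecomposablesAreIntervals P hP Y).1 hY
  refine isLineOrZero_of_forall fun f g hg => ?_
  have hg' : φ.inv ≫ g.hom ≫ ψ.hom ≠ 0 := by
    intro h
    have : φ.hom ≫ (φ.inv ≫ g.hom ≫ ψ.hom) ≫ ψ.inv = g.hom := by simp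
    rw [h] at this
    exact hg (P.hom_ext (by rw [← this]; simp))
  obtain ⟨c, hc⟩ := exists_eq_smul_intervalRep_hom (φ.inv ≫ f.hom ≫ ψ.hom) hg'
  refine ⟨c, P.hom_ext ?_⟩
  have : φ.hom ≫ (φ.inv ≫ f.hom ≫ ψ.hom) ≫ ψ.inv = f.hom := by simp
  rw [← this, hc]
  change _ = c • g.hom
  simp

end Indecomposables

/-! ### Canonical morphisms between interval representations -/

section Canonical

variable {k : Type u} [Field k] {A : ContinuousQuiverA}
variable {I J : Set ℝ} [hI : I.OrdConnected] [hJ : J.OrdConnected]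

/-- The condition under which the canonical morphism of interval representations exists. -/
def HasCanonicalHom (A : ContinuousQuiverA) (I J : Set ℝ) : Prop :=
  ∀ x y : A.Vertex, (x ⟶ y) → x.val ∈ I → y.val ∈ J → (x.val ∈ J ↔ y.val ∈ I)

/-- The canonical morphism of interval representations. -/
noncomputable def canonicalHom (h : HasCanonicalHom A I J) :
    intervalRep k A I ⟶ intervalRep k A J :=
  homOfSection (fun x => stdVec k J x) (by
    intro x y a hx
    by_cases hy : y.val ∈ J
    · by_cases hx' : x.val ∈ J
      · rw [map_stdVec a hx' hy, if_pos ((h x y a hx hy).1 hx')]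
      · rw [stdVec_of_notMem hx', map_zero, if_neg fun h' => hx' ((h x y a hx hy).2 h')]
    · rw [map_stdVec_of_notMem a hy, stdVec_of_notMem hy, ite_self])

lemma canonicalHom_app (h : HasCanonicalHom A I J) (x : A.Vertex)
    (m : (intervalRep k A I).obj x) :
    ((canonicalHom h).app x).hom m = coord I x m • stdVec k J x := rfl

lemma canonicalHom_stdVec (h : HasCanonicalHom A I J) {x : A.Vertex} (hx : x.val ∈ I) :
    ((canonicalHom h).app x).hom (stdVec k I x) = stdVec k J x :=
  homOfSection_stdVec _ _ hx

lemma coord_canonicalHom (h : HasCanonicalHom A I J) {x : A.Vertex} (hx : x.val ∈ J)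
    (m : (intervalRep k A I).obj x) :
    coord J x (((canonicalHom h).app x).hom m) = coord I x m := by
  rw [canonicalHom_app, map_smul, coord_stdVec hx, smul_eq_mul, mul_one]

lemma isCanonicalHom_canonicalHom (h : HasCanonicalHom A I J) :
    IsCanonicalHom (canonicalHom h : intervalRep k A I ⟶ intervalRep k A J) := by
  classical
  intro x
  ext m
  apply coord_injective x
  change _ = if x.val ∈ J then coord I x m else 0
  split_ifs with hx
  · exact coord_canonicalHom h hx m
  · exact coord_of_notMem hx _

/-- From y ⪯ x ⪯ c with y and c in I, convexity gives x in I. These morphisms will generate `M_I`.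
-/
lemma hasCanonicalHom_lowerSet {C : Set ℝ} (hC : C ⊆ I) : HasCanonicalHom A (A.lowerSet C) I := by
  rintro x y a ⟨c, hc, hxc⟩ hy
  refine ⟨fun _ => ⟨c, hc, A.le_trans a.down hxc⟩, fun _ => ?_⟩
  exact hI.uIcc_subset hy (hC hc) (A.mem_uIcc_of_le_real a.down hxc)

end Canonical

/-! ### Constructible representations and finite generation of intervals -/

section Constructible

variable {k : Type u} [Field k] {A : ContinuousQuiverA}

/-- A path from a point of D to a point outside crosses an end of D, and that end is finite. Default
values of `sInf` and `sSup` for unbounded or empty sets only make the hypotheses stronger. -/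
lemma mem_iff_mem_of_notMem_uIcc {D : Set ℝ} (hD : D.OrdConnected) {x y : ℝ}
    (h1 : sInf D ∉ Set.uIcc x y) (h2 : sSup D ∉ Set.uIcc x y) : x ∈ D ↔ y ∈ D := by
  have key : ∀ x y : ℝ, sInf D ∉ Set.uIcc x y → sSup D ∉ Set.uIcc x y → x ∈ D → y ∈ D := by
    intro x y h1 h2 hx
    by_contra hy
    rcases le_total x y with hxy | hxy
    · have hb : ∀ d ∈ D, d ≤ y := fun d hd => by
        by_contra h
        exact hy (hD.out hx hd ⟨hxy, (not_le.1 h).le⟩)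
      exact h2 (Set.mem_uIcc.2 (Or.inl ⟨le_csSup ⟨y, hb⟩ hx, csSup_le ⟨x, hx⟩ hb⟩))
    · have hb : ∀ d ∈ D, y ≤ d := fun d hd => by
        by_contra h
        exact hy (hD.out hd hx ⟨(not_le.1 h).le, hxy⟩)
      exact h1 (Set.mem_uIcc.2 (Or.inr ⟨le_csInf ⟨x, hx⟩ hb, csInf_le ⟨y, hb⟩ hx⟩))
  exact ⟨key x y h1 h2, key y x (by rwa [Set.uIcc_comm]) (by rwa [Set.uIcc_comm])⟩

/-- Away from `T` the representation is locally constant, and zero near elements of `S`. -/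
def ConstructibleOn (T : Set ℝ) (V : QRep k A) : Prop :=
  ∀ x y : A.Vertex, (∀ t ∈ T, t ∉ Set.uIcc x.val y.val) →
    (∀ a : x ⟶ y, Function.Bijective (V.map a).hom) ∧
    ∀ s ∈ A.S, s ∈ Set.uIcc x.val y.val → Subsingleton (V.obj x)

/-- Constructible representations. -/
def IsConstructible (k : Type u) [Field k] (A : ContinuousQuiverA) : ObjectProperty (QRep k A) :=
  fun V => isPwf k A V ∧ ∃ T : Set ℝ, T.Finite ∧ ConstructibleOn T V

lemma ConstructibleOn.comparable {T : Set ℝ} {V : QRep k A} (h : ConstructibleOn T V)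
    {x y : A.Vertex} (hxy : ∀ t ∈ T, t ∉ Set.uIcc x.val y.val) :
    (Subsingleton (V.obj x) ∧ Subsingleton (V.obj y)) ∨ Nonempty (x ⟶ y) ∨ Nonempty (y ⟶ x) := by
  by_cases hS : ∃ s ∈ A.S, s ∈ Set.uIcc x.val y.val
  · obtain ⟨s, hs, hs'⟩ := hS
    refine Or.inl ⟨(h x y hxy).2 s hs hs', (h y x ?_).2 s hs ?_⟩
    · rwa [Set.uIcc_comm]
    · rwa [Set.uIcc_comm]
  · push Not at hS
    exact Or.inr ((A.comparable_of_uIcc hS).elim (fun h => Or.inr ⟨⟨h⟩⟩) (fun h => Or.inl ⟨⟨h⟩⟩))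

lemma ConstructibleOn.finrank_eq {T : Set ℝ} {V : QRep k A} (h : ConstructibleOn T V)
    {x y : A.Vertex} (hxy : ∀ t ∈ T, t ∉ Set.uIcc x.val y.val) :
    Module.finrank k (V.obj x) = Module.finrank k (V.obj y) := by
  rcases h.comparable hxy with ⟨h1, h2⟩ | ⟨⟨a⟩⟩ | ⟨⟨a⟩⟩
  · rw [Module.finrank_zero_of_subsingleton, Module.finrank_zero_of_subsingleton]
  · exact (LinearEquiv.ofBijective _ ((h x y hxy).1 a)).finrank_eq
  · exact (LinearEquiv.ofBijective _ ((h y x (by rwa [Set.uIcc_comm])).1 a)).finrank_eq.symm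

/-- Finitely many points meet all components of the complement of a finite set. -/
lemma exists_test_points {T : Set ℝ} (hT : T.Finite) : ∃ T' : Finset ℝ, T ⊆ T' ∧
    ∀ x, ∃ t ∈ T', x = t ∨ ∀ z ∈ T, z ∉ Set.uIcc x t := by
  classical
  -- The component of a point off T is recorded by the set of points of T to its left. One
  -- representative is chosen for each of the finitely many records; the default 0 in the choice is
  -- never taken.
  have hfin : (Set.range fun x : {x : ℝ // x ∉ T} => T ∩ Set.Iio x.1).Finite :=
    hT.finite_subsets.subset (by rintro _ ⟨x, rfl⟩; exact Set.inter_subset_left)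
  refine ⟨hT.toFinset ∪ hfin.toFinset.image fun U => if h : U ∈ Set.range
    (fun x : {x : ℝ // x ∉ T} => T ∩ Set.Iio x.1) then h.choose.1 else 0, by
      intro t ht; simp [ht], fun x => ?_⟩
  by_cases hx : x ∈ T
  · exact ⟨x, by simp [hx], Or.inl rfl⟩
  have hU : T ∩ Set.Iio x ∈ Set.range fun x : {x : ℝ // x ∉ T} => T ∩ Set.Iio x.1 := ⟨⟨x, hx⟩, rfl⟩
  refine ⟨hU.choose.1, ?_, Or.inr ?_⟩
  · refine Finset.mem_union_right _ (Finset.mem_image.2 ⟨T ∩ Set.Iio x, ?_, ?_⟩)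
    · rwa [Set.Finite.mem_toFinset]
    · rw [dif_pos hU]
  · have h1 : T ∩ Set.Iio hU.choose.1 = T ∩ Set.Iio x := hU.choose_spec
    have h2 := hU.choose.2
    intro z hz hz'
    have h3 : z < hU.choose.1 ↔ z < x :=
      ⟨fun h => (h1.subset ⟨hz, h⟩).2, fun h => (h1.symm.subset ⟨hz, h⟩).2⟩
    have h4 : z ≠ hU.choose.1 := fun h => h2 (h ▸ hz)
    have h5 : z ≠ x := fun h => hx (h ▸ hz)
    rw [Set.mem_uIcc] at hz'
    rcases hz' with hz' | hz'
    · exact absurd (h3.1 (lt_of_le_of_ne hz'.2 h4)) (not_lt.2 hz'.1)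
    · exact absurd (h3.2 (lt_of_le_of_ne hz'.2 h5)) (not_lt.2 hz'.1)

/-- A representation whose structure maps away from a finite set are all injective or all
surjective is constructible if its dimensions are bounded. -/
lemma isConstructible_of_injective_or_surjective {V : QRep k A} (hV : isPwf k A V) {n : ℕ}
    (hn : ∀ x, Module.finrank k (V.obj x) ≤ n) {T : Set ℝ} (hT : T.Finite)
    (h : (∀ (x y : A.Vertex) (a : x ⟶ y), (∀ t ∈ T, t ∉ Set.uIcc x.val y.val) →
        Function.Injective (V.map a).hom) ∨
      (∀ (x y : A.Vertex) (a : x ⟶ y), (∀ t ∈ T, t ∉ Set.uIcc x.val y.val) →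
        Function.Surjective (V.map a).hom))
    (h0 : ∀ x y : A.Vertex, (∀ t ∈ T, t ∉ Set.uIcc x.val y.val) →
      ∀ s ∈ A.S, s ∈ Set.uIcc x.val y.val → Subsingleton (V.obj x)) :
    IsConstructible k A V := by
  have hVx : ∀ x, Module.Finite k (V.obj x) := hV
  -- The points of one component of the complement of T where the dimension is at most a given
  -- bound. This set is convex: between two points of a component the dimension is monotone, or it
  -- vanishes because an element of S intervenes.
  let D : Set ℝ × ℕ → Set ℝ := fun p =>
    {x | x ∉ T ∧ T ∩ Set.Iio x = p.1 ∧ Module.finrank k (V.obj (show A.Vertex from x)) ≤ p.2}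
  have hsep : ∀ {x y z : ℝ}, x ∉ T → y ∉ T → T ∩ Set.Iio x = T ∩ Set.Iio y → x ≤ z → z ≤ y →
      z ∉ T := by
    intro x y z _ hy hxy h1 h2 hz
    have : z ∈ T ∩ Set.Iio x := hxy ▸ ⟨hz, lt_of_le_of_ne h2 fun h => hy (h ▸ hz)⟩
    exact absurd this.2 (not_lt.2 h1)
  have hD : ∀ p, (D p).OrdConnected := by
    rintro ⟨U, m⟩
    refine ⟨fun x hx y hy z hz => ?_⟩
    obtain ⟨hx1, hx2, hx3⟩ := hx
    obtain ⟨hy1, hy2, hy3⟩ := hy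
    have hxy : T ∩ Set.Iio x = T ∩ Set.Iio y := hx2.trans hy2.symm
    refine ⟨hsep hx1 hy1 hxy hz.1 hz.2, subset_antisymm (fun t ht => ?_) (fun t ht => ?_), ?_⟩
    · change t ∈ U
      change _ = U at hy2
      rw [← hy2]
      exact ⟨ht.1, lt_of_lt_of_le ht.2 hz.2⟩
    · change t ∈ U at ht
      change _ = U at hx2
      rw [← hx2] at ht
      exact ⟨ht.1, lt_of_lt_of_le ht.2 hz.1⟩
    · change Module.finrank k (V.obj (show A.Vertex from z)) ≤ m
      have hfree : ∀ p q : A.Vertex, p.val ∈ Set.Icc x y → q.val ∈ Set.Icc x y →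
          ∀ t ∈ T, t ∉ Set.uIcc p.val q.val := fun p q hp hq t ht ht' => by
        have := (Set.ordConnected_Icc (a := x) (b := y)).uIcc_subset hp hq ht'
        exact hsep hx1 hy1 hxy this.1 this.2 ht
      have hxm : x ∈ Set.Icc x y := ⟨le_rfl, hz.1.trans hz.2⟩
      have hym : y ∈ Set.Icc x y := ⟨hz.1.trans hz.2, le_rfl⟩
      let X : A.Vertex := x
      let Y : A.Vertex := y
      let Z : A.Vertex := z
      by_cases hS : ∃ s ∈ A.S, s ∈ Set.Icc x y
      · obtain ⟨s, hs, hs'⟩ := hS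
        have := h0 Z (show A.Vertex from s) (hfree Z (show A.Vertex from s) hz hs') s hs
          Set.right_mem_uIcc
        rw [Module.finrank_zero_of_subsingleton]
        exact Nat.zero_le _
      · push Not at hS
        have hc := A.comparable_of_uIcc (x := x) (y := y) fun s hs hs' => hS s hs (by
          rwa [Set.uIcc_of_le (hz.1.trans hz.2)] at hs')
        have hzb : Z ∈ between X Y := Set.mem_uIcc.2 (Or.inl hz)
        rcases hc with hc | hc
        · obtain ⟨⟨a⟩, ⟨b⟩⟩ := hom_of_mem_between (x := Y) (z := X) ⟨hc⟩
            (by rwa [between_comm])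
          rcases h with h | h
          · exact (LinearMap.finrank_le_finrank_of_injective
              (h Z X b (hfree Z X hz hxm))).trans hx3
          · exact (LinearMap.finrank_le_finrank_of_surjective
              (h Y Z a (hfree Y Z hym hz))).trans hy3
        · obtain ⟨⟨a⟩, ⟨b⟩⟩ := hom_of_mem_between (x := X) (z := Y) ⟨hc⟩ hzb
          rcases h with h | h
          · exact (LinearMap.finrank_le_finrank_of_injective
              (h Z Y b (hfree Z Y hz hym))).trans hy3
          · exact (LinearMap.finrank_le_finrank_of_surjective
              (h X Z a (hfree X Z hxm hz))).trans hx3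
  let PP : Set (Set ℝ × ℕ) := {U | U ⊆ T} ×ˢ Set.Iic n
  have hPP : PP.Finite := hT.finite_subsets.prod (Set.finite_Iic n)
  -- Off T and the ends of the finitely many sets D the dimension cannot jump, so injective or
  -- surjective structure maps are bijective.
  refine ⟨hV, T ∪ ((fun p => sInf (D p)) '' PP ∪ (fun p => sSup (D p)) '' PP),
    hT.union ((hPP.image _).union (hPP.image _)), fun x y hxy => ?_⟩
  have hxyT : ∀ t ∈ T, t ∉ Set.uIcc x.val y.val := fun t ht => hxy t (Or.inl ht)
  refine ⟨fun a => ?_, h0 x y hxyT⟩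
  have hxT : x.val ∉ T := fun h => hxyT _ h Set.left_mem_uIcc
  have hyT : y.val ∉ T := fun h => hxyT _ h Set.right_mem_uIcc
  have hle : ∀ x y : A.Vertex, x.val ∉ T → y.val ∉ T → (∀ p ∈ PP, x.val ∈ D p ↔ y.val ∈ D p) →
      Module.finrank k (V.obj y) ≤ Module.finrank k (V.obj x) := by
    intro x y hx hy hp
    exact ((hp (T ∩ Set.Iio x.val, Module.finrank k (V.obj x))
      ⟨Set.inter_subset_left, hn x⟩).1 ⟨hx, rfl, le_rfl⟩).2.2
  have hp : ∀ p ∈ PP, x.val ∈ D p ↔ y.val ∈ D p := fun p hp =>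
    mem_iff_mem_of_notMem_uIcc (hD p)
      (hxy _ (Or.inr (Or.inl (Set.mem_image_of_mem _ hp))))
      (hxy _ (Or.inr (Or.inr (Set.mem_image_of_mem _ hp))))
  have heq := le_antisymm (hle y x hyT hxT fun p h => (hp p h).symm) (hle x y hxT hyT hp)
  rcases h with h | h
  · exact ⟨h x y a hxyT,
      (LinearMap.injective_iff_surjective_of_finrank_eq_finrank heq).1 (h x y a hxyT)⟩
  · exact ⟨(LinearMap.injective_iff_surjective_of_finrank_eq_finrank heq).2 (h x y a hxyT),
      h x y a hxyT⟩

lemma IsConstructible.exists_bound {V : QRep k A} (h : IsConstructible k A V) :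
    ∃ n, ∀ x, Module.finrank k (V.obj x) ≤ n := by
  obtain ⟨-, T, hT, h⟩ := h
  obtain ⟨T', -, hT'⟩ := exists_test_points hT
  refine ⟨T'.sup fun t => Module.finrank k (V.obj (show A.Vertex from t)), fun x => ?_⟩
  obtain ⟨t, ht, h'⟩ := hT' x.val
  refine le_trans (le_of_eq ?_) (Finset.le_sup ht)
  rcases h' with h' | h'
  · rw [← h']; rfl
  · exact h.finrank_eq (y := (show A.Vertex from t)) h'

/-- Away from T the structure maps of a subobject are still injective, though perhaps no longer
bijective; bounded dimensions then confine the jumps to finitely many points. -/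
instance : (IsConstructible k A).IsClosedUnderSubobjects where
  prop_of_mono {U V} f _ h := by
    obtain ⟨n, hn⟩ := h.exists_bound
    obtain ⟨hV, T, hT, h⟩ := h
    have hVx : ∀ x, Module.Finite k (V.obj x) := hV
    have hf := (qrep_mono_iff f).1 inferInstance
    refine isConstructible_of_injective_or_surjective (isPwf_of_mono f hV) (n := n)
      (fun x => (LinearMap.finrank_le_finrank_of_injective (hf x)).trans (hn x)) hT (Or.inl ?_) ?_
    · intro x y a hxy m m' hm
      refine hf x (((h x y hxy).1 a).1 ?_)
      rw [← nat_apply, ← nat_apply, hm]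
    · intro x y hxy s hs hs'
      have := (h x y hxy).2 s hs hs'
      exact (hf x).subsingleton

/-- Here surjectivity is what survives away from T. -/
instance : (IsConstructible k A).IsClosedUnderQuotients where
  prop_of_epi {V W} f _ h := by
    obtain ⟨n, hn⟩ := h.exists_bound
    obtain ⟨hV, T, hT, h⟩ := h
    have hVx : ∀ x, Module.Finite k (V.obj x) := hV
    have hf := (qrep_epi_iff f).1 inferInstance
    refine isConstructible_of_injective_or_surjective (isPwf_of_epi f hV) (n := n)
      (fun x => (LinearMap.finrank_le_finrank_of_surjective (hf x)).trans (hn x)) hT (Or.inr ?_) ?_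
    · intro x y a hxy w
      obtain ⟨v, rfl⟩ := hf y w
      obtain ⟨v', rfl⟩ := ((h x y hxy).1 a).2 v
      exact ⟨(f.app x).hom v', (nat_apply f a v').symm⟩
    · intro x y hxy s hs hs'
      have := (h x y hxy).2 s hs hs'
      exact (hf x).subsingleton

lemma isConstructible_intervalRep {I : Set ℝ} [hI : I.OrdConnected] (hS : (A.S ∩ I).Finite) :
    IsConstructible k A (intervalRep k A I) := by
  refine ⟨isPwf_intervalRep I, (A.S ∩ I) ∪ {sInf I, sSup I}, hS.union (Set.toFinite _), ?_⟩
  intro x y hxy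
  have hiff := mem_iff_mem_of_notMem_uIcc hI (hxy _ (by simp)) (hxy _ (by simp))
  refine ⟨fun a => ?_, fun s hs hs' => ?_⟩
  · by_cases hx : x.val ∈ I
    · have hy := hiff.1 hx
      refine ⟨fun m m' h => coord_injective x ?_, fun m => ⟨coord I y m • stdVec k I x, ?_⟩⟩
      · have := congrArg (coord I y) h
        rwa [coord_map, coord_map, if_pos hy, if_pos hy] at this
      · rw [map_smul, map_stdVec a hx hy, coord_smul_stdVec]
    · have hy : y.val ∉ I := fun h => hx (hiff.2 h)
      refine ⟨fun m m' _ => coord_injective x ?_, fun m => ⟨0, coord_injective y ?_⟩⟩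
      · rw [coord_of_notMem hx, coord_of_notMem hx]
      · rw [coord_of_notMem hy, coord_of_notMem hy]
  · refine ⟨fun m m' => coord_injective x ?_⟩
    by_cases hx : x.val ∈ I
    · exact absurd hs' (hxy s (Or.inl ⟨hs, hI.uIcc_subset hx (hiff.1 hx) hs'⟩))
    · rw [coord_of_notMem hx, coord_of_notMem hx]

/-- At an element of S outside T the space must vanish, so I can meet S only inside T. -/
lemma IsConstructible.finite_inter {I : Set ℝ} [hI : I.OrdConnected]
    (h : IsConstructible k A (intervalRep k A I)) : (A.S ∩ I).Finite := by
  obtain ⟨-, T, hT, h⟩ := h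
  refine hT.subset fun s hs => ?_
  by_contra hsT
  let x : A.Vertex := s
  have := (h x x (fun t ht ht' => by
    rw [Set.uIcc_self, Set.mem_singleton_iff] at ht'
    exact hsT (by rw [ht'] at ht; exact ht))).2 s hs.1 Set.left_mem_uIcc
  have h1 := congrArg (coord I x) (Subsingleton.elim (stdVec k I x) 0)
  rw [coord_stdVec (x := x) hs.2, map_zero] at h1
  exact one_ne_zero h1

section Biproduct

variable {ι : Type} [Finite ι] (Q : ι → QRep k A)

lemma sum_biproduct_ι_π_apply [Fintype ι] (x : A.Vertex) (q : (⨁ Q).obj x) :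
    ∑ i, ((biproduct.ι Q i).app x).hom (((biproduct.π Q i).app x).hom q) = q := by
  have h := congrArg (fun f : (⨁ Q) ⟶ ⨁ Q => (f.app x).hom q) (biproduct.total (f := Q))
  simp only [NatTrans.app_sum, ModuleCat.hom_sum, LinearMap.sum_apply] at h
  exact h

lemma isConstructible_biproduct (h : ∀ i, IsConstructible k A (Q i)) :
    IsConstructible k A (⨁ Q) := by
  classical
  have := Fintype.ofFinite ι
  choose hpwf T hT hc using h
  have hext : ∀ {x : A.Vertex} {q q' : (⨁ Q).obj x}, (∀ i, ((biproduct.π Q i).app x).hom q =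
      ((biproduct.π Q i).app x).hom q') → q = q' := fun {x q q'} h => by
    rw [← sum_biproduct_ι_π_apply Q x q, ← sum_biproduct_ι_π_apply Q x q']
    simp only [h]
  refine ⟨fun x => ?_, ⋃ i, T i, Set.finite_iUnion hT, fun x y hxy => ?_⟩
  · have : ∀ i, Module.Finite k ((Q i).obj x) := fun i => hpwf i x
    exact Module.Finite.of_injective (LinearMap.pi fun i => ((biproduct.π Q i).app x).hom)
      fun q q' hq => hext fun i => congrFun hq i
  have hxy' : ∀ i, ∀ t ∈ T i, t ∉ Set.uIcc x.val y.val := fun i t ht =>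
    hxy t (Set.mem_iUnion.2 ⟨i, ht⟩)
  refine ⟨fun a => ⟨fun q q' hq => hext fun i => ((hc i x y (hxy' i)).1 a).1 ?_, fun q => ?_⟩,
    fun s hs hs' => ⟨fun q q' => hext fun i => ?_⟩⟩
  · rw [← nat_apply, ← nat_apply, hq]
  · choose p hp using fun i => ((hc i x y (hxy' i)).1 a).2 (((biproduct.π Q i).app y).hom q)
    refine ⟨∑ i, ((biproduct.ι Q i).app x).hom (p i), ?_⟩
    rw [map_sum, ← sum_biproduct_ι_π_apply Q y q]
    exact Finset.sum_congr rfl fun i _ => by rw [← nat_apply, hp]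
  · have := (hc i x y (hxy' i)).2 s hs hs'
    exact Subsingleton.elim _ _

end Biproduct

lemma IsListedProjective.isConstructible {Q : QRep k A} (h : IsListedProjective Q) :
    IsConstructible k A Q := by
  obtain ⟨a, ⟨⟨e⟩⟩ | ⟨⟨e⟩⟩ | ⟨⟨e⟩⟩⟩ := h
  · exact ObjectProperty.prop_of_mono _ e.hom
      (isConstructible_intervalRep (IsListed.finite_inter ⟨a, Or.inl rfl⟩))
  · exact ObjectProperty.prop_of_mono _ e.hom
      (isConstructible_intervalRep (IsListed.finite_inter ⟨a, Or.inr (Or.inl rfl)⟩))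
  · exact ObjectProperty.prop_of_mono _ e.hom
      (isConstructible_intervalRep (IsListed.finite_inter ⟨a, Or.inr (Or.inr rfl)⟩))

lemma isFG.isConstructible {V : QRep k A} (h : isFG k A V) : IsConstructible k A V := by
  obtain ⟨-, ι, hι, Q, hQ, f, hf⟩ := h
  exact ObjectProperty.prop_of_epi _ f (isConstructible_biproduct Q fun i => (hQ i).isConstructible)

lemma _root_.ContinuousQuiverA.IsListed.isListedProjective {J : Set ℝ} [J.OrdConnected]
    (h : A.IsListed J) : IsListedProjective (intervalRep k A J) := by
  obtain ⟨a, rfl | rfl | rfl⟩ := h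
  · exact ⟨a, Or.inl ⟨Iso.refl _⟩⟩
  · exact ⟨a, Or.inr (Or.inl ⟨Iso.refl _⟩)⟩
  · exact ⟨a, Or.inr (Or.inr ⟨Iso.refl _⟩)⟩

/-- An interval that contains finitely many elements of `S` is a finite union of pieces below
which there are listed sets. -/
lemma exists_listed_cover {I : Set ℝ} [hI : I.OrdConnected] (hS : (A.S ∩ I).Finite) :
    ∃ (ι : Type) (_ : Finite ι) (C : ι → Set ℝ), (∀ i, C i ⊆ I) ∧ (∀ x ∈ I, ∃ i, x ∈ C i) ∧
      ∀ i, A.IsListed (A.lowerSet (C i)) := by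
  have := hS.to_subtype
  have : Finite {U : Set ℝ | U ⊆ A.S ∩ I} := hS.finite_subsets
  -- One piece for each element of S in I, and one for each gap, labelled by the elements of S ∩ I
  -- to its left. Labels of no gap give empty pieces.
  refine ⟨↥(A.S ∩ I) ⊕ {U : Set ℝ | U ⊆ A.S ∩ I}, inferInstance,
    Sum.elim (fun x => {x.1}) (fun U => {y | y ∈ I ∧ y ∉ A.S ∧ (A.S ∩ I) ∩ Set.Iio y = U.1}),
    ?_, ?_, ?_⟩
  · rintro (⟨x, hx⟩ | U)
    · simpa using hx.2
    · exact fun y hy => hy.1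
  · intro x hx
    by_cases hxS : x ∈ A.S
    · exact ⟨Sum.inl ⟨x, hxS, hx⟩, rfl⟩
    · exact ⟨Sum.inr ⟨(A.S ∩ I) ∩ Set.Iio x, Set.inter_subset_left⟩, hx, hxS, rfl⟩
  · rintro (⟨x, hx⟩ | U)
    · exact ⟨x, Or.inl (A.lowerSet_singleton x)⟩
    · have key : ∀ x y : ℝ, x ∈ I → y ∈ I → (A.S ∩ I) ∩ Set.Iio x = (A.S ∩ I) ∩ Set.Iio y →
          x < y → A.le x y ∨ A.le y x := by
        intro x y hx hy hxy hlt
        refine A.comparable_of_lt hlt fun z hz h1 h2 => ?_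
        have : z ∈ (A.S ∩ I) ∩ Set.Iio x := hxy ▸ ⟨⟨hz, hI.out hx hy ⟨h1.le, h2.le⟩⟩, h2⟩
        exact absurd this.2 (not_lt.2 h1.le)
      refine A.isListed_lowerSet (fun x hx y hy => ?_) fun x hx => hx.2.1
      rcases lt_trichotomy x y with h | rfl | h
      · exact key x y hx.1 hy.1 (hx.2.2.trans hy.2.2.symm) h
      · exact Or.inl (A.le_refl _)
      · exact (key y x hy.1 hx.1 (hy.2.2.trans hx.2.2.symm) h).symm

/-- The lower sets of the finitely many pieces are listed, and the canonical morphism from the lower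
set of a piece is onto over that piece. -/
lemma isFG_intervalRep {I : Set ℝ} [hI : I.OrdConnected] (hS : (A.S ∩ I).Finite) :
    isFG k A (intervalRep k A I) := by
  obtain ⟨ι, hι, C, hC, hcov, hlist⟩ := exists_listed_cover (A := A) hS
  have hord : ∀ i, (A.lowerSet (C i)).OrdConnected := fun i => (hlist i).ordConnected
  refine ⟨isPwf_intervalRep I, ι, hι, fun i => intervalRep k A (A.lowerSet (C i)),
    fun i => (hlist i).isListedProjective,
    biproduct.desc fun i => canonicalHom (hasCanonicalHom_lowerSet (hC i)), ?_⟩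
  rw [qrep_epi_iff]
  intro x m
  by_cases hx : x.val ∈ I
  · obtain ⟨i, hi⟩ := hcov _ hx
    have hx' : x.val ∈ A.lowerSet (C i) := ⟨_, hi, A.le_refl _⟩
    refine ⟨((biproduct.ι (fun i => intervalRep k A (A.lowerSet (C i))) i).app x).hom
      (coord I x m • stdVec k _ x), ?_⟩
    rw [← qrep_comp_app, biproduct.ι_desc, map_smul, canonicalHom_stdVec _ hx', coord_smul_stdVec]
  · exact ⟨0, coord_injective x (by rw [coord_of_notMem hx, coord_of_notMem hx])⟩

end Constructible

/-! ### Finite decompositions; finitely generated means constructible -/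

section Decomposition

variable {k : Type u} [Field k] {A : ContinuousQuiverA}

/-- Summands keep the same T, so a single set of test points serves the whole inductive
decomposition; general subobjects may need a larger T. -/
lemma ConstructibleOn.of_retract {T : Set ℝ} {V Y : QRep k A} (h : ConstructibleOn T V)
    {i : Y ⟶ V} {p : V ⟶ Y} (hip : i ≫ p = 𝟙 Y) : ConstructibleOn T Y := by
  have hip' : ∀ x (m : Y.obj x), (p.app x).hom ((i.app x).hom m) = m := fun x m => by
    rw [← qrep_comp_app, hip]; rfl
  have hi : ∀ x, Function.Injective (i.app x).hom := fun x =>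
    Function.LeftInverse.injective (hip' x)
  intro x y hxy
  refine ⟨fun a => ⟨fun m m' hm => hi x (((h x y hxy).1 a).1 ?_), fun m => ?_⟩, fun s hs hs' => ?_⟩
  · rw [← nat_apply, ← nat_apply, hm]
  · obtain ⟨m', hm'⟩ := ((h x y hxy).1 a).2 ((i.app y).hom m)
    exact ⟨(p.app x).hom m', by rw [← nat_apply, hm', hip']⟩
  · have := (h x y hxy).2 s hs hs'
    exact (hi x).subsingleton

lemma ConstructibleOn.id_eq_zero {T : Set ℝ} {V : QRep k A} (h : ConstructibleOn T V)
    (hV : isPwf k A V) {T' : Finset ℝ}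
    (hT' : ∀ x, ∃ t ∈ T', x = t ∨ ∀ z ∈ T, z ∉ Set.uIcc x t)
    (h0 : ∑ t ∈ T', Module.finrank k (V.obj (show A.Vertex from t)) = 0) : 𝟙 V = 0 := by
  refine qrep_hom_ext fun x => LinearMap.ext fun m => ?_
  have hVx := hV x
  have : Module.finrank k (V.obj x) = 0 := by
    obtain ⟨t, ht, h'⟩ := hT' x.val
    have h1 := (Finset.sum_eq_zero_iff.1 h0) t ht
    rcases h' with h' | h'
    · rw [← h'] at h1; exact h1
    · rw [h.finrank_eq (y := (show A.Vertex from t)) h', h1]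
  have := Module.finrank_zero_iff.1 this
  exact Subsingleton.elim _ _

lemma finrank_eq_add {V Y Z : QRep k A} (hY : isPwf k A Y) (hZ : isPwf k A Z)
    {i : Y ⟶ V} {p : V ⟶ Y} {j : Z ⟶ V} {q : V ⟶ Z} (h1 : i ≫ p = 𝟙 Y) (h2 : j ≫ q = 𝟙 Z)
    (h3 : i ≫ q = 0) (h4 : j ≫ p = 0) (h5 : p ≫ i + q ≫ j = 𝟙 V) (x : A.Vertex) :
    Module.finrank k (V.obj x) = Module.finrank k (Y.obj x) + Module.finrank k (Z.obj x) := by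
  have := hY x
  have := hZ x
  rw [← Module.finrank_prod]
  refine (LinearEquiv.ofLinearMap ((i.app x).hom.coprod (j.app x).hom)
    ((p.app x).hom.prod (q.app x).hom) ?_ ?_).symm.finrank_eq
  · refine LinearMap.ext fun m => ?_
    exact congrArg (fun f : V ⟶ V => (f.app x).hom m) h5
  · refine LinearMap.ext fun m => Prod.ext ?_ ?_
    · change (p.app x).hom ((i.app x).hom m.1 + (j.app x).hom m.2) = m.1
      rw [map_add, ← qrep_comp_app, ← qrep_comp_app, h1, h4]
      exact add_zero _
    · change (q.app x).hom ((i.app x).hom m.1 + (j.app x).hom m.2) = m.2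
      rw [map_add, ← qrep_comp_app, ← qrep_comp_app, h2, h3]
      exact zero_add _

/-- Constructible representations are finite direct sums of interval representations. -/
theorem IsConstructible.exists_decomposition {V : QRep k A} (hV : IsConstructible k A V) :
    ∃ (ι : Type) (_ : Fintype ι) (F : ι → QRep k A) (σ : ∀ i, F i ⟶ V) (π : ∀ i, V ⟶ F i),
      (∀ i, ∃ (I : Set ℝ) (_ : I.OrdConnected), I.Nonempty ∧
        Nonempty (F i ≅ intervalRep k A I)) ∧
      (∀ i, σ i ≫ π i = 𝟙 _) ∧ (∀ i j, i ≠ j → σ i ≫ π j = 0) ∧ ∑ i, π i ≫ σ i = 𝟙 V := by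
  obtain ⟨hV, T, hT, h⟩ := hV
  obtain ⟨T', -, hT'⟩ := exists_test_points hT
  -- A nonzero summand is nonzero at some test point, so in a nontrivial splitting both parts have
  -- smaller total dimension at the test points.
  induction hN : ∑ t ∈ T', Module.finrank k (V.obj (show A.Vertex from t))
    using Nat.strong_induction_on generalizing V with
  | _ N ih =>
  by_cases h0 : 𝟙 V = 0
  · exact ⟨Empty, inferInstance, Empty.elim, fun i => i.elim, fun i => i.elim, fun i => i.elim,
      fun i => i.elim, fun i => i.elim, by rw [h0]; simp⟩
  by_cases h1 : HasTrivialIdempotents V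
  · exact ⟨Unit, inferInstance, fun _ => V, fun _ => 𝟙 V, fun _ => 𝟙 V,
      fun _ => exists_iso_intervalRep hV h1 h0, fun _ => Category.id_comp _,
      fun i j hij => (hij (Subsingleton.elim _ _)).elim, by simp⟩
  simp only [HasTrivialIdempotents, not_forall, not_or] at h1
  obtain ⟨e, he, he0, he1⟩ := h1
  obtain ⟨Y, Z, i, p, j, q, h1, h2, h3, h4, h5, h6⟩ := exists_split he
  have : Mono i := SplitMono.mono ⟨p, h1⟩
  have : Mono j := SplitMono.mono ⟨q, h2⟩
  have hY := isPwf_of_mono i hV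
  have hZ := isPwf_of_mono j hV
  have hcY := h.of_retract h1
  have hcZ := h.of_retract h2
  have hsum := Finset.sum_congr (rfl : T' = T') fun t _ =>
    finrank_eq_add hY hZ h1 h2 h3 h4 h6 (show A.Vertex from t)
  rw [Finset.sum_add_distrib] at hsum
  have hY0 : ∑ t ∈ T', Module.finrank k (Y.obj (show A.Vertex from t)) ≠ 0 := fun h' => he0 (by
    rw [← h5, ← Category.id_comp i, hcY.id_eq_zero hY hT' h']; simp)
  have hZ0 : ∑ t ∈ T', Module.finrank k (Z.obj (show A.Vertex from t)) ≠ 0 := fun h' => he1 (by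
    rw [← Category.id_comp j, hcZ.id_eq_zero hZ hT' h'] at h6
    rw [← h5, ← h6]; simp)
  obtain ⟨ι, _, F, σ, π, f1, f2, f3, f4⟩ := ih _ (by omega) hY hcY rfl
  obtain ⟨κ, _, G, τ, ρ, g1, g2, g3, g4⟩ := ih _ (by omega) hZ hcZ rfl
  refine ⟨ι ⊕ κ, inferInstance, Sum.elim F G,
    fun a => match a with
      | Sum.inl a => σ a ≫ i
      | Sum.inr a => τ a ≫ j,
    fun a => match a with
      | Sum.inl a => p ≫ π a
      | Sum.inr a => q ≫ ρ a, ?_, ?_, ?_, ?_⟩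
  · rintro (a | a)
    · exact f1 a
    · exact g1 a
  · rintro (a | a)
    · simp [reassoc_of% h1, f2]
    · simp [reassoc_of% h2, g2]
  · rintro (a | a) (b | b) hab
    · simp [reassoc_of% h1, f3 a b (fun h => hab (congrArg _ h))]
      rfl
    · simp [reassoc_of% h3]
      rfl
    · simp [reassoc_of% h4]
      rfl
    · simp [reassoc_of% h2, g3 a b (fun h => hab (congrArg _ h))]
      rfl
  · rw [Fintype.sum_sum_type]
    have e1 : ∑ a, (p ≫ π a) ≫ σ a ≫ i = p ≫ i := by
      have : ∑ a, (p ≫ π a) ≫ σ a ≫ i = p ≫ (∑ a, π a ≫ σ a) ≫ i := by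
        rw [Preadditive.sum_comp, Preadditive.comp_sum]
        simp
      rw [this, f4, Category.id_comp]
    have e2 : ∑ a, (q ≫ ρ a) ≫ τ a ≫ j = q ≫ j := by
      have : ∑ a, (q ≫ ρ a) ≫ τ a ≫ j = q ≫ (∑ a, ρ a ≫ τ a) ≫ j := by
        rw [Preadditive.sum_comp, Preadditive.comp_sum]
        simp
      rw [this, g4, Category.id_comp]
    exact (congrArg₂ (· + ·) e1 e2).trans h6

/-- Each interval summand is constructible as a subobject, hence meets S in finitely many points and
is finitely generated; only finitely many summands occur. -/
lemma IsConstructible.isFG {V : QRep k A} (hV : IsConstructible k A V) : isFG k A V := by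
  obtain ⟨ι, _, F, σ, π, h1, h2, h3, h4⟩ := hV.exists_decomposition
  have hF : ∀ i, _root_.isFG k A (F i) := fun i => by
    obtain ⟨I, _, -, ⟨e⟩⟩ := h1 i
    have : Mono (σ i) := SplitMono.mono ⟨π i, h2 i⟩
    have hF : IsConstructible k A (F i) := ObjectProperty.prop_of_mono _ (σ i) hV
    exact (_root_.isFG k A).prop_of_iso e.symm
      (isFG_intervalRep ((IsConstructible k A).prop_of_iso e hF).finite_inter)
  refine (_root_.isFG k A).prop_of_iso (X := ⨁ F) ⟨biproduct.desc σ, biproduct.lift π, ?_, ?_⟩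
    (ObjectProperty.prop_of_isLimit _ (biproduct.isLimit F) fun i => hF i.as)
  · classical
    refine biproduct.hom_ext _ _ fun j => biproduct.hom_ext' _ _ fun i => ?_
    rw [Category.assoc, biproduct.lift_π, biproduct.ι_desc_assoc, Category.id_comp,
      biproduct.ι_π]
    split_ifs with h
    · subst h; simp [h2]
    · exact h3 i j h
  · rw [biproduct.lift_desc, h4]

/-- This identification yields closure of `rep` under subobjects, which is not apparent from a
presentation by generators. -/
theorem isFG_eq_isConstructible : isFG k A = IsConstructible k A :=
  funext fun _ => propext ⟨fun h => h.isConstructible, fun h => h.isFG⟩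

instance : (isFG k A).IsClosedUnderSubobjects := by
  rw [isFG_eq_isConstructible]; infer_instance

instance : (isFG k A).IsClosedUnderQuotients := by
  rw [isFG_eq_isConstructible]; infer_instance

lemma isFG_intervalRep_iff {I : Set ℝ} [hI : I.OrdConnected] :
    isFG k A (intervalRep k A I) ↔ (A.S ∩ I).Finite :=
  ⟨fun h => h.isConstructible.finite_inter, isFG_intervalRep⟩

/-- Every endomorphism of an interval summand is a scalar multiple of the identity, and nonzero
scalars are units. -/
theorem isKrullSchmidt_repFG : IsKrullSchmidt (RepFG k A) := by
  classical
  intro V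
  obtain ⟨ι, _, F, σ, π, h1, h2, h3, h4⟩ := V.property.isConstructible.exists_decomposition
  have hF : ∀ i, isFG k A (F i) := fun i => by
    have : Mono (σ i) := SplitMono.mono ⟨π i, h2 i⟩
    exact ObjectProperty.prop_of_mono _ (σ i) V.property
  let e := (Fintype.equivFin ι).symm
  refine ⟨Fintype.card ι, fun n => ⟨F (e n), hF _⟩, fun n => ?_, ⟨?_⟩⟩
  · obtain ⟨I, _, hI, ⟨φ⟩⟩ := h1 (e n)
    let X : RepFG k A := ⟨F (e n), hF _⟩
    have hid : 𝟙 (F (e n)) ≠ 0 := fun h => intervalRep_id_ne_zero (k := k) (A := A) hI (by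
      have : φ.inv ≫ 𝟙 _ ≫ φ.hom = 𝟙 _ := by simp
      rw [← this, h]; simp)
    have hsc : ∀ f : End X, ∃ c : k, f = c • (1 : End X) := fun f => by
      obtain ⟨c, hc⟩ := exists_eq_smul_intervalRep_hom (φ.inv ≫ f.hom ≫ φ.hom)
        (intervalRep_id_ne_zero hI)
      refine ⟨c, (isFG k A).hom_ext ?_⟩
      have : φ.hom ≫ (φ.inv ≫ f.hom ≫ φ.hom) ≫ φ.inv = f.hom := by simp
      rw [← this, hc]
      change _ = c • 𝟙 _
      simp
    have : Nontrivial (End X) := ⟨⟨1, 0, fun h => hid (congrArg (fun f => f.hom) h)⟩⟩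
    refine IsLocalRing.of_isUnit_or_isUnit_one_sub_self fun f => ?_
    have hu : ∀ c : k, c ≠ 0 → IsUnit (c • (1 : End X)) := fun c hc =>
      ⟨⟨c • 1, c⁻¹ • 1, by rw [smul_mul_smul_comm, mul_inv_cancel₀ hc, one_smul, one_mul],
        by rw [smul_mul_smul_comm, inv_mul_cancel₀ hc, one_smul, one_mul]⟩, rfl⟩
    obtain ⟨c, rfl⟩ := hsc f
    by_cases hc : c = 0
    · right
      rw [hc, zero_smul, sub_zero]
      exact isUnit_one
    · exact Or.inl (hu c hc)
  · refine ⟨biproduct.lift fun n => (isFG k A).homMk (π (e n)),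
      biproduct.desc fun n => (isFG k A).homMk (σ (e n)), ?_, ?_⟩
    · rw [biproduct.lift_desc]
      refine (isFG k A).hom_ext ?_
      have : (∑ n, (isFG k A).homMk (X := V) (Y := ⟨F (e n), hF _⟩) (π (e n)) ≫
          (isFG k A).homMk (X := ⟨F (e n), hF _⟩) (Y := V) (σ (e n))).hom =
          ∑ n, π (e n) ≫ σ (e n) := map_sum ((isFG k A).ι.mapAddHom (X := V) (Y := V)) _ _
      refine this.trans ?_
      rw [e.sum_comp (fun i => π i ≫ σ i), h4]
      rfl
    · refine biproduct.hom_ext _ _ fun j => biproduct.hom_ext' _ _ fun i => ?_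
      rw [Category.assoc, biproduct.lift_π, biproduct.ι_desc_assoc, Category.id_comp,
        biproduct.ι_π]
      refine (isFG k A).hom_ext ?_
      split_ifs with h
      · subst h; exact h2 _
      · exact h3 _ _ fun h' => h (e.injective h')

end Decomposition

/-! ### Cocycles describing extensions of intervals -/

section Cocycles

variable {k : Type u} [Field k] {A : ContinuousQuiverA}

open Classical in
/-- The cocycles that describe extensions of an interval representation `M_I` by another interval
representation `M_J`. -/
def IsCocycle (I J : Set ℝ) (c : A.Vertex → A.Vertex → k) : Prop :=
  ∀ x y z : A.Vertex, (x ⟶ y) → (y ⟶ z) → x.val ∈ I → z.val ∈ J →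
    c x z = (if y.val ∈ J then c x y else 0) + (if y.val ∈ I then c y z else 0)

open Classical in
/-- The coboundary of a function. -/
noncomputable def coboundary (I J : Set ℝ) (h : A.Vertex → k) (x y : A.Vertex) : k :=
  (if x.val ∈ J then h x else 0) - (if y.val ∈ I then h y else 0)

variable {I J : Set ℝ}

lemma IsCocycle.add {c d : A.Vertex → A.Vertex → k} (hc : IsCocycle I J c)
    (hd : IsCocycle I J d) : IsCocycle I J fun x y => c x y + d x y := by
  intro x y z a b hx hz
  dsimp only
  rw [hc x y z a b hx hz, hd x y z a b hx hz]
  split_ifs <;> ring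

lemma IsCocycle.smul {c : A.Vertex → A.Vertex → k} (hc : IsCocycle I J c) (r : k) :
    IsCocycle I J fun x y => r * c x y := by
  intro x y z a b hx hz
  dsimp only
  rw [hc x y z a b hx hz]
  split_ifs <;> ring

lemma coboundary_add_smul (r s : k) (h h' : A.Vertex → k) (x y : A.Vertex) :
    coboundary I J (fun z => r * h z + s * h' z) x y =
      r * coboundary I J h x y + s * coboundary I J h' x y := by
  simp only [coboundary]
  split_ifs <;> ring

lemma isCocycle_coboundary [hI : I.OrdConnected] [hJ : J.OrdConnected] (h : A.Vertex → k) :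
    IsCocycle I J (coboundary I J h) := by
  intro x y z a b hx hz
  have hy := mem_between_of_hom a b
  have h1 : x.val ∈ J → y.val ∈ J := fun h => hJ.uIcc_subset h hz hy
  have h2 : z.val ∈ I → y.val ∈ I := fun h => hI.uIcc_subset hx h hy
  simp only [coboundary]
  by_cases h3 : x.val ∈ J <;> by_cases h4 : z.val ∈ I <;> by_cases h5 : y.val ∈ I <;>
    by_cases h6 : y.val ∈ J <;> (simp_all; try ring)

/-- Values on the pairs of points of two separated sets agree if they agree for neighbours. -/
lemma eq_of_separated {α : Type*} {U W : Set ℝ} {d : A.Vertex → A.Vertex → α}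
    (hUW : (∀ u ∈ U, ∀ w ∈ W, u < w) ∨ (∀ u ∈ U, ∀ w ∈ W, w < u))
    (h1 : ∀ x x' y : A.Vertex, (x ⟶ x') → (x' ⟶ y) → x.val ∈ U → x'.val ∈ U → y.val ∈ W →
      d x y = d x' y)
    (h2 : ∀ x y' y : A.Vertex, (x ⟶ y') → (y' ⟶ y) → x.val ∈ U → y'.val ∈ W → y.val ∈ W →
      d x y = d x y') {x y x' y' : A.Vertex} (a : x ⟶ y) (a' : x' ⟶ y') (hx : x.val ∈ U)
    (hx' : x'.val ∈ U) (hy : y.val ∈ W) (hy' : y'.val ∈ W) : d x y = d x' y' := by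
  have key : ∀ {x y x' y' : A.Vertex}, (x ⟶ y) → x.val ∈ U → x'.val ∈ U → y.val ∈ W →
      y'.val ∈ W → x' ∈ between x y → y' ∈ between x' y → d x y = d x' y' := by
    intro x y x' y' a hx hx' hy hy' hb hb'
    obtain ⟨⟨b⟩, ⟨b'⟩⟩ := hom_of_mem_between a hb
    obtain ⟨⟨e⟩, ⟨e'⟩⟩ := hom_of_mem_between b' hb'
    rw [h1 x x' y b b' hx hx' hy, h2 x' y' y e e' hx' hy' hy]
  -- The inner one of x, x' and the inner one of y, y' form a pair nested in both given pairs; each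
  -- of these is then moved to it one end at a time.
  have hsel : ∃ x'' y'' : A.Vertex, x''.val ∈ U ∧ y''.val ∈ W ∧ x'' ∈ between x y ∧
      y'' ∈ between x'' y ∧ x'' ∈ between x' y' ∧ y'' ∈ between x'' y' := by
    simp only [between, Set.mem_ofPred_eq, Set.mem_uIcc]
    rcases hUW with h | h
    · have := h _ hx _ hy
      have := h _ hx _ hy'
      have := h _ hx' _ hy
      have := h _ hx' _ hy'
      refine ⟨if x.val ≤ x'.val then x' else x, if y.val ≤ y'.val then y else y', ?_⟩
      split_ifs <;> grind
    · have := h _ hx _ hy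
      have := h _ hx _ hy'
      have := h _ hx' _ hy
      have := h _ hx' _ hy'
      refine ⟨if x.val ≤ x'.val then x else x', if y.val ≤ y'.val then y' else y, ?_⟩
      split_ifs <;> grind
  obtain ⟨x'', y'', h3, h4, h5, h6, h7, h8⟩ := hsel
  rw [key a hx h3 hy h4 h5 h6, key a' hx' h3 hy' h4 h7 h8]

/-- The pairs of points that connect the part of `I ∪ J` in `H` with `I ∩ J`. -/
def IsCrossing (I J H : Set ℝ) (x y : A.Vertex) : Prop :=
  (x.val ∈ I ∧ x.val ∉ J ∧ x.val ∈ H ∧ y.val ∈ I ∧ y.val ∈ J) ∨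
    (x.val ∈ I ∧ x.val ∈ J ∧ y.val ∉ I ∧ y.val ∈ J ∧ y.val ∈ H)

variable [hI : I.OrdConnected] [hJ : J.OrdConnected]

/-- Whichever of x and y is nearer to p lies between p and the other, hence in the interval of the
other. So crossings of the two kinds cannot occur on the same side of p. -/
lemma mem_or_mem_of_same_side {p : ℝ} (hpI : p ∈ I) (hpJ : p ∈ J) {H : Set ℝ}
    (hH : H = Set.Iio p ∨ H = Set.Ioi p) {x y : ℝ} (hx : x ∈ I) (hy : y ∈ J) (hxH : x ∈ H)
    (hyH : y ∈ H) : x ∈ J ∨ y ∈ I := by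
  rcases hH with rfl | rfl <;> rcases le_total x y with h | h
  · exact Or.inr (hI.out hx hpI ⟨h, le_of_lt hyH⟩)
  · exact Or.inl (hJ.out hy hpJ ⟨h, le_of_lt hxH⟩)
  · exact Or.inl (hJ.out hpJ hy ⟨le_of_lt hxH, h⟩)
  · exact Or.inr (hI.out hpI hx ⟨le_of_lt hyH, h⟩)

/-- A cocycle that vanishes on `I ∩ J` is constant on the crossings of each side. -/
lemma IsCocycle.eq_of_isCrossing {c : A.Vertex → A.Vertex → k} (hc : IsCocycle I J c)
    (hL : ∀ x y : A.Vertex, (x ⟶ y) → x.val ∈ I → x.val ∈ J → y.val ∈ I → y.val ∈ J → c x y = 0)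
    {p : ℝ} (hpI : p ∈ I) (hpJ : p ∈ J) {H : Set ℝ}
    (hH : H = Set.Iio p ∨ H = Set.Ioi p) {x y x' y' : A.Vertex} (a : x ⟶ y) (a' : x' ⟶ y')
    (h : IsCrossing I J H x y) (h' : IsCrossing I J H x' y') : c x y = c x' y' := by
  have hsep : ∀ {K : Set ℝ}, K.OrdConnected → p ∈ K → (∀ z ∈ H, z ∉ K → ∀ y ∈ K, z < y) ∨
      (∀ z ∈ H, z ∉ K → ∀ y ∈ K, y < z) := by
    intro K hK hpK
    rcases hH with rfl | rfl
    · refine Or.inl fun z hz hzK y hy => ?_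
      by_contra hle
      exact hzK (hK.out hy hpK ⟨not_lt.1 hle, le_of_lt hz⟩)
    · refine Or.inr fun z hz hzK y hy => ?_
      by_contra hle
      exact hzK (hK.out hpK hy ⟨le_of_lt hz, not_lt.1 hle⟩)
  rcases h with ⟨h1, h2, h3, h4, h5⟩ | ⟨h1, h2, h3, h4, h5⟩ <;>
    rcases h' with ⟨h1', h2', h3', h4', h5'⟩ | ⟨h1', h2', h3', h4', h5'⟩
  · refine eq_of_separated (U := {x | x ∈ I ∧ x ∉ J ∧ x ∈ H}) (W := I ∩ J) ?_ ?_ ?_ a a'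
      ⟨h1, h2, h3⟩ ⟨h1', h2', h3'⟩ ⟨h4, h5⟩ ⟨h4', h5'⟩
    · exact (hsep hJ hpJ).imp (fun h u hu w hw => h u hu.2.2 hu.2.1 w hw.2)
        (fun h u hu w hw => h u hu.2.2 hu.2.1 w hw.2)
    · intro x x' y a b hx hx' hy
      rw [hc x x' y a b hx.1 hy.2, if_neg hx'.2.1, if_pos hx'.1, zero_add]
    · intro x y' y a b hx hy' hy
      rw [hc x y' y a b hx.1 hy.2, if_pos hy'.2, if_pos hy'.1, hL y' y b hy'.1 hy'.2 hy.1 hy.2,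
        add_zero]
  · exact absurd (mem_or_mem_of_same_side hpI hpJ hH h1 h4' h3 h5') (by tauto)
  · exact absurd (mem_or_mem_of_same_side hpI hpJ hH h1' h4 h3' h5) (by tauto)
  · refine eq_of_separated (U := I ∩ J) (W := {x | x ∈ J ∧ x ∉ I ∧ x ∈ H}) ?_ ?_ ?_ a a'
      ⟨h1, h2⟩ ⟨h1', h2'⟩ ⟨h4, h3, h5⟩ ⟨h4', h3', h5'⟩
    · exact ((hsep hI hpI).imp (fun h u hu w hw => h w hw.2.2 hw.2.1 u hu.1)
        (fun h u hu w hw => h w hw.2.2 hw.2.1 u hu.1)).symm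
    · intro x x' y a b hx hx' hy
      rw [hc x x' y a b hx.1 hy.1, if_pos hx'.1, if_pos hx'.2, hL x x' a hx.1 hx.2 hx'.1 hx'.2,
        zero_add]
    · intro x y' y a b hx hy' hy
      rw [hc x y' y a b hx.1 hy.1, if_neg hy'.2.1, if_pos hy'.1, add_zero]

lemma exists_ne_zero_mul_add_mul_eq_zero (s t : k) :
    ∃ a b : k, (a ≠ 0 ∨ b ≠ 0) ∧ a * s + b * t = 0 := by
  by_cases hs : s = 0
  · exact ⟨1, 0, Or.inl one_ne_zero, by rw [hs]; ring⟩
  · exact ⟨t, -s, Or.inr (neg_ne_zero.2 hs), by ring⟩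

/-- An arrow from I to J that is neither inside I ∩ J nor a crossing has its ends on opposite sides
of p, so the cocycle condition at p breaks its value into two crossing values. -/
lemma IsCocycle.eq_zero_of_crossings {c : A.Vertex → A.Vertex → k} (hc : IsCocycle I J c)
    (hL : ∀ x y : A.Vertex, (x ⟶ y) → x.val ∈ I → x.val ∈ J → y.val ∈ I → y.val ∈ J → c x y = 0)
    {p : A.Vertex} (hpI : p.val ∈ I) (hpJ : p.val ∈ J)
    (hl : ∀ x y, (x ⟶ y) → IsCrossing I J (Set.Iio p.val) x y → c x y = 0)
    (hr : ∀ x y, (x ⟶ y) → IsCrossing I J (Set.Ioi p.val) x y → c x y = 0) {x y : A.Vertex}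
    (a : x ⟶ y) (hx : x.val ∈ I) (hy : y.val ∈ J) : c x y = 0 := by
  have side : ∀ {z : ℝ} {K : Set ℝ}, p.val ∈ K → z ∉ K → z ∈ Set.Iio p.val ∨ z ∈ Set.Ioi p.val :=
    fun {z K} hp hz => lt_or_gt_of_ne (a := z) (b := p.val) fun h => hz (by rwa [h])
  have hxL : ∀ x y : A.Vertex, (x ⟶ y) → x.val ∈ I → x.val ∉ J → y.val ∈ I → y.val ∈ J →
      c x y = 0 := by
    intro x y a h1 h2 h3 h4
    rcases side hpJ h2 with h | h
    · exact hl x y a (Or.inl ⟨h1, h2, h, h3, h4⟩)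
    · exact hr x y a (Or.inl ⟨h1, h2, h, h3, h4⟩)
  have hyL : ∀ x y : A.Vertex, (x ⟶ y) → x.val ∈ I → x.val ∈ J → y.val ∉ I → y.val ∈ J →
      c x y = 0 := by
    intro x y a h1 h2 h3 h4
    rcases side hpI h3 with h | h
    · exact hl x y a (Or.inr ⟨h1, h2, h3, h4, h⟩)
    · exact hr x y a (Or.inr ⟨h1, h2, h3, h4, h⟩)
  by_cases hxJ : x.val ∈ J <;> by_cases hyI : y.val ∈ I
  · exact hL x y a hx hxJ hyI hy
  · exact hyL x y a hx hxJ hyI hy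
  · exact hxL x y a hx hxJ hyI hy
  · have hp : p ∈ between x y := by
      have hs := side hpJ hxJ
      have hs' := side hpI hyI
      have hn : ∀ H : Set ℝ, H = Set.Iio p.val ∨ H = Set.Ioi p.val → x.val ∈ H → y.val ∉ H :=
        fun H hH h h' => (mem_or_mem_of_same_side hpI hpJ hH hx hy h h').elim hxJ hyI
      have h1 := hn _ (Or.inl rfl)
      have h2 := hn _ (Or.inr rfl)
      simp only [Set.mem_Iio, Set.mem_Ioi] at hs hs' h1 h2
      rw [mem_between, Set.mem_uIcc]
      grind
    obtain ⟨⟨b⟩, ⟨b'⟩⟩ := hom_of_mem_between a hp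
    rw [hc x p y b b' hx hy, if_pos hpJ, if_pos hpI, hxL x p b hx hxJ hpI hpJ,
      hyL p y b' hpI hpJ hyI hy, add_zero]

/-- Any two cocycles are linearly dependent modulo coboundaries. -/
theorem IsCocycle.exists_smul_add_smul_eq_coboundary {c d : A.Vertex → A.Vertex → k}
    (hc : IsCocycle I J c) (hd : IsCocycle I J d) : ∃ r s : k, (r ≠ 0 ∨ s ≠ 0) ∧
      ∃ h : A.Vertex → k, ∀ x y : A.Vertex, (x ⟶ y) → x.val ∈ I → y.val ∈ J →
        r * c x y + s * d x y = coboundary I J h x y := by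
  -- For disjoint intervals a cocycle has a single value on all arrows from I to J, and two scalars
  -- are dependent.
  rcases (I ∩ J).eq_empty_or_nonempty with hIJ | ⟨p, hpI, hpJ⟩
  · have hdisj : ∀ x ∈ I, x ∉ J := fun x hx hx' => by
      have : x ∈ I ∩ J := ⟨hx, hx'⟩
      simp [hIJ] at this
    by_cases hex : ∃ x₀ y₀ : A.Vertex, Nonempty (x₀ ⟶ y₀) ∧ x₀.val ∈ I ∧ y₀.val ∈ J
    · obtain ⟨x₀, y₀, ⟨a₀⟩, hx₀, hy₀⟩ := hex
      have hsep : (∀ u ∈ I, ∀ w ∈ J, u < w) ∨ (∀ u ∈ I, ∀ w ∈ J, w < u) := by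
        have key : ∀ u ∈ I, ∀ w ∈ J, ∀ u' ∈ I, ∀ w' ∈ J, u < w → u' < w' := by
          intro u hu w hw u' hu' w' hw' h
          by_contra h'
          rw [not_lt] at h'
          rcases le_total u w' with h1 | h1
          · exact hdisj w' (hI.out hu hu' ⟨h1, h'⟩) hw'
          · exact hdisj u hu (hJ.out hw' hw ⟨h1, h.le⟩)
        rcases lt_or_gt_of_ne (fun h : x₀.val = y₀.val => hdisj _ hx₀ (h ▸ hy₀)) with h | h
        · exact Or.inl fun u hu w hw => key _ hx₀ _ hy₀ u hu w hw h
        · refine Or.inr fun u hu w hw => ?_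
          by_contra h'
          have h'' := lt_of_le_of_ne (not_lt.1 h') (fun e => hdisj _ hu (e ▸ hw))
          exact absurd (key u hu w hw _ hx₀ _ hy₀ h'') (not_lt.2 (le_of_lt h))
      have hconst : ∀ {c : A.Vertex → A.Vertex → k}, IsCocycle I J c → ∀ x y : A.Vertex,
          (x ⟶ y) → x.val ∈ I → y.val ∈ J → c x y = c x₀ y₀ := by
        intro c hc x y a hx hy
        refine eq_of_separated hsep ?_ ?_ a a₀ hx hx₀ hy hy₀
        · intro x x' y a b hx hx' hy
          rw [hc x x' y a b hx hy, if_neg (hdisj _ hx'), if_pos hx', zero_add]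
        · intro x y' y a b hx hy' hy
          rw [hc x y' y a b hx hy, if_pos hy', if_neg fun h => hdisj _ h hy', add_zero]
      obtain ⟨r, s, hrs, h⟩ := exists_ne_zero_mul_add_mul_eq_zero (c x₀ y₀) (d x₀ y₀)
      refine ⟨r, s, hrs, 0, fun x y a hx hy => ?_⟩
      rw [hconst hc x y a hx hy, hconst hd x y a hx hy, h]
      simp [coboundary]
    · exact ⟨1, 0, Or.inl one_ne_zero, 0, fun x y a hx hy => (hex ⟨x, y, ⟨a⟩, hx, hy⟩).elim⟩
  -- On I ∩ J the cocycle condition is the plain additive one, so a cocycle can be normalised by a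
  -- coboundary to vanish there.
  · have hcob : ∀ {c : A.Vertex → A.Vertex → k}, IsCocycle I J c → ∃ h : A.Vertex → k,
        ∀ x y : A.Vertex, (x ⟶ y) → x.val ∈ I → x.val ∈ J → y.val ∈ I → y.val ∈ J →
          c x y + (-1) * coboundary I J h x y = 0 := by
      intro c hc
      obtain ⟨h, hh⟩ := (isConvexSet_val (A := A) (I ∩ J)).exists_coboundary
        (G := Multiplicative k) (fun x y => Multiplicative.ofAdd (c x y)) (by
          intro x hx y hy z hz a b
          rw [hc x y z a b hx.1 hz.2, if_pos hy.2, if_pos hy.1, ofAdd_add])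
      refine ⟨fun x => Multiplicative.toAdd (h x), fun x y a h1 h2 h3 h4 => ?_⟩
      have := congrArg Multiplicative.toAdd (hh x ⟨h1, h2⟩ y ⟨h3, h4⟩ a)
      rw [toAdd_ofAdd, toAdd_div] at this
      rw [this, coboundary, if_pos h2, if_pos h3]
      ring
    obtain ⟨h₁, hh₁⟩ := hcob hc
    obtain ⟨h₂, hh₂⟩ := hcob hd
    set c' : A.Vertex → A.Vertex → k := fun x y => c x y + (-1) * coboundary I J h₁ x y with hc'
    set d' : A.Vertex → A.Vertex → k := fun x y => d x y + (-1) * coboundary I J h₂ x y with hd'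
    have hcc : IsCocycle I J c' := hc.add ((isCocycle_coboundary h₁).smul (-1))
    have hdd : IsCocycle I J d' := hd.add ((isCocycle_coboundary h₂).smul (-1))
    -- The coboundary of the constant 1 vanishes on I ∩ J and is nonzero on every crossing: it is a
    -- correction compatible with the normalisation.
    set e : A.Vertex → A.Vertex → k := coboundary I J fun _ => 1 with he
    have hee : IsCocycle I J e := isCocycle_coboundary _
    have heL : ∀ x y : A.Vertex, (x ⟶ y) → x.val ∈ I → x.val ∈ J → y.val ∈ I → y.val ∈ J →
        e x y = 0 := by
      intro x y _ _ h2 h3 _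
      simp [he, coboundary, h2, h3]
    have heX : ∀ {H : Set ℝ} {x y : A.Vertex}, IsCrossing I J H x y → e x y ≠ 0 := by
      rintro H x y (⟨h1, h2, h3, h4, h5⟩ | ⟨h1, h2, h3, h4, h5⟩)
      · simp [he, coboundary, h2, h4]
      · simp [he, coboundary, h2, h3]
    suffices ∃ r s t : k, (r ≠ 0 ∨ s ≠ 0) ∧ ∀ x y : A.Vertex, (x ⟶ y) → x.val ∈ I → y.val ∈ J →
        r * c' x y + s * d' x y + t * e x y = 0 by
      obtain ⟨r, s, t, hrs, h⟩ := this
      refine ⟨r, s, hrs, fun z => 1 * (r * h₁ z + s * h₂ z) + (-t) * 1, fun x y a hx hy => ?_⟩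
      have := h x y a hx hy
      rw [coboundary_add_smul, coboundary_add_smul]
      simp only [hc', hd', he] at this
      linear_combination this
    let q : A.Vertex := p
    have hcomb : ∀ r s t : k, IsCocycle I J fun x y => r * c' x y + s * d' x y + t * e x y :=
      fun r s t => ((hcc.smul r).add (hdd.smul s)).add (hee.smul t)
    have hcombL : ∀ r s t : k, ∀ x y : A.Vertex, (x ⟶ y) → x.val ∈ I → x.val ∈ J → y.val ∈ I →
        y.val ∈ J → r * c' x y + s * d' x y + t * e x y = 0 := by
      intro r s t x y a h1 h2 h3 h4
      have e1 : c' x y = 0 := hh₁ x y a h1 h2 h3 h4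
      have e2 : d' x y = 0 := hh₂ x y a h1 h2 h3 h4
      rw [e1, e2, heL x y a h1 h2 h3 h4]
      ring
    have hval : ∀ H : Set ℝ, H = Set.Iio p ∨ H = Set.Ioi p → ∃ γ δ ε : k,
        (ε = 0 → γ = 0 ∧ δ = 0) ∧ ∀ x y : A.Vertex, (x ⟶ y) → IsCrossing I J H x y →
          c' x y = γ ∧ d' x y = δ ∧ e x y = ε := by
      intro H hH
      by_cases hex : ∃ x₀ y₀ : A.Vertex, Nonempty (x₀ ⟶ y₀) ∧ IsCrossing I J H x₀ y₀
      · obtain ⟨x₀, y₀, ⟨a₀⟩, h₀⟩ := hex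
        exact ⟨c' x₀ y₀, d' x₀ y₀, e x₀ y₀, fun h => absurd h (heX h₀), fun x y a h =>
          ⟨hcc.eq_of_isCrossing hh₁ hpI hpJ hH a a₀ h h₀,
            hdd.eq_of_isCrossing hh₂ hpI hpJ hH a a₀ h h₀,
            hee.eq_of_isCrossing heL hpI hpJ hH a a₀ h h₀⟩⟩
      · exact ⟨0, 0, 0, fun _ => ⟨rfl, rfl⟩, fun x y a h => (hex ⟨x, y, ⟨a⟩, h⟩).elim⟩
    obtain ⟨γ, δ, ε, hε, hl⟩ := hval _ (Or.inl rfl)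
    obtain ⟨γ', δ', ε', -, hr⟩ := hval _ (Or.inr rfl)
    -- For any r and s a multiple of e cancels the crossings on the left. What remains on the right
    -- is one linear equation in r and s. Without left crossings γ, δ and ε are 0, and the division
    -- by 0 is harmless.
    obtain ⟨r, s, hrs, h⟩ := exists_ne_zero_mul_add_mul_eq_zero (γ' - γ / ε * ε') (δ' - δ / ε * ε')
    refine ⟨r, s, -(r * (γ / ε) + s * (δ / ε)), hrs, fun x y a hx hy => ?_⟩
    refine (hcomb _ _ _).eq_zero_of_crossings (hcombL _ _ _) (p := q) hpI hpJ ?_ ?_ a hx hy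
    · intro x y a hxy
      obtain ⟨h1, h2, h3⟩ := hl x y a hxy
      rw [h1, h2, h3]
      by_cases h0 : ε = 0
      · simp [hε h0]
      · field_simp
        ring
    · intro x y a hxy
      obtain ⟨h1, h2, h3⟩ := hr x y a hxy
      rw [h1, h2, h3]
      linear_combination h

end Cocycles

/-! ### First extension classes and a criterion for lines -/

section Effaceable

variable {C : Type v} [Category.{w} C] [Abelian C] [HasExt.{u} C]

open DerivedCategory Pretriangulated in
/-- Extension classes are killed by an epimorphism. -/
theorem exists_epi_comp_eq_zero {X Y : C} (e : Abelian.Ext.{u} X Y 1) :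
    ∃ (P : C) (p : P ⟶ X), Epi p ∧ (Abelian.Ext.mk₀ p).comp e (zero_add 1) = 0 := by
  let := HasDerivedCategory.standard C
  let α : (singleFunctor C 0).obj X ⟶ ((singleFunctor C 0).obj Y)⟦(1 : ℤ)⟧ := e.hom
  -- The third vertex of the triangle on X → Y[1] is the extension itself. Both outer terms sit in
  -- degree 0, hence so does E, and the class dies on E because consecutive maps of a triangle
  -- compose to zero.
  obtain ⟨E, i, q, hT⟩ := distinguished_cocone_triangle₂ α
  have h1 : E.IsGE 0 := TStructure.t.isGE₂ _ hT 0
    (inferInstanceAs (((singleFunctor C 0).obj Y).IsGE 0))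
    (inferInstanceAs (((singleFunctor C 0).obj X).IsGE 0))
  have h2 : E.IsLE 0 := TStructure.t.isLE₂ _ hT 0
    (inferInstanceAs (((singleFunctor C 0).obj Y).IsLE 0))
    (inferInstanceAs (((singleFunctor C 0).obj X).IsLE 0))
  obtain ⟨P, ⟨φ⟩⟩ := exists_iso_singleFunctor_obj_of_isGE_of_isLE E 0
  obtain ⟨p, hp⟩ := (singleFunctor C 0).map_surjective (φ.inv ≫ q)
  have hq : q ≫ α = 0 := comp_distTriang_mor_zero₂₃ _ hT
  refine ⟨P, p, Preadditive.epi_of_cancel_zero _ fun {Z} r hr => ?_, ?_⟩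
  · apply (singleFunctor C 0).map_injective
    rw [Functor.map_zero]
    have h3 : q ≫ (singleFunctor C 0).map r = 0 := by
      rw [← cancel_epi φ.inv, ← Category.assoc, ← hp, ← Functor.map_comp, hr, Functor.map_zero,
        comp_zero]
    -- A map out of X that vanishes on E factors through Y[1]. This lies in degree -1 and has no
    -- nonzero map to an object in degree 0.
    obtain ⟨s, hs⟩ := Triangle.yoneda_exact₃ _ hT ((singleFunctor C 0).map r) h3
    have : TStructure.t.IsLE (((singleFunctor C 0).obj Y)⟦(1 : ℤ)⟧) (-1) :=
      TStructure.t.isLE_shift _ 0 1 (-1)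
    have hs0 : s = 0 := TStructure.t.zero_of_isLE_of_isGE s (-1) 0 (by decide) this
      (inferInstanceAs (((singleFunctor C 0).obj Z).IsGE 0))
    rw [hs, hs0, comp_zero]
    rfl
  · ext
    rw [← Abelian.Ext.singleFunctor_map_comp_hom, hp, Abelian.Ext.zero_hom, Category.assoc]
    exact (congrArg (φ.inv ≫ ·) hq).trans comp_zero

/-- A criterion for first extension spaces to be at most one-dimensional. -/
theorem isLineOrZero_ext {k : Type*} [Field k] [Linear k C] {X Y : C}
    (h : ∀ {S : ShortComplex C} (_ : S.ShortExact) (_ : S.X₃ = X) (f g : S.X₁ ⟶ Y),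
      ∃ r s : k, (r ≠ 0 ∨ s ≠ 0) ∧ ∃ t : S.X₂ ⟶ Y, r • f + s • g = S.f ≫ t) :
    IsLineOrZero k (Abelian.Ext.{u} X Y 1) := by
  refine isLineOrZero_of_forall fun e e' he' => ?_
  -- Applying effacement twice gives one epimorphism killing both classes. By the long exact
  -- sequence they come from morphisms on its kernel, and morphisms that extend to the middle term
  -- give the zero class.
  obtain ⟨P₁, p₁, _, h₁⟩ := exists_epi_comp_eq_zero e
  obtain ⟨P₂, p₂, _, h₂⟩ := exists_epi_comp_eq_zero
    ((Abelian.Ext.mk₀ p₁).comp e' (zero_add 1))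
  have hS : (ShortComplex.mk (kernel.ι (p₂ ≫ p₁)) (p₂ ≫ p₁) (kernel.condition _)).ShortExact :=
    { exact := ShortComplex.exact_kernel _
      mono_f := by dsimp; infer_instance
      epi_g := by dsimp; infer_instance }
  rw [Abelian.Ext.mk₀_comp_mk₀_assoc] at h₂
  obtain ⟨x, hx⟩ := Abelian.Ext.contravariant_sequence_exact₃ hS Y e (by
    change (Abelian.Ext.mk₀ (p₂ ≫ p₁)).comp e _ = 0
    rw [← Abelian.Ext.mk₀_comp_mk₀_assoc, h₁, Abelian.Ext.comp_zero]) (n₀ := 0) rfl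
  obtain ⟨x', hx'⟩ := Abelian.Ext.contravariant_sequence_exact₃ hS Y e' h₂ (n₀ := 0) rfl
  obtain ⟨f, rfl⟩ := (Abelian.Ext.mk₀_bijective _ _).2 x
  obtain ⟨f', rfl⟩ := (Abelian.Ext.mk₀_bijective _ _).2 x'
  obtain ⟨r, s, hrs, t, ht⟩ := h hS rfl f f'
  have key : r • e + s • e' = 0 := by
    rw [← hx, ← hx', ← Abelian.Ext.comp_smul, ← Abelian.Ext.comp_smul, ← Abelian.Ext.comp_add,
      ← Abelian.Ext.mk₀_smul, ← Abelian.Ext.mk₀_smul, ← Abelian.Ext.mk₀_add, ht,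
      ← Abelian.Ext.mk₀_comp_mk₀, hS.extClass_comp_assoc]
  by_cases hr : r = 0
  · rw [hr, zero_smul, zero_add] at key
    exact absurd key (smul_ne_zero (hrs.resolve_left fun h => h hr) he')
  · refine ⟨-(r⁻¹ * s), ?_⟩
    rw [neg_smul, mul_smul, ← smul_neg, ← eq_neg_of_add_eq_zero_left key, smul_smul,
      inv_mul_cancel₀ hr, one_smul]

end Effaceable

/-! ### Extending morphisms from a kernel with interval quotient -/

section Lifting

variable {k : Type u} [Field k] {A : ContinuousQuiverA}

/-- Two morphisms from a subobject to an interval representation have a nontrivial linear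
combination that extends, if the quotient is an interval representation. -/
theorem exists_smul_add_smul_eq_comp {S : ShortComplex (QRep k A)} (hS : S.ShortExact)
    {I J : Set ℝ} [hI : I.OrdConnected] [hJ : J.OrdConnected] (φ : S.X₃ ≅ intervalRep k A I)
    (f g : S.X₁ ⟶ intervalRep k A J) : ∃ r s : k, (r ≠ 0 ∨ s ≠ 0) ∧
      ∃ t : S.X₂ ⟶ intervalRep k A J, r • f + s • g = S.f ≫ t := by
  classical
  let i := S.f
  let p := S.g ≫ φ.hom
  have hip : ∀ x u, (p.app x).hom ((i.app x).hom u) = 0 := fun x u => by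
    rw [← qrep_comp_app]
    simp only [i, p, S.zero_assoc, zero_comp]
    rfl
  have hi : ∀ x, Function.Injective (i.app x).hom := (qrep_mono_iff _).1 hS.mono_f
  have hp : ∀ x, Function.Surjective (p.app x).hom := (qrep_epi_iff _).1 (by
    have := hS.epi_g
    exact epi_comp _ _)
  have hφ : ∀ x, Function.Injective (φ.hom.app x).hom := (qrep_mono_iff _).1 inferInstance
  have hex : ∀ x v, (p.app x).hom v = 0 → ∃ u, (i.app x).hom u = v := fun x v hv =>
    (qrep_exact_iff S).1 hS.exact x v (hφ x (by rw [map_zero]; exact hv))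
  -- Chosen lifts of the generators of the quotient. Every v is then its kernel component, called ρ
  -- x v below, plus its coordinate times w x.
  choose w hw using fun x => hp x (stdVec k I x)
  -- the kernel component of an element
  have hker : ∀ x v, ∃ u, (i.app x).hom u = v - coord I x ((p.app x).hom v) • w x := fun x v =>
    hex x _ (by rw [map_sub, map_smul, hw, coord_smul_stdVec, sub_self])
  choose ρ hρ using hker
  have hρ_eq : ∀ x v u, (i.app x).hom u = v - coord I x ((p.app x).hom v) • w x → ρ x v = u :=
    fun x v u h => hi x (by rw [hρ, h])
  have hρ_add : ∀ x v v', ρ x (v + v') = ρ x v + ρ x v' := fun x v v' => hρ_eq _ _ _ (by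
    rw [map_add, hρ, hρ, map_add, map_add, add_smul]; abel)
  have hρ_smul : ∀ x (c : k) v, ρ x (c • v) = c • ρ x v := fun x c v => hρ_eq _ _ _ (by
    rw [map_smul, hρ, map_smul, map_smul, smul_sub, smul_smul, smul_eq_mul])
  have hρ_i : ∀ x u, ρ x ((i.app x).hom u) = u := fun x u => hρ_eq _ _ _ (by
    rw [hip, map_zero, zero_smul, sub_zero])
  -- The failure of the lifts to be natural, measured through f. An extension of f is determined by
  -- its values at the lifts, and naturality asks that the coboundary of these values be c f.
  let c : (S.X₁ ⟶ intervalRep k A J) → A.Vertex → A.Vertex → k := fun f x y =>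
    if a : Nonempty (x ⟶ y) then coord J y ((f.app y).hom (ρ y ((S.X₂.map a.some).hom (w x))))
    else 0
  have hcval : ∀ f {x y : A.Vertex} (a : x ⟶ y),
      c f x y = coord J y ((f.app y).hom (ρ y ((S.X₂.map a).hom (w x)))) := fun f x y a => by
    simp only [c, dif_pos (⟨a⟩ : Nonempty (x ⟶ y))]
    rw [hom_eq (Nonempty.some _) a]
  have hmap : ∀ {x y : A.Vertex} (a : x ⟶ y) v, (S.X₂.map a).hom v =
      (i.app y).hom (ρ y ((S.X₂.map a).hom v)) +
        coord I y ((p.app y).hom ((S.X₂.map a).hom v)) • w y := fun a v => by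
    rw [hρ, sub_add_cancel]
  have hcoordw : ∀ {x y : A.Vertex} (a : x ⟶ y), x.val ∈ I →
      coord I y ((p.app y).hom ((S.X₂.map a).hom (w x))) = if y.val ∈ I then 1 else 0 := by
    intro x y a hx
    rw [nat_apply, hw, coord_map, coord_stdVec hx]
  have hcoc : ∀ f, IsCocycle I J (c f) := by
    intro f x y z a b hx hz
    rw [hcval f (a ≫ b), ← map_comp_apply, hmap a, map_add, ← nat_apply, map_smul, hρ_add, hρ_i,
      hρ_smul, map_add, map_add, map_smul, map_smul, ← hcval f b, hcoordw a hx, nat_apply,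
      coord_map, if_pos hz, hcval f a]
    congr 1
    · split_ifs with hy
      · rfl
      · exact coord_of_notMem hy _
    · simp
  obtain ⟨r, s, hrs, h, hh⟩ := (hcoc f).exists_smul_add_smul_eq_coboundary (hcoc g)
  refine ⟨r, s, hrs, ?_⟩
  have hfg : ∀ x u, ((r • f + s • g).app x).hom u = r • (f.app x).hom u + s • (g.app x).hom u :=
    fun x u => rfl
  set F := r • f + s • g with hF
  let t : ∀ x, S.X₂.obj x →ₗ[k] (intervalRep k A J).obj x := fun x =>
    { toFun := fun v => (F.app x).hom (ρ x v) +
        (coord I x ((p.app x).hom v) * h x) • stdVec k J x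
      map_add' := fun v v' => by
        simp only [hρ_add, map_add, add_mul, add_smul]
        abel
      map_smul' := fun a v => by
        simp only [hρ_smul, map_smul, smul_add, smul_smul, smul_eq_mul,
          RingHom.id_apply, mul_assoc] }
  have ht : ∀ x v, t x v = (F.app x).hom (ρ x v) +
        (coord I x ((p.app x).hom v) * h x) • stdVec k J x := fun _ _ => rfl
  have hti : ∀ x u, t x ((i.app x).hom u) = (F.app x).hom u := fun x u => by
    rw [ht, hρ_i, hip, map_zero, zero_mul, zero_smul, add_zero]
  have hcF : ∀ {x y : A.Vertex} (a : x ⟶ y), y.val ∈ J →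
      coord J y ((F.app y).hom (ρ y ((S.X₂.map a).hom (w x)))) = r * c f x y + s * c g x y := by
    intro x y a hy
    rw [hfg, map_add, map_smul, map_smul, hcval f a, hcval g a]
    rfl
  have htn : NatOn t Set.univ := by
    intro x y a _ _ v
    have hv : v = (i.app x).hom (ρ x v) + coord I x ((p.app x).hom v) • w x := by
      rw [hρ, sub_add_cancel]
    suffices hww : x.val ∈ I → t y ((S.X₂.map a).hom (w x)) =
        ((intervalRep k A J).map a).hom (t x (w x)) by
      by_cases hx : x.val ∈ I
      · rw [hv]
        simp only [map_add, map_smul]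
        rw [hww hx, ← nat_apply i, hti, hti, nat_apply]
      · rw [coord_of_notMem hx, zero_smul, add_zero] at hv
        rw [hv, ← nat_apply i, hti, hti, nat_apply]
    intro hx
    apply coord_injective
    by_cases hy : y.val ∈ J
    · have h0 : ρ x (w x) = 0 := hρ_eq _ _ _ (by
        rw [map_zero, hw, coord_stdVec hx, one_smul, sub_self])
      rw [coord_map, if_pos hy, ht, ht, h0, hw, coord_stdVec hx, hcoordw a hx, map_zero, zero_add,
        map_add, hcF a hy, hh x y a hx hy, map_smul, map_smul, coord_stdVec hy, coboundary]
      by_cases hx' : x.val ∈ J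
      · simp [coord_stdVec hx', hx']
      · simp [coord_of_notMem hx', hx']
    · rw [coord_of_notMem hy, coord_of_notMem hy]
  exact ⟨htn.toHom, qrep_hom_ext fun x => LinearMap.ext fun u => (hti x u).symm⟩

end Lifting

/-! ### Exactness in the subcategories, and their Ext spaces -/

section SubcategoryExactness

variable {C : Type v} [Category.{w} C] [Abelian C] (P : ObjectProperty C) [P.ContainsZero]
  [P.IsClosedUnderKernels] [P.IsClosedUnderCokernels] [P.IsClosedUnderFiniteProducts]

instance preservesHomology_ι : P.ι.PreservesHomology where
  preservesKernels _ _ f := P.preservesKernels_ι f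
  preservesCokernels _ _ f := P.preservesCokernels_ι f

lemma shortExact_map_ι_iff (S : ShortComplex P.FullSubcategory) :
    (S.map P.ι).ShortExact ↔ S.ShortExact := by
  have := P.preservesMonomorphisms_ι_of_isNormalEpiCategory
  have := P.preservesEpimorphisms_ι_of_isNormalMonoCategory
  constructor
  · intro h
    have h1 : S.Exact := (S.exact_map_iff_of_faithful P.ι).1 h.exact
    have h2 : Mono S.f := P.ι.mono_of_mono_map h.mono_f
    have h3 : Epi S.g := P.ι.epi_of_epi_map h.epi_g
    exact ⟨h1⟩
  · intro h
    have := h.mono_f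
    have := h.epi_g
    exact h.map P.ι

end SubcategoryExactness

section Ext

variable {k : Type u} [Field k] {A : ContinuousQuiverA}

/-- The inclusion into all representations is exact, so the extension problem can be solved there;
by fullness the solution is a morphism of the subcategory. -/
theorem extLineOrZero (P : ObjectProperty (QRep k A)) [P.ContainsZero]
    [P.IsClosedUnderKernels] [P.IsClosedUnderCokernels] [P.IsClosedUnderFiniteProducts]
    (hP : ∀ V, P V → isPwf k A V) (h : HasKernelsCokernelsImages P.FullSubcategory) :
    letI := h.abelian
    ExtLineOrZero P.FullSubcategory k := by
  let := h.abelian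
  let := HasExt.standard P.FullSubcategory
  intro X Y hX hY
  obtain ⟨I, _, -, ⟨φ⟩⟩ := (indecomposablesAreIntervals P hP X).1 hX
  obtain ⟨J, _, -, ⟨ψ⟩⟩ := (indecomposablesAreIntervals P hP Y).1 hY
  refine isLineOrZero_ext fun {S} hS hX f g => ?_
  subst hX
  obtain ⟨r, s, hrs, t, ht⟩ := exists_smul_add_smul_eq_comp ((shortExact_map_ι_iff P S).2 hS) φ
    (f.hom ≫ ψ.hom) (g.hom ≫ ψ.hom)
  let t' : S.X₂.obj ⟶ intervalRep k A J := t
  have ht' : r • f.hom ≫ ψ.hom + s • g.hom ≫ ψ.hom = S.f.hom ≫ t' := ht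
  refine ⟨r, s, hrs, P.homMk (t' ≫ ψ.inv), P.hom_ext ?_⟩
  change r • f.hom + s • g.hom = S.f.hom ≫ t' ≫ ψ.inv
  rw [← Category.assoc, ← ht']
  simp

end Ext

/-! ### Down-closed and directed sets -/

namespace ContinuousQuiverA

variable {A : ContinuousQuiverA}

/-- Elements of `S` are sinks or sources. -/
lemma sink_or_source {t : ℝ} (ht : t ∈ A.S) :
    (∀ w : ℝ, A.le w t → w = t) ∨ (∀ w : ℝ, A.le t w → w = t) := by
  obtain ⟨n, hn, hn', h1, h2⟩ := A.exists_segment t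
  -- An element of S is not interior to its segment, so t is the left end; the parity of its index n
  -- decides between sink and source.
  have h1' : (A.s ⟨_, hn⟩ : EReal) = t := by
    by_contra hne
    exact A.notMem_S_of_mem_segment (lt_of_le_of_ne h1 hne) h2 ht
  have key : ∀ {m : ℤ} {hm : ExtInt.ofInt m ∈ A.index} {hm' : ExtInt.ofInt (m + 1) ∈ A.index},
      (t : EReal) ∈ Set.Icc (A.s ⟨_, hm⟩ : EReal) (A.s ⟨_, hm'⟩) →
        (m = n ∧ (A.s ⟨_, hm⟩ : EReal) = t) ∨ (m + 1 = n ∧ (A.s ⟨_, hm'⟩ : EReal) = t) := by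
    intro m hm hm' h
    rw [← h1'] at h
    have h3 := (A.s_le_s hm hn).1 h.1
    have h4 := (A.s_le_s hn hm').1 h.2
    obtain rfl | rfl : m = n ∨ m + 1 = n := by omega
    · exact Or.inl ⟨rfl, h1'⟩
    · exact Or.inr ⟨rfl, h1'⟩
  rcases Int.even_or_odd n with e | e
  · left
    rintro w (h | ⟨m, hm, hm', hw, ht', h⟩)
    · exact EReal.coe_eq_coe_iff.1 h
    refine EReal.coe_eq_coe_iff.1 ?_
    rcases key ht' with ⟨rfl, h3⟩ | ⟨rfl, h3⟩
    · rcases h with ⟨-, h⟩ | ⟨h, -⟩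
      · exact _root_.le_antisymm h (h3 ▸ hw.1)
      · exact absurd e (Int.not_even_iff_odd.2 h)
    · rcases h with ⟨h, -⟩ | ⟨-, h⟩
      · exact absurd e (Int.not_even_iff_odd.2 h.add_one)
      · exact _root_.le_antisymm (h3 ▸ hw.2) h
  · right
    rintro w (h | ⟨m, hm, hm', ht', hw, h⟩)
    · exact (EReal.coe_eq_coe_iff.1 h).symm
    refine EReal.coe_eq_coe_iff.1 ?_
    rcases key ht' with ⟨rfl, h3⟩ | ⟨rfl, h3⟩
    · rcases h with ⟨h, -⟩ | ⟨-, h⟩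
      · exact absurd h (Int.not_even_iff_odd.2 e)
      · exact _root_.le_antisymm h (h3 ▸ hw.1)
    · rcases h with ⟨-, h⟩ | ⟨h, -⟩
      · exact _root_.le_antisymm (h3 ▸ hw.2) h
      · exact absurd e (Int.not_odd_iff_even.2 h.add_one)

variable (A)

/-- Sets of points that are closed under going down. -/
def IsLower (J : Set ℝ) : Prop := ∀ x ∈ J, ∀ y : ℝ, A.le y x → y ∈ J

/-- Sets of points in which any two points have an upper bound. -/
def IsUpDirected (J : Set ℝ) : Prop := ∀ x ∈ J, ∀ y ∈ J, ∃ z ∈ J, A.le x z ∧ A.le y z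

variable {A}

lemma isLower_lowerSet (C : Set ℝ) : A.IsLower (A.lowerSet C) := fun _ ⟨c, hc, hxc⟩ _ hy =>
  ⟨c, hc, A.le_trans hy hxc⟩

lemma subset_lowerSet (C : Set ℝ) : C ⊆ A.lowerSet C := fun c hc => ⟨c, hc, A.le_refl _⟩

lemma IsUpDirected.lowerSet {C : Set ℝ} (hC : A.IsUpDirected C) :
    A.IsUpDirected (A.lowerSet C) := by
  rintro x ⟨c, hc, hxc⟩ y ⟨d, hd, hyd⟩
  obtain ⟨z, hz, h1, h2⟩ := hC c hc d hd
  exact ⟨z, subset_lowerSet C hz, A.le_trans hxc h1, A.le_trans hyd h2⟩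

lemma IsUpDirected.ordConnected {J : Set ℝ} (hJ : A.IsUpDirected J) (hl : A.IsLower J) :
    J.OrdConnected := by
  refine ⟨fun x hx y hy w hw => ?_⟩
  obtain ⟨z, hz, h1, h2⟩ := hJ x hx y hy
  rcases le_total w z with h | h
  · exact hl z hz w (A.le_of_mem_uIcc_real h1 (Set.mem_uIcc.2 (Or.inl ⟨hw.1, h⟩))).2
  · exact hl z hz w (A.le_of_mem_uIcc_real h2 (Set.mem_uIcc.2 (Or.inr ⟨h, hw.2⟩))).2

lemma IsUpDirected.exists_upper_bound {J : Set ℝ} (hJ : A.IsUpDirected J) (hne : J.Nonempty)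
    (Y : Finset ℝ) (hY : ∀ y ∈ Y, y ∈ J) : ∃ z ∈ J, ∀ y ∈ Y, A.le y z := by
  classical
  induction Y using Finset.induction_on with
  | empty =>
    obtain ⟨z, hz⟩ := hne
    exact ⟨z, hz, by simp⟩
  | insert a Y _ ih =>
    obtain ⟨z, hz, h⟩ := ih fun y hy => hY y (Finset.mem_insert_of_mem hy)
    obtain ⟨t, ht, h1, h2⟩ := hJ a (hY a (Finset.mem_insert_self _ _)) z hz
    refine ⟨t, ht, fun y hy => ?_⟩
    rcases Finset.mem_insert.1 hy with rfl | hy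
    · exact h1
    · exact A.le_trans (h y hy) h2

/-- The points below an interval and on one side of it. -/
lemma isLower_side {I : Set ℝ} (hI : I.OrdConnected) {r : ℝ → ℝ → Prop}
    (hr : r = (· < ·) ∨ r = (· > ·)) :
    A.IsLower {z | z ∈ A.lowerSet I ∧ ∀ i ∈ I, r z i} ∧
      A.IsUpDirected {z | z ∈ A.lowerSet I ∧ ∀ i ∈ I, r z i} := by
  constructor
  · rintro z ⟨⟨c, hc, hzc⟩, hz⟩ w hw
    refine ⟨⟨c, hc, A.le_trans hw hzc⟩, fun i hi => ?_⟩
    -- A point i of I between w and z would satisfy i ⪯ z ⪯ c with c in I, so z would lie in I by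
    -- convexity, although z is strictly to one side of I.
    have key : i ∉ Set.uIcc w z := fun h => by
      have h1 := (A.le_of_mem_uIcc_real hw h).2
      have h2 := hz z (hI.uIcc_subset hi hc (A.mem_uIcc_of_le_real h1 hzc))
      rcases hr with rfl | rfl <;> exact lt_irrefl _ h2
    have h3 := hz i hi
    rw [Set.mem_uIcc] at key
    rcases hr with rfl | rfl
    · by_contra h
      exact key (Or.inr ⟨le_of_lt h3, not_lt.1 h⟩)
    · by_contra h
      exact key (Or.inl ⟨not_lt.1 h, le_of_lt h3⟩)
  · have key : ∀ z ∈ {z | z ∈ A.lowerSet I ∧ ∀ i ∈ I, r z i},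
        ∀ z' ∈ {z | z ∈ A.lowerSet I ∧ ∀ i ∈ I, r z i}, (r z z' ∨ z = z') → A.le z z' := by
      rintro z ⟨⟨c, hc, hzc⟩, hz⟩ z' ⟨-, hz'⟩ h
      have h1 := hz' c hc
      refine (A.le_of_mem_uIcc_real hzc ?_).1
      rw [Set.mem_uIcc]
      rcases hr with rfl | rfl
      · exact Or.inl ⟨le_of_lt_or_eq h, le_of_lt h1⟩
      · exact Or.inr ⟨le_of_lt h1, le_of_lt_or_eq (h.imp id Eq.symm)⟩
    intro z hz z' hz'
    have : (r z z' ∨ z = z') ∨ (r z' z ∨ z' = z) := by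
      rcases hr with rfl | rfl <;> rcases lt_trichotomy z z' with h | h | h <;> simp [h]
    rcases this with h | h
    · exact ⟨z', hz', key z hz z' hz' h, A.le_refl _⟩
    · exact ⟨z, hz, A.le_refl _, key z' hz' z hz h⟩

end ContinuousQuiverA

/-! ### Short exact sequences of intervals, and the lifting property -/

section IntervalSequences

variable {k : Type u} [Field k] {A : ContinuousQuiverA}

lemma hasCanonicalHom_sub {I D : Set ℝ} (hDI : D ⊆ I)
    (hD : ∀ x ∈ D, ∀ y ∈ I, A.le y x → y ∈ D) : HasCanonicalHom A D I :=
  fun x _ a hx hy => ⟨fun _ => hD x.val hx _ hy a.down, fun _ => hDI hx⟩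

lemma hasCanonicalHom_quot {I D E : Set ℝ} (hE : E = I \ D)
    (hD : ∀ x ∈ D, ∀ y ∈ I, A.le y x → y ∈ D) : HasCanonicalHom A I E := by
  subst hE
  exact fun x _ a hx hy =>
    ⟨fun _ => hy.1, fun _ => ⟨hx, fun h => hy.2 (hD x.val h _ hy.1 a.down)⟩⟩

lemma mono_canonicalHom {I D : Set ℝ} [I.OrdConnected] [D.OrdConnected]
    (h : HasCanonicalHom A D I) (hDI : D ⊆ I) :
    Mono (canonicalHom h : intervalRep k A D ⟶ intervalRep k A I) :=
  (qrep_mono_iff _).2 fun x m m' h' => coord_injective x (by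
    by_cases hx : x.val ∈ D
    · have := congrArg (coord I x) h'
      rwa [coord_canonicalHom _ (hDI hx), coord_canonicalHom _ (hDI hx)] at this
    · rw [coord_of_notMem hx, coord_of_notMem hx])

lemma epi_canonicalHom {I E : Set ℝ} [I.OrdConnected] [E.OrdConnected]
    (h : HasCanonicalHom A I E) (hEI : E ⊆ I) :
    Epi (canonicalHom h : intervalRep k A I ⟶ intervalRep k A E) :=
  (qrep_epi_iff _).2 fun x m => by
    by_cases hx : x.val ∈ E
    · exact ⟨coord _ x m • stdVec k I x, by
        rw [map_smul, canonicalHom_stdVec _ (hEI hx), coord_smul_stdVec]⟩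
    · exact ⟨0, coord_injective x (by rw [coord_of_notMem hx, coord_of_notMem hx])⟩

/-- The short exact sequence given by a lower subset of an interval. -/
lemma shortExact_intervalRep {I D E : Set ℝ} [I.OrdConnected] [D.OrdConnected]
    [E.OrdConnected] (hDI : D ⊆ I) (hE : E = I \ D) (h1 : HasCanonicalHom A D I)
    (h2 : HasCanonicalHom A I E) :
    ∃ w : (canonicalHom h1 : intervalRep k A D ⟶ _) ≫ canonicalHom h2 = 0,
      (ShortComplex.mk (canonicalHom h1 : intervalRep k A D ⟶ _) (canonicalHom h2)
        w).ShortExact := by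
  subst hE
  have hfg : (canonicalHom h1 : intervalRep k A D ⟶ _) ≫ canonicalHom h2 = 0 := by
    refine intervalRep_hom_ext fun x hx => ?_
    rw [qrep_comp_app, canonicalHom_stdVec _ hx, canonicalHom_stdVec _ (hDI hx),
      stdVec_of_notMem fun h => h.2 hx]
    rfl
  have := mono_canonicalHom (k := k) h1 hDI
  have := epi_canonicalHom (k := k) h2 Set.sdiff_subset
  have h3 : (ShortComplex.mk _ _ hfg).Exact := (qrep_exact_iff _).2 fun x m hm => by
    refine ⟨coord I x m • stdVec k D x, coord_injective x ?_⟩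
    change coord I x (((canonicalHom h1).app x).hom (coord I x m • stdVec k D x)) = coord I x m
    by_cases hxI : x.val ∈ I
    · rw [coord_canonicalHom _ hxI, map_smul]
      by_cases hxD : x.val ∈ D
      · rw [coord_stdVec hxD, smul_eq_mul, mul_one]
      · have := congrArg (coord (I \ D) x) hm
        erw [coord_canonicalHom h2 (Set.mem_sdiff_of_mem hxI hxD), map_zero] at this
        rw [this, zero_smul]
    · rw [coord_of_notMem hxI, coord_of_notMem hxI]
  exact ⟨hfg, ⟨h3⟩⟩

/-- Interval representations of lower directed sets have the lifting property. -/
theorem exists_lift_intervalRep {J : Set ℝ} [J.OrdConnected] (hl : A.IsLower J)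
    (hd : A.IsUpDirected J) {M N : QRep k A} (hM : isPwf k A M) (e : M ⟶ N) [Epi e]
    (f : intervalRep k A J ⟶ N) : ∃ s : intervalRep k A J ⟶ M, s ≫ e = f := by
  classical
  have he := (qrep_epi_iff e).1 inferInstance
  choose t ht using fun x => he x ((f.app x).hom (stdVec k J x))
  -- Being a lift is an affine condition at each vertex: the difference from one pointwise lift must
  -- be killed by e. So lifts over finite sets of vertices suffice.
  obtain ⟨F, hF⟩ := exists_hom_of_finite (isPwf_intervalRep J) hM
    (fun x => (coord J x).smulRight (t x))
    (fun x => LinearMap.ker ((e.app x).hom.compRight k (M := (intervalRep k A J).obj x))) (by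
      intro Y
      rcases J.eq_empty_or_nonempty with hJ | hJ
      · have h0 : ∀ (x : A.Vertex) m, coord J x m = (0 : k) := fun x m =>
          coord_of_notMem (by simp [hJ]) m
        have h0' : ∀ (x : A.Vertex) (m : (intervalRep k A J).obj x), m = 0 := fun x m =>
          coord_injective x (by rw [h0, h0])
        refine ⟨fun _ => 0, fun x y a _ _ m => by simp, fun x _ => ?_⟩
        rw [LinearMap.mem_ker]
        exact LinearMap.ext fun m => by rw [h0' x m, map_zero, map_zero]
      -- Directedness gives one point z above all the points of Y in J. A lift chosen at z and
      -- pushed down along the arrows is natural over Y.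
      obtain ⟨z, hz, hzY⟩ := hd.exists_upper_bound hJ
        ((Y.image fun y => y.val).filter (· ∈ J)) (fun y hy => (Finset.mem_filter.1 hy).2)
      let Z : A.Vertex := z
      have hle : ∀ y ∈ Y, y.val ∈ J → Nonempty (Z ⟶ y) := fun y hy hyJ =>
        ⟨⟨hzY _ (Finset.mem_filter.2 ⟨Finset.mem_image_of_mem _ hy, hyJ⟩)⟩⟩
      let s : ∀ x : A.Vertex, M.obj x := fun x =>
        if a : Nonempty (Z ⟶ x) then (M.map a.some).hom (t Z) else 0
      have hs : ∀ {x} (a : Z ⟶ x), s x = (M.map a).hom (t Z) := fun {x} a => by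
        simp only [s, dif_pos (⟨a⟩ : Nonempty (Z ⟶ x))]
        rw [hom_eq (Nonempty.some _) a]
      refine ⟨fun x => (coord J x).smulRight (s x), fun x y a hx hy m => ?_, fun x hx => ?_⟩
      · by_cases hxJ : x.val ∈ J
        · obtain ⟨b⟩ := hle x hx hxJ
          rw [LinearMap.smulRight_apply, LinearMap.smulRight_apply, coord_map,
            if_pos (hl _ hxJ _ a.down), hs b, hs (b ≫ a), map_smul, map_comp_apply]
        · have : m = 0 := coord_injective x (by rw [coord_of_notMem hxJ, map_zero])
          rw [this, map_zero, map_zero, map_zero, map_zero]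
      · rw [LinearMap.mem_ker]
        refine LinearMap.ext fun m => ?_
        change (e.app x).hom (coord J x m • s x - coord J x m • t x) = 0
        rw [← smul_sub, map_smul, map_sub, ht]
        by_cases hxJ : x.val ∈ J
        · obtain ⟨b⟩ := hle x hx hxJ
          rw [hs b, nat_apply, ht, ← nat_apply, map_stdVec b hz hxJ, sub_self, smul_zero]
        · rw [coord_of_notMem hxJ, zero_smul])
  refine ⟨F, qrep_hom_ext fun x => LinearMap.ext fun m => ?_⟩
  have := LinearMap.congr_fun (LinearMap.mem_ker.1 (hF x)) m
  change (e.app x).hom ((F.app x).hom m - coord J x m • t x) = 0 at this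
  rw [map_sub, map_smul, ht, sub_eq_zero, ← app_eq_coord_smul] at this
  exact this

end IntervalSequences

/-- Writing the identity as the given sum expresses every extension class on X through classes on
the F i, which vanish in the relevant degrees. -/
lemma hasProjectiveDimensionLT_of_sum {C : Type v} [Category.{w} C] [Abelian C] {ι : Type*}
    [Fintype ι] {X : C} {F : ι → C} (σ : ∀ i, F i ⟶ X) (π : ∀ i, X ⟶ F i)
    (h : ∑ i, π i ≫ σ i = 𝟙 X) (n : ℕ) (hF : ∀ i, HasProjectiveDimensionLT (F i) n) :
    HasProjectiveDimensionLT X n := by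
  let := HasExt.standard C
  rw [hasProjectiveDimensionLT_iff]
  intro i hi Y e
  rw [← e.mk₀_id_comp, ← h, Abelian.Ext.mk₀_sum, Abelian.Ext.sum_comp]
  refine Finset.sum_eq_zero fun j _ => ?_
  have := hF j
  rw [← Abelian.Ext.mk₀_comp_mk₀, Abelian.Ext.comp_assoc_of_second_deg_zero,
    ((Abelian.Ext.mk₀ (σ j)).comp e (zero_add i)).eq_zero_of_hasProjectiveDimensionLT n hi,
    Abelian.Ext.comp_zero]

namespace ContinuousQuiverA

variable {A : ContinuousQuiverA}

lemma isUpDirected_of_disjoint {I : Set ℝ} [hI : I.OrdConnected] (h : ∀ x ∈ I, x ∉ A.S) :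
    A.IsUpDirected I := fun x hx y hy => by
  rcases A.comparable_of_uIcc (fun z hz hz' => h z (hI.uIcc_subset hx hy hz') hz) with h | h
  · exact ⟨y, hy, h, A.le_refl _⟩
  · exact ⟨x, hx, A.le_refl _, h⟩

lemma isUpDirected_singleton (a : ℝ) : A.IsUpDirected {a} := by
  rintro _ rfl _ rfl
  exact ⟨_, rfl, A.le_refl _, A.le_refl _⟩

lemma finite_inter_lowerSet {I : Set ℝ} [I.OrdConnected] (hS : (A.S ∩ I).Finite) :
    (A.S ∩ A.lowerSet I).Finite := by
  obtain ⟨ι, _, C, hC, hcov, hlist⟩ := exists_listed_cover hS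
  refine (Set.finite_iUnion fun i => (hlist i).finite_inter).subset ?_
  rintro x ⟨hx, c, hc, hxc⟩
  obtain ⟨i, hi⟩ := hcov c hc
  exact Set.mem_iUnion.2 ⟨i, hx, c, hi, hxc⟩

variable (A) in
lemma exists_notMem_S : ∃ a : ℝ, a ∉ A.S := by
  obtain ⟨a, -, ha⟩ := ((Set.Icc_infinite (zero_lt_one' ℝ)).sdiff
    (A.finite_inter_Icc 0 1)).nonempty.imp fun a ha => (⟨ha.1, fun h => ha.2 ⟨h, ha.1⟩⟩ :
      a ∈ Set.Icc (0 : ℝ) 1 ∧ a ∉ A.S)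
  exact ⟨a, ha⟩

lemma exists_lt_of_notMem {a : ℝ} (ha : a ∉ A.S) : ∃ b : ℝ, b ≠ a ∧ A.le b a := by
  obtain ⟨n, hn, hn', h1, h2⟩ := A.exists_open_segment ha
  rcases Int.even_or_odd n with e | e
  · obtain ⟨b, hb, hba⟩ := EReal.lt_iff_exists_real_btwn.1 h1
    exact ⟨b, fun h => hba.ne (congrArg _ h), (A.le_of_mem_segment hb.le hba.le h2.le).1 e⟩
  · obtain ⟨b, hb, hba⟩ := EReal.lt_iff_exists_real_btwn.1 h2
    exact ⟨b, fun h => hb.ne' (congrArg _ h), (A.le_of_mem_segment h1.le hb.le hba.le).2 e⟩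

end ContinuousQuiverA

/-! ### Global dimension of the category of finitely generated representations -/

section GlobalDimension

variable {k : Type u} [Field k] {A : ContinuousQuiverA}

/-- The representation is finitely generated, and its projective dimension in the category of
finitely generated representations is less than `n`. -/
def ProjDimLT (h : HasKernelsCokernelsImages (RepFG k A)) (n : ℕ) (V : QRep k A) : Prop :=
  ∃ hV : isFG k A V, letI := h.abelian; HasProjectiveDimensionLT (⟨V, hV⟩ : RepFG k A) n

variable {h : HasKernelsCokernelsImages (RepFG k A)}

lemma ProjDimLT.of_iso {n : ℕ} {V W : QRep k A} (e : V ≅ W) (hV : ProjDimLT h n V) :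
    ProjDimLT h n W := by
  let := h.abelian
  obtain ⟨hV, _⟩ := hV
  have hW := (isFG k A).prop_of_iso e hV
  exact ⟨hW, hasProjectiveDimensionLT_of_iso
    (⟨(isFG k A).homMk e.hom, (isFG k A).homMk e.inv, (isFG k A).hom_ext e.hom_inv_id,
      (isFG k A).hom_ext e.inv_hom_id⟩ : (⟨V, hV⟩ : RepFG k A) ≅ ⟨W, hW⟩) n⟩

lemma shortExact_repFG {I D E : Set ℝ} [I.OrdConnected] [D.OrdConnected]
    [E.OrdConnected] (hDI : D ⊆ I) (hE : E = I \ D) (hD : ∀ x ∈ D, ∀ y ∈ I, A.le y x → y ∈ D)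
    (h : HasKernelsCokernelsImages (RepFG k A)) (h1 : isFG k A (intervalRep k A D))
    (h2 : isFG k A (intervalRep k A I)) (h3 : isFG k A (intervalRep k A E)) :
    ∃ (f : (⟨_, h1⟩ : RepFG k A) ⟶ ⟨_, h2⟩) (g : (⟨_, h2⟩ : RepFG k A) ⟶ ⟨_, h3⟩)
      (w : f ≫ g = 0), (ShortComplex.mk f g w).ShortExact := by
  let := h.abelian
  obtain ⟨w, hw⟩ := shortExact_intervalRep (k := k) hDI hE (hasCanonicalHom_sub hDI hD)
    (hasCanonicalHom_quot hE hD)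
  exact ⟨(isFG k A).homMk _, (isFG k A).homMk _, (isFG k A).hom_ext w,
    (shortExact_map_ι_iff (isFG k A) _).1 hw⟩

lemma ProjDimLT.extension {n : ℕ} {I D E : Set ℝ} [I.OrdConnected] [D.OrdConnected]
    [E.OrdConnected] (hS : (A.S ∩ I).Finite) (hDI : D ⊆ I)
    (hD : ∀ x ∈ D, ∀ y ∈ I, A.le y x → y ∈ D) (hE : E = I \ D)
    (h1 : ProjDimLT h n (intervalRep k A D)) (h3 : ProjDimLT h n (intervalRep k A E)) :
    ProjDimLT h n (intervalRep k A I) := by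
  let := h.abelian
  obtain ⟨h1, h1'⟩ := h1
  obtain ⟨h3, h3'⟩ := h3
  obtain ⟨f, g, w, hT⟩ := shortExact_repFG hDI hE hD h h1 (isFG_intervalRep hS) h3
  exact ⟨_, hT.hasProjectiveDimensionLT_X₂ n h1' h3'⟩

lemma ProjDimLT.quotient {n : ℕ} {I D E : Set ℝ} [I.OrdConnected] [D.OrdConnected]
    [E.OrdConnected] (hS : (A.S ∩ I).Finite) (hDI : D ⊆ I)
    (hD : ∀ x ∈ D, ∀ y ∈ I, A.le y x → y ∈ D) (hE : E = I \ D)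
    (h1 : ProjDimLT h n (intervalRep k A D)) (h2 : ProjDimLT h (n + 1) (intervalRep k A I)) :
    ProjDimLT h (n + 1) (intervalRep k A E) := by
  let := h.abelian
  have h3 : isFG k A (intervalRep k A E) :=
    isFG_intervalRep (hS.subset (Set.inter_subset_inter_right _ (hE ▸ Set.sdiff_subset)))
  obtain ⟨h1, h1'⟩ := h1
  obtain ⟨h2, h2'⟩ := h2
  obtain ⟨f, g, w, hT⟩ := shortExact_repFG hDI hE hD h h1 h2 h3
  exact ⟨h3, hT.hasProjectiveDimensionLT_X₃ n h1' h2'⟩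

lemma ProjDimLT.succ {n : ℕ} {V : QRep k A} (hV : ProjDimLT h n V) : ProjDimLT h (n + 1) V := by
  let := h.abelian
  obtain ⟨hV, hV'⟩ := hV
  exact ⟨hV, hasProjectiveDimensionLT_of_ge _ n (n + 1) n.le_succ⟩

lemma epi_hom_of_epi {h : HasKernelsCokernelsImages (RepFG k A)} {V W : RepFG k A} (e : V ⟶ W)
    [Epi e] : Epi e.hom := by
  let := h.abelian
  have := (isFG k A).preservesEpimorphisms_ι_of_isNormalMonoCategory
  exact inferInstanceAs (Epi ((isFG k A).ι.map e))

/-- Epimorphisms in `rep` remain epimorphisms among all representations, so the lifting property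
there gives projectivity. -/
lemma projDimLT_one {J : Set ℝ} [J.OrdConnected] (hS : (A.S ∩ J).Finite) (hl : A.IsLower J)
    (hd : A.IsUpDirected J) : ProjDimLT h 1 (intervalRep k A J) := by
  let := h.abelian
  refine ⟨isFG_intervalRep hS, projective_iff_hasProjectiveDimensionLT_one.1
    ⟨fun {M N} f e _ => ?_⟩⟩
  have := epi_hom_of_epi (h := h) e
  obtain ⟨s, hs⟩ := exists_lift_intervalRep hl hd M.property.1 e.hom f.hom
  exact ⟨(isFG k A).homMk s, (isFG k A).hom_ext hs⟩

/-- The down-closure of I is directed, hence gives a projective. Its points outside I form a part L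
to the left and a part R to the right, both down-closed and directed. Dividing by these two
projectives in turn leaves `M_I`. -/
lemma projDimLT_two_of_isUpDirected {I : Set ℝ} [hI : I.OrdConnected] (hS : (A.S ∩ I).Finite)
    (hd : A.IsUpDirected I) : ProjDimLT h 2 (intervalRep k A I) := by
  have hJS := finite_inter_lowerSet hS
  have hJ : (A.lowerSet I).OrdConnected := hd.lowerSet.ordConnected (isLower_lowerSet I)
  obtain ⟨hl1, hl2⟩ := isLower_side (A := A) hI (r := (· < ·)) (Or.inl rfl)
  obtain ⟨hr1, hr2⟩ := isLower_side (A := A) hI (r := (· > ·)) (Or.inr rfl)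
  set L : Set ℝ := {z | z ∈ A.lowerSet I ∧ ∀ i ∈ I, z < i}
  set R : Set ℝ := {z | z ∈ A.lowerSet I ∧ ∀ i ∈ I, z > i}
  have hL := hl2.ordConnected hl1
  have hR := hr2.ordConnected hr1
  have hM : (A.lowerSet I \ L).OrdConnected := ⟨fun x hx y hy z hz =>
    ⟨hJ.out hx.1 hy.1 hz, fun hzL => hx.2 ⟨hx.1, fun i hi => hz.1.trans_lt (hzL.2 i hi)⟩⟩⟩
  have hLp : ProjDimLT h 1 (intervalRep k A L) :=
    projDimLT_one (hJS.subset (Set.inter_subset_inter_right _ fun x hx => hx.1)) hl1 hl2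
  have hRp : ProjDimLT h 1 (intervalRep k A R) :=
    projDimLT_one (hJS.subset (Set.inter_subset_inter_right _ fun x hx => hx.1)) hr1 hr2
  have hJp : ProjDimLT h 1 (intervalRep k A (A.lowerSet I)) :=
    projDimLT_one hJS (isLower_lowerSet I) hd.lowerSet
  have hMp : ProjDimLT h 2 (intervalRep k A (A.lowerSet I \ L)) :=
    ProjDimLT.quotient hJS (fun x hx => hx.1) (fun x hx y _ hyx => hl1 x hx y hyx) rfl hLp hJp.succ
  refine ProjDimLT.quotient (D := R)
    (hJS.subset (Set.inter_subset_inter_right _ Set.sdiff_subset)) ?_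
    (fun x hx y _ hyx => hr1 x hx y hyx) ?_ hRp hMp
  · rintro x ⟨⟨c, hc, hxc⟩, hx⟩
    exact ⟨⟨c, hc, hxc⟩, fun h => lt_asymm (h.2 c hc) (hx c hc)⟩
  · ext x
    constructor
    · intro hx
      have hx' := A.subset_lowerSet I hx
      exact ⟨⟨hx', fun h => lt_irrefl _ (h.2 x hx)⟩, fun h => lt_irrefl _ (h.2 x hx)⟩
    · rintro ⟨⟨hx, h1⟩, h2⟩
      have h1' : ∃ i ∈ I, i ≤ x := by
        by_contra! hcon
        exact h1 ⟨hx, hcon⟩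
      have h2' : ∃ i ∈ I, x ≤ i := by
        by_contra! hcon
        exact h2 ⟨hx, hcon⟩
      obtain ⟨i, hi, hix⟩ := h1'
      obtain ⟨j, hj, hxj⟩ := h2'
      exact hI.out hi hj ⟨hix, hxj⟩

/-- Interval representations in `rep` have projective dimension at most one. -/
theorem projDimLT_two_intervalRep {I : Set ℝ} [hI : I.OrdConnected] (hS : (A.S ∩ I).Finite) :
    ProjDimLT h 2 (intervalRep k A I) := by
  induction hN : (A.S ∩ I).ncard using Nat.strong_induction_on generalizing I with
  | _ N ih =>
  by_cases h0 : ∀ x ∈ I, x ∉ A.S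
  · exact projDimLT_two_of_isUpDirected hS (isUpDirected_of_disjoint h0)
  push Not at h0
  obtain ⟨t, htI, htS⟩ := h0
  have hlt : (I ∩ Set.Iio t).OrdConnected := hI.inter Set.ordConnected_Iio
  have hgt : (I ∩ Set.Ioi t).OrdConnected := hI.inter Set.ordConnected_Ioi
  -- Subintervals that miss t contain fewer elements of S.
  have key : ∀ (D : Set ℝ) [D.OrdConnected], D ⊆ I → t ∉ D → ProjDimLT h 2 (intervalRep k A D) := by
    intro D _ hD ht
    refine ih _ ?_ (hS.subset (Set.inter_subset_inter_right _ hD)) rfl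
    rw [← hN]
    exact Set.ncard_lt_ncard ⟨Set.inter_subset_inter_right _ hD, fun hc => ht (hc ⟨htS, htI⟩).2⟩ hS
  have h1 : ProjDimLT h 2 (intervalRep k A (I ∩ Set.Iio t)) :=
    key _ Set.inter_subset_left fun h => lt_irrefl t h.2
  have h2 : ProjDimLT h 2 (intervalRep k A (I ∩ Set.Ioi t)) :=
    key _ Set.inter_subset_left fun h => lt_irrefl t h.2
  have h3 : ProjDimLT h 2 (intervalRep k A {t}) :=
    projDimLT_two_of_isUpDirected ((Set.finite_singleton t).subset Set.inter_subset_right)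
      (isUpDirected_singleton t)
  -- The interval is an iterated extension of its part left of t, the point t, and its part right of
  -- t. A sink enters as a subobject and a source as a quotient.
  rcases sink_or_source htS with ht | ht
  · have hle : (I ∩ Set.Iic t).OrdConnected := hI.inter Set.ordConnected_Iic
    have h4 : ProjDimLT h 2 (intervalRep k A (I ∩ Set.Iic t)) := by
      refine ProjDimLT.extension (D := {t}) (E := I ∩ Set.Iio t)
        (hS.subset (Set.inter_subset_inter_right _ Set.inter_subset_left)) ?_ ?_ ?_ h3 h1
      · rintro x rfl
        exact ⟨htI, _root_.le_refl x⟩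
      · rintro x rfl y - hy
        exact ht y hy
      · ext x
        simp [lt_iff_le_and_ne, and_assoc]
    refine ProjDimLT.extension hS Set.inter_subset_left ?_ ?_ h4 h2
    · rintro x ⟨hx, hxt⟩ y hy hyx
      refine ⟨hy, ?_⟩
      by_contra hyt
      refine hyt (ht y ?_).le
      exact (A.le_of_mem_uIcc_real hyx (Set.mem_uIcc.2 (Or.inr ⟨hxt, (not_le.1 hyt).le⟩))).1
    · ext x
      simp +contextual
  · have hge : (I ∩ Set.Ici t).OrdConnected := hI.inter Set.ordConnected_Ici
    have h4 : ProjDimLT h 2 (intervalRep k A (I ∩ Set.Ici t)) := by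
      refine ProjDimLT.extension (D := I ∩ Set.Ioi t) (E := {t})
        (hS.subset (Set.inter_subset_inter_right _ Set.inter_subset_left)) ?_ ?_ ?_ h2 h3
      · exact Set.inter_subset_inter_right _ Set.Ioi_subset_Ici_self
      · rintro x ⟨hx, hxt⟩ y ⟨hy, hyt⟩ hyx
        refine ⟨hy, show t < y from lt_of_le_of_ne hyt ?_⟩
        rintro rfl
        exact (ne_of_gt hxt) (ht x hyx)
      · ext x
        simp only [Set.mem_singleton_iff, Set.mem_sdiff, Set.mem_inter_iff, Set.mem_Ici,
          Set.mem_Ioi, not_and, not_lt]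
        exact ⟨fun hx => by subst hx; exact ⟨⟨htI, le_rfl⟩, fun _ => le_rfl⟩,
          fun hx => _root_.le_antisymm (hx.2 hx.1.1) hx.1.2⟩
    refine ProjDimLT.extension hS Set.inter_subset_left ?_ ?_ h1 h4
    · rintro x ⟨hx, hxt⟩ y hy hyx
      refine ⟨hy, ?_⟩
      by_contra hyt
      refine (ne_of_lt hxt) (ht x ?_)
      exact (A.le_of_mem_uIcc_real hyx (Set.mem_uIcc.2
        (Or.inr ⟨le_of_lt hxt, (not_lt (α := ℝ)).1 hyt⟩))).2
    · ext x
      simp +contextual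

theorem projDimLT_two {V : QRep k A} (hV : isFG k A V) : ProjDimLT h 2 V := by
  let := h.abelian
  obtain ⟨ι, _, F, σ, π, h1, h2, -, h4⟩ := hV.isConstructible.exists_decomposition
  have hF : ∀ i, ProjDimLT h 2 (F i) := fun i => by
    obtain ⟨I, _, -, ⟨e⟩⟩ := h1 i
    have : Mono (σ i) := SplitMono.mono ⟨π i, h2 i⟩
    have hF : isFG k A (F i) := ObjectProperty.prop_of_mono _ (σ i) hV
    exact (projDimLT_two_intervalRep
      (isFG_intervalRep_iff.1 ((isFG k A).prop_of_iso e hF))).of_iso e.symm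
  choose hF hF' using hF
  refine ⟨hV, hasProjectiveDimensionLT_of_sum (F := fun i => ⟨F i, hF i⟩)
    (fun i => (isFG k A).homMk (σ i)) (fun i => (isFG k A).homMk (π i))
    ((isFG k A).hom_ext ?_) 2 hF'⟩
  refine Eq.trans ?_ h4
  exact map_sum ((isFG k A).ι.mapAddHom (X := ⟨V, hV⟩) (Y := ⟨V, hV⟩)) _ _

/-- Projectivity would split the canonical epimorphism from the down-closure of a. But a morphism
from the simple must vanish: the generator of the down-closure at a survives at some b strictly
below a, and that of the simple does not. -/
lemma not_projDimLT_one_singleton {a : ℝ} (ha : a ∉ A.S) :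
    ¬ ProjDimLT h 1 (intervalRep k A {a}) := by
  let := h.abelian
  rintro ⟨h1, h2⟩
  have := projective_iff_hasProjectiveDimensionLT_one.2 h2
  have hJ : (A.lowerSet {a}).OrdConnected := by rw [A.lowerSet_singleton]; infer_instance
  have hJF : isFG k A (intervalRep k A (A.lowerSet {a})) :=
    isFG_intervalRep (finite_inter_lowerSet ((Set.finite_singleton a).subset
      Set.inter_subset_right))
  let q : intervalRep k A (A.lowerSet {a}) ⟶ intervalRep k A {a} :=
    canonicalHom (hasCanonicalHom_lowerSet subset_rfl)
  let p : (⟨_, hJF⟩ : RepFG k A) ⟶ ⟨_, h1⟩ := (isFG k A).homMk q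
  have hq : Epi q := epi_canonicalHom _ (subset_lowerSet _)
  have hp : Epi p := (isFG k A).ι.epi_of_epi_map hq
  obtain ⟨b, hba, hb⟩ := exists_lt_of_notMem ha
  let s := Projective.factorThru (𝟙 _) p
  have hs : s.hom ≫ q = 𝟙 _ := congrArg (fun f => f.hom) (Projective.factorThru_comp (𝟙 _) p)
  refine intervalRep_id_ne_zero (k := k) (A := A) (Set.singleton_nonempty a) ?_
  let a' : A.Vertex := a
  let b' : A.Vertex := b
  have hs0 : s.hom = 0 := by
    refine intervalRep_hom_eq_zero (p := a') rfl (subset_lowerSet _ rfl) ?_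
    have h3 := nat_apply s.hom (⟨hb⟩ : a' ⟶ b') (stdVec k ({a} : Set ℝ) a')
    rw [map_stdVec_of_notMem (I := {a}) _ hba, map_zero] at h3
    have h4 := congrArg (coord (A.lowerSet {a}) b') h3
    rw [coord_map, if_pos (show b'.val ∈ A.lowerSet {a} from ⟨a, rfl, hb⟩), map_zero] at h4
    exact coord_injective _ (h4.symm.trans (map_zero _).symm)
  rw [← hs, hs0, zero_comp]

theorem globalDimension_repFG (h : HasKernelsCokernelsImages (RepFG k A)) :
    letI := h.abelian
    globalDimension (RepFG k A) = 1 := by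
  let := h.abelian
  refine _root_.le_antisymm (iSup_le fun V => ?_) ?_
  · obtain ⟨_, hV⟩ := projDimLT_two (h := h) V.property
    exact_mod_cast (projectiveDimension_le_iff V 1).2 hV
  · obtain ⟨a, ha⟩ := A.exists_notMem_S
    have hF : isFG k A (intervalRep k A {a}) :=
      isFG_intervalRep ((Set.finite_singleton a).subset Set.inter_subset_right)
    refine le_iSup_of_le (⟨_, hF⟩ : RepFG k A) ?_
    exact_mod_cast (projectiveDimension_ge_iff (⟨_, hF⟩ : RepFG k A) 1).2 fun h2 =>
      not_projDimLT_one_singleton (h := h) ha ⟨hF, h2⟩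

end GlobalDimension

/-! ### Order relations around points off S -/

namespace ContinuousQuiverA

variable {A : ContinuousQuiverA}

lemma le_antisymm_real {x y : ℝ} (h : A.le x y) (h' : A.le y x) : x = y :=
  EReal.coe_eq_coe_iff.1 (A.le_antisymm h h')

lemma total_of_le {q x y : ℝ} (hq : q ∉ A.S) (hx : A.le x q) (hy : A.le y q) :
    A.le x y ∨ A.le y x := by
  obtain ⟨n, hn, hn', h1, h2⟩ := A.exists_open_segment hq
  rw [A.le_iff_of_mem_segment h1 h2] at hx hy
  rcases hx with ⟨e, hx, hx'⟩ | ⟨e, hx, hx'⟩ <;> rcases hy with ⟨e', hy, hy'⟩ | ⟨e', hy, hy'⟩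
  · exact (le_total (x : EReal) y).imp (fun h => (A.le_of_mem_segment hx h (hy'.trans h2.le)).1 e)
      (fun h => (A.le_of_mem_segment hy h (hx'.trans h2.le)).1 e)
  · exact absurd e (Int.not_even_iff_odd.2 e')
  · exact absurd e' (Int.not_even_iff_odd.2 e)
  · exact (le_total (y : EReal) x).imp (fun h => (A.le_of_mem_segment (h1.le.trans hy) h hx').2 e)
      (fun h => (A.le_of_mem_segment (h1.le.trans hx) h hy').2 e)

lemma total_of_ge {p x y : ℝ} (hp : p ∉ A.S) (hx : A.le p x) (hy : A.le p y) :
    A.le x y ∨ A.le y x := by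
  obtain ⟨n, hn, hn', h1, h2⟩ := A.exists_open_segment hp
  rw [A.ge_iff_of_mem_segment h1 h2] at hx hy
  rcases hx with ⟨e, hx, hx'⟩ | ⟨e, hx, hx'⟩ <;> rcases hy with ⟨e', hy, hy'⟩ | ⟨e', hy, hy'⟩
  · exact (le_total (x : EReal) y).imp (fun h => (A.le_of_mem_segment (h1.le.trans hx) h hy').1 e)
      (fun h => (A.le_of_mem_segment (h1.le.trans hy) h hx').1 e)
  · exact absurd e (Int.not_even_iff_odd.2 e')
  · exact absurd e' (Int.not_even_iff_odd.2 e)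
  · exact (le_total (y : EReal) x).imp (fun h => (A.le_of_mem_segment hy h (hx'.trans h2.le)).2 e)
      (fun h => (A.le_of_mem_segment hx h (hy'.trans h2.le)).2 e)

lemma exists_gt_of_notMem {a : ℝ} (ha : a ∉ A.S) : ∃ b : ℝ, b ≠ a ∧ A.le a b := by
  obtain ⟨n, hn, hn', h1, h2⟩ := A.exists_open_segment ha
  rcases Int.even_or_odd n with e | e
  · obtain ⟨b, hb, hba⟩ := EReal.lt_iff_exists_real_btwn.1 h2
    exact ⟨b, fun h => hb.ne' (congrArg _ h), (A.le_of_mem_segment h1.le hb.le hba.le).1 e⟩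
  · obtain ⟨b, hb, hba⟩ := EReal.lt_iff_exists_real_btwn.1 h1
    exact ⟨b, fun h => hba.ne (congrArg _ h), (A.le_of_mem_segment hb.le hba.le h2.le).2 e⟩

/-- Strictly between related points there is a third one. -/
lemma exists_between_of_le {a b : ℝ} (h : A.le a b) (hab : a ≠ b) :
    ∃ c : ℝ, c ≠ a ∧ c ≠ b ∧ A.le a c ∧ A.le c b := by
  have hc : (a + b) / 2 ∈ Set.uIcc a b := by
    rw [Set.mem_uIcc]
    rcases le_total a b with h | h
    · exact Or.inl ⟨by linarith, by linarith⟩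
    · exact Or.inr ⟨by linarith, by linarith⟩
  refine ⟨(a + b) / 2, fun h => hab (by linarith), fun h => hab (by linarith), ?_⟩
  exact A.le_of_mem_uIcc_real h hc

lemma exists_mem_uIcc_inter {p q d z : ℝ} (hpq : p ≠ q) (hd : p ∈ Set.uIcc d q) (hdp : d ≠ p)
    (hz : p ∈ Set.uIcc z q) (hzp : z ≠ p) : ∃ y ≠ p, y ∈ Set.uIcc z p ∧ y ∈ Set.uIcc d p := by
  simp only [Set.mem_uIcc] at *
  rcases hd with hd | hd <;> rcases hz with hz | hz
  · exact ⟨max d z, by rcases max_choice d z with h | h <;> rwa [h],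
      Or.inl ⟨le_max_right _ _, max_le hd.1 hz.1⟩, Or.inl ⟨le_max_left _ _, max_le hd.1 hz.1⟩⟩
  · exact absurd (_root_.le_antisymm hd.2 hz.1) hpq
  · exact absurd (_root_.le_antisymm hz.2 hd.1) hpq
  · exact ⟨min d z, by rcases min_choice d z with h | h <;> rwa [h],
      Or.inr ⟨le_min hd.2 hz.2, min_le_right _ _⟩, Or.inr ⟨le_min hd.2 hz.2, min_le_left _ _⟩⟩

lemma mem_uIcc_cases (z p q : ℝ) :
    p ∈ Set.uIcc z q ∨ q ∈ Set.uIcc z p ∨ z ∈ Set.uIcc p q := by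
  simp only [Set.mem_uIcc]
  rcases le_total z p with h1 | h1 <;> rcases le_total p q with h2 | h2 <;>
    rcases le_total z q with h3 | h3 <;> simp [*]

end ContinuousQuiverA

/-! ### Failure of the descending chain condition -/

section NotArtinian

variable {k : Type u} [Field k] {A : ContinuousQuiverA}

/-- Density of the line supplies points moving strictly down from a towards a point b below it;
their down-closures give an infinite descending sequence of subobjects of the projective at a. -/
theorem not_isArtinianCategory_repFG : ¬ IsArtinianCategory (RepFG k A) := by
  intro hA
  obtain ⟨a, ha⟩ := A.exists_notMem_S
  obtain ⟨b, hba, hb⟩ := exists_lt_of_notMem ha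
  -- The sequence starts at a and approaches b without reaching it, whichever of the two is larger.
  let x : ℕ → ℝ := fun n => b + (a - b) / (n + 1)
  have hx0 : x 0 = a := by simp [x]
  have hxb : ∀ n, x n ≠ b := fun n h => by
    have : (a - b) / ((n : ℝ) + 1) = 0 := by linarith [show b + (a - b) / ((n : ℝ) + 1) = b from h]
    rw [div_eq_zero_iff] at this
    rcases this with h | h
    · exact hba (by linarith)
    · exact absurd h (by positivity)
  have hstep : ∀ n, x (n + 1) ∈ Set.uIcc b (x n) ∧ x (n + 1) ≠ x n := fun n => by
    have h1 : (0 : ℝ) < (n : ℝ) + 1 := by positivity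
    have h2 : x (n + 1) - b = (x n - b) * (((n : ℝ) + 1) / ((n : ℝ) + 2)) := by
      simp only [x]
      push_cast
      field_simp
      ring
    have h3 : ((n : ℝ) + 1) / ((n : ℝ) + 2) < 1 := by rw [div_lt_one (by positivity)]; linarith
    have h4 : 0 < ((n : ℝ) + 1) / ((n : ℝ) + 2) := by positivity
    rw [Set.mem_uIcc]
    rcases lt_or_gt_of_ne (hxb n) with h | h
    · exact ⟨Or.inr ⟨by nlinarith, by nlinarith⟩, by nlinarith⟩
    · exact ⟨Or.inl ⟨by nlinarith, by nlinarith⟩, by nlinarith⟩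
  have hle : ∀ n, A.le b (x n) ∧ A.le (x n) a := fun n => by
    induction n with
    | zero => rw [hx0]; exact ⟨hb, A.le_refl _⟩
    | succ n ih =>
      have := A.le_of_mem_uIcc_real ih.1 (hstep n).1
      exact ⟨this.1, A.le_trans this.2 ih.2⟩
  have hle' : ∀ n, A.le (x (n + 1)) (x n) := fun n =>
    (A.le_of_mem_uIcc_real (hle n).1 (hstep n).1).2
  have hF : ∀ n, isFG k A (intervalRep k A (A.supp (x n))) := fun n =>
    isFG_intervalRep (A.finite_inter_supp _)
  have hFa : isFG k A (intervalRep k A (A.supp a)) := isFG_intervalRep (A.finite_inter_supp _)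
  have hsub : ∀ {c d : ℝ}, A.le c d → A.supp c ⊆ A.supp d := fun h z hz => A.le_trans hz h
  have hcan : ∀ {c d : ℝ}, A.le c d → HasCanonicalHom A (A.supp c) (A.supp d) := fun h =>
    hasCanonicalHom_sub (hsub h) fun z hz y _ hy => A.le_trans hy hz
  let i : ∀ n, (⟨_, hF n⟩ : RepFG k A) ⟶ ⟨_, hFa⟩ := fun n =>
    (isFG k A).homMk (canonicalHom (hcan (hle n).2))
  have hi : ∀ n, Mono (i n) := fun n =>
    (isFG k A).ι.mono_of_mono_map (mono_canonicalHom (hcan (hle n).2) (hsub (hle n).2))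
  have := hA ⟨_, hFa⟩
  refine not_strictAnti_of_isArtinianObject (fun n => Subobject.mk (i n))
    (strictAnti_nat_of_succ_lt fun n => lt_iff_le_not_ge.2 ⟨?_, fun hge => ?_⟩)
  · refine Subobject.mk_le_mk_of_comm ((isFG k A).homMk (canonicalHom (hcan (hle' n))))
      ((isFG k A).hom_ext (intervalRep_hom_ext fun z hz => ?_))
    change ((canonicalHom (hcan (hle n).2)).app z).hom
      (((canonicalHom (hcan (hle' n))).app z).hom _) =
        ((canonicalHom (hcan (hle (n + 1)).2)).app z).hom _
    rw [canonicalHom_stdVec _ hz, canonicalHom_stdVec _ (hsub (hle' n) hz),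
      canonicalHom_stdVec _ hz]
  -- A factorization of the larger subobject through the smaller one would vanish at the vertex x n,
  -- which lies outside the smaller support, whereas the inclusion does not.
  · let s := Subobject.ofMkLEMk _ _ hge
    let z : A.Vertex := x n
    have hs : s.hom ≫ canonicalHom (hcan (hle (n + 1)).2) = canonicalHom (hcan (hle n).2) :=
      congrArg (fun f => f.hom) (Subobject.ofMkLEMk_comp hge)
    have hz : z.val ∈ A.supp (x n) := A.le_refl _
    have h0 : (s.hom.app z).hom (stdVec k (A.supp (x n)) z) = 0 := coord_injective z (by
      rw [coord_of_notMem (fun h => (hstep n).2 (le_antisymm_real (hle' n) h)), map_zero])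
    have h1 : ((canonicalHom (hcan (hle n).2)).app z).hom (stdVec k (A.supp (x n)) z) = 0 := by
      rw [← hs, qrep_comp_app]
      erw [h0]
      rw [map_zero]
    rw [canonicalHom_stdVec _ hz] at h1
    have h2 := congrArg (coord (A.supp a) z) h1
    rw [coord_stdVec (hsub (hle n).2 hz), map_zero] at h2
    exact one_ne_zero h2

end NotArtinian

namespace ContinuousQuiverA

variable {A : ContinuousQuiverA}

lemma mem_uIcc_iff_of_le {p q z : ℝ} (h : A.le p q) :
    z ∈ Set.uIcc p q ↔ A.le p z ∧ A.le z q :=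
  ⟨A.le_of_mem_uIcc_real h, fun hz => A.mem_uIcc_of_le_real hz.1 hz.2⟩

end ContinuousQuiverA

/-! ### Simples off S do not occur at the ends of Auslander-Reiten sequences -/

section SimpleNotInARSequence

variable {k : Type u} [Field k] {A : ContinuousQuiverA}

lemma exists_greatest_of_chain {M : Type*} [AddCommGroup M] [Module k M] [Module.Finite k M]
    {ι : Type*} [Nonempty ι] (R : ι → Submodule k M) (h : ∀ i j, R i ≤ R j ∨ R j ≤ R i) :
    ∃ i, ∀ j, R j ≤ R i := by
  obtain ⟨_, ⟨i, rfl⟩, hi⟩ := (wellFounded_gt (α := Submodule k M)).has_min (Set.range R)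
    (Set.range_nonempty R)
  refine ⟨i, fun j => (h j i).elim id fun h' => ?_⟩
  by_contra hne
  exact hi _ ⟨j, rfl⟩ (lt_of_le_not_ge h' hne)

lemma exists_least_of_chain {M : Type*} [AddCommGroup M] [Module k M] [Module.Finite k M]
    {ι : Type*} [Nonempty ι] (R : ι → Submodule k M) (h : ∀ i j, R i ≤ R j ∨ R j ≤ R i) :
    ∃ i, ∀ j, R i ≤ R j := by
  obtain ⟨_, ⟨i, rfl⟩, hi⟩ := (wellFounded_lt (α := Submodule k M)).has_min (Set.range R)
    (Set.range_nonempty R)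
  refine ⟨i, fun j => (h i j).elim id fun h' => ?_⟩
  by_contra hne
  exact hi _ ⟨j, rfl⟩ (lt_of_le_not_ge h' hne)

lemma hasCanonicalHom_singleton_uIcc {a c : ℝ} (h : A.le a c) :
    HasCanonicalHom A {a} (Set.uIcc a c) :=
  hasCanonicalHom_sub (Set.singleton_subset_iff.2 Set.left_mem_uIcc) (by
    rintro x rfl y hy hyx
    exact le_antisymm_real hyx ((mem_uIcc_iff_of_le h).1 hy).1)

lemma hasCanonicalHom_uIcc_singleton {a c : ℝ} (h : A.le c a) :
    HasCanonicalHom A (Set.uIcc c a) {a} := by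
  rintro x y f hx rfl
  have hxy := le_antisymm_real ((mem_uIcc_iff_of_le h).1 hx).2 f.down
  exact ⟨fun _ => Set.right_mem_uIcc, fun _ => hxy⟩

/-- A morphism that starts in a simple representation is a section if all morphisms to
longer intervals factor through it. -/
lemma exists_retraction_of_factors {a : ℝ} (ha : a ∉ A.S) {V : QRep k A} (hV : isPwf k A V)
    (f : intervalRep k A {a} ⟶ V)
    (H : ∀ (c : ℝ) (h : A.le a c), c ≠ a → ∃ r : V ⟶ intervalRep k A (Set.uIcc a c),
      f ≫ r = canonicalHom (hasCanonicalHom_singleton_uIcc h)) :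
    ∃ r : V ⟶ intervalRep k A {a}, f ≫ r = 𝟙 _ := by
  classical
  let a' : A.Vertex := a
  let ι := {x : A.Vertex // x.val ≠ a ∧ A.le a x.val}
  -- Images at a of the spaces strictly above a. They form a chain, and finite-dimensionality
  -- provides a greatest one, attained at some x.
  let R : ι → Submodule k (V.obj a') := fun x => LinearMap.range (V.map (⟨x.2.2⟩ : x.1 ⟶ a')).hom
  have := hV a'
  obtain ⟨b, hba, hb⟩ := exists_gt_of_notMem ha
  have : Nonempty ι := ⟨⟨(b : A.Vertex), hba, hb⟩⟩
  have hmono : ∀ x y : ι, A.le x.1.val y.1.val → R y ≤ R x := by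
    rintro x y h _ ⟨m, rfl⟩
    exact ⟨(V.map (⟨h⟩ : y.1 ⟶ x.1)).hom m, map_comp_apply V _ _ m⟩
  obtain ⟨x, hx⟩ := exists_greatest_of_chain R fun x y =>
    (total_of_ge ha x.2.2 y.2.2).symm.imp (hmono y x) (hmono x y)
  -- With c strictly between a and x, the point x lies outside the interval from a to c, so r kills
  -- the image coming from x. As this is the greatest image, r kills all that comes from strictly
  -- above a, and its component at a is a morphism to the simple.
  obtain ⟨c, hca, hcx, hac, hcx'⟩ := exists_between_of_le x.2.2 x.2.1.symm
  obtain ⟨r, hr⟩ := H c hac hca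
  have hkill : ∀ (y : A.Vertex) (h : y ⟶ a'), y.val ≠ a → ∀ m,
      (r.app a').hom ((V.map h).hom m) = 0 := by
    intro y h hy m
    obtain ⟨m', hm'⟩ := hx ⟨y, hy, h.down⟩ ⟨m, rfl⟩
    have : (V.map h).hom m = (V.map (⟨x.2.2⟩ : x.1 ⟶ a')).hom m' := hm'.symm
    rw [this, nat_apply]
    have h0 : (r.app x.1).hom m' = 0 := coord_injective x.1 (by
      rw [coord_of_notMem, map_zero]
      exact fun h => hcx (le_antisymm_real hcx' ((mem_uIcc_iff_of_le hac).1 h).2))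
    rw [h0, map_zero]
  let φ : ∀ x : A.Vertex, V.obj x →ₗ[k] k := fun x =>
    if h : x = a' then (coord (Set.uIcc a c) a').comp ((r.app a').hom.comp
      (V.map (eqToHom h)).hom) else 0
  have hφa : ∀ m, φ a' m = coord (Set.uIcc a c) a' ((r.app a').hom m) := fun m => by
    simp only [φ, dif_pos, LinearMap.comp_apply]
    rw [map_id_apply]
  refine ⟨homOfCosection φ fun y z g hz m => ?_, ?_⟩
  · obtain rfl : a' = z := Eq.symm hz
    rw [hφa]
    split_ifs with hy
    · obtain rfl : a' = y := Eq.symm hy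
      rw [map_id_apply, hφa]
    · rw [hkill y g hy, map_zero]
  · refine intervalRep_hom_ext fun y hy => coord_injective y ?_
    obtain rfl : a' = y := Eq.symm hy
    rw [qrep_comp_app, coord_homOfCosection _ _ hy, hφa, ← qrep_comp_app, hr,
      canonicalHom_stdVec _ hy,
      coord_stdVec (show a'.val ∈ Set.uIcc a c from Set.left_mem_uIcc)]
    exact (coord_stdVec (k := k) hy).symm

/-- A morphism that ends in a simple representation is a retraction if all morphisms from
longer intervals factor through it. -/
lemma exists_section_of_factors {a : ℝ} (ha : a ∉ A.S) {V : QRep k A} (hV : isPwf k A V)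
    (g : V ⟶ intervalRep k A {a})
    (H : ∀ (c : ℝ) (h : A.le c a), c ≠ a → ∃ s : intervalRep k A (Set.uIcc c a) ⟶ V,
      s ≫ g = canonicalHom (hasCanonicalHom_uIcc_singleton h)) :
    ∃ s : intervalRep k A {a} ⟶ V, s ≫ g = 𝟙 _ := by
  classical
  let a' : A.Vertex := a
  let ι := {x : A.Vertex // x.val ≠ a ∧ A.le x.val a}
  let R : ι → Submodule k (V.obj a') := fun x => LinearMap.ker (V.map (⟨x.2.2⟩ : a' ⟶ x.1)).hom
  have := hV a'
  obtain ⟨b, hba, hb⟩ := exists_lt_of_notMem ha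
  have : Nonempty ι := ⟨⟨(b : A.Vertex), hba, hb⟩⟩
  have hmono : ∀ x y : ι, A.le x.1.val y.1.val → R y ≤ R x := by
    intro x y h m hm
    rw [LinearMap.mem_ker] at hm ⊢
    rw [hom_eq (⟨x.2.2⟩ : a' ⟶ x.1) ((⟨y.2.2⟩ : a' ⟶ y.1) ≫ (⟨h⟩ : y.1 ⟶ x.1)),
      ← map_comp_apply, hm, map_zero]
  obtain ⟨x, hx⟩ := exists_least_of_chain R fun x y =>
    (total_of_le ha x.2.2 y.2.2).symm.imp (hmono y x) (hmono x y)
  -- Here x has the least kernel among the maps from a to points strictly below. Since x lies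
  -- outside the interval from c to a, the vector v dies at x, hence at every point strictly below
  -- a, and spans a copy of the simple.
  obtain ⟨c, hcx, hca, hxc, hca'⟩ := exists_between_of_le x.2.2 x.2.1
  obtain ⟨s, hs⟩ := H c hca' hca
  let v : V.obj a' := (s.app a').hom (stdVec k _ a')
  have hkill : ∀ (y : A.Vertex) (h : a' ⟶ y), y.val ≠ a → (V.map h).hom v = 0 := by
    intro y h hy
    refine LinearMap.mem_ker.1 (hx ⟨y, hy, h.down⟩ (LinearMap.mem_ker.2 ?_))
    rw [← nat_apply, map_stdVec_of_notMem, map_zero]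
    exact fun h => hcx (le_antisymm_real ((mem_uIcc_iff_of_le hca').1 h).1 hxc)
  let w : ∀ x : A.Vertex, V.obj x := fun x =>
    if h : a' = x then (V.map (eqToHom h)).hom v else 0
  have hwa : w a' = v := by
    simp only [w, dif_pos]
    rw [map_id_apply]
  refine ⟨homOfSection w fun y z f hy => ?_, ?_⟩
  · obtain rfl : a' = y := Eq.symm hy
    rw [hwa]
    split_ifs with hz
    · obtain rfl : a' = z := Eq.symm hz
      rw [map_id_apply, hwa]
    · exact hkill z f hz
  · refine intervalRep_hom_ext fun y hy => ?_
    obtain rfl : a' = y := Eq.symm hy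
    rw [qrep_comp_app, homOfSection_stdVec _ _ hy, hwa, ← qrep_comp_app, hs,
      canonicalHom_stdVec _ (show a'.val ∈ Set.uIcc c a from Set.right_mem_uIcc)]
    rfl

lemma isEmpty_iso_intervalRep {I J : Set ℝ} [I.OrdConnected] [J.OrdConnected] {c : ℝ} (hI : c ∉ I)
    (hJ : c ∈ J) : IsEmpty (intervalRep k A I ≅ intervalRep k A J) := ⟨fun e => by
  let c' : A.Vertex := c
  have h1 : (e.inv.app c').hom (stdVec k J c') = 0 :=
    coord_injective c' (by rw [coord_of_notMem (x := c') hI, map_zero])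
  have h2 : ((e.inv ≫ e.hom).app c').hom (stdVec k J c') = stdVec k _ c' := by
    rw [e.inv_hom_id]; rfl
  rw [qrep_comp_app, h1, map_zero] at h2
  have h3 := congrArg (coord J c') h2
  rw [map_zero, coord_stdVec (x := c') hJ] at h3
  exact zero_ne_one h3⟩

lemma canonicalHom_ne_zero {I J : Set ℝ} [I.OrdConnected] [J.OrdConnected]
    (h : HasCanonicalHom A I J) {c : ℝ} (hI : c ∈ I) (hJ : c ∈ J) :
    (canonicalHom h : intervalRep k A I ⟶ _) ≠ 0 := fun h0 => by
  let c' : A.Vertex := c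
  have h1 : ((canonicalHom h : intervalRep k A I ⟶ _).app c').hom (stdVec k I c') = 0 := by
    rw [h0]; rfl
  rw [canonicalHom_stdVec (x := c') h hI] at h1
  have h2 := congrArg (coord J c') h1
  rw [map_zero, coord_stdVec (x := c') hJ] at h2
  exact one_ne_zero h2

lemma isFG_uIcc {p q : ℝ} (h : A.le p q) : isFG k A (intervalRep k A (Set.uIcc p q)) :=
  isFG_intervalRep ((A.finite_inter_supp q).subset (Set.inter_subset_inter_right _
    fun _ hz => ((mem_uIcc_iff_of_le h).1 hz).2))

lemma indecomposable_repFG_intervalRep {I : Set ℝ} [I.OrdConnected] (hI : I.Nonempty)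
    (h : isFG k A (intervalRep k A I)) : Indecomposable (⟨_, h⟩ : RepFG k A) :=
  (indecomposablesAreIntervals (isFG k A) (fun _ h => h.1) _).2 ⟨I, inferInstance, hI, ⟨Iso.refl _⟩⟩

/-- The almost split property supplies factorizations for every closed interval ending at a on the
appropriate side, however short. Together they split the sequence, which is excluded. -/
theorem noARSequence_singleton {a : ℝ} (ha : a ∉ A.S) : NoARSequence k A {a} := by
  refine ⟨isFG_intervalRep ((Set.finite_singleton a).subset Set.inter_subset_right),
    fun T hT => ⟨?_, ?_⟩⟩
  · rintro ⟨e⟩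
    obtain ⟨r, hr⟩ := exists_retraction_of_factors ha T.X₂.property.1 (e.inv ≫ T.f.hom)
      fun c h hca => by
        let j : intervalRep k A {a} ⟶ intervalRep k A (Set.uIcc a c) :=
          canonicalHom (hasCanonicalHom_singleton_uIcc h)
        obtain ⟨h', hh'⟩ := hT.left_almost_split ⟨_, isFG_uIcc h⟩
          ((isFG k A).homMk (e.hom ≫ j))
          (indecomposable_repFG_intervalRep Set.nonempty_uIcc _)
          (fun h0 => by
            have h1 : e.hom ≫ j = 0 := congrArg (fun f => f.hom) h0
            refine canonicalHom_ne_zero (k := k) (hasCanonicalHom_singleton_uIcc h)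
              (Set.mem_singleton a) Set.left_mem_uIcc ?_
            change j = 0
            rw [← e.inv_hom_id_assoc j, h1, comp_zero])
          (fun ⟨e'⟩ => (isEmpty_iso_intervalRep (k := k) (A := A) (I := {a}) hca
            Set.right_mem_uIcc).false
            (e.symm ≪≫ (isFG k A).ι.mapIso e'))
        have hh : T.f.hom ≫ h'.hom = e.hom ≫ j := congrArg (fun f => f.hom) hh'
        exact ⟨h'.hom, by rw [Category.assoc, hh, e.inv_hom_id_assoc]⟩
    refine hT.not_section (IsSplitMono.mk' ⟨(isFG k A).homMk (r ≫ e.inv),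
      (isFG k A).hom_ext ?_⟩)
    change T.f.hom ≫ r ≫ e.inv = 𝟙 _
    rw [Category.assoc] at hr
    rw [← e.hom_inv_id_assoc (T.f.hom ≫ r ≫ e.inv), ← Category.assoc T.f.hom,
      ← Category.assoc e.inv, hr, Category.id_comp, e.hom_inv_id]
  · rintro ⟨e⟩
    obtain ⟨s, hs⟩ := exists_section_of_factors ha T.X₂.property.1 (T.g.hom ≫ e.hom)
      fun c h hca => by
        let j : intervalRep k A (Set.uIcc c a) ⟶ intervalRep k A {a} :=
          canonicalHom (hasCanonicalHom_uIcc_singleton h)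
        obtain ⟨h', hh'⟩ := hT.right_almost_split ⟨_, isFG_uIcc h⟩
          ((isFG k A).homMk (j ≫ e.inv))
          (indecomposable_repFG_intervalRep Set.nonempty_uIcc _)
          (fun h0 => by
            have h1 : j ≫ e.inv = 0 := congrArg (fun f => f.hom) h0
            refine canonicalHom_ne_zero (k := k) (hasCanonicalHom_uIcc_singleton h)
              Set.right_mem_uIcc (Set.mem_singleton a) ?_
            change j = 0
            rw [← Category.comp_id j, ← e.inv_hom_id, ← Category.assoc, h1, zero_comp])
          (fun ⟨e'⟩ => (isEmpty_iso_intervalRep (k := k) (A := A) (I := {a}) hca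
            Set.left_mem_uIcc).false
            (e.symm ≪≫ ((isFG k A).ι.mapIso e').symm))
        have hh : h'.hom ≫ T.g.hom = j ≫ e.inv := congrArg (fun f => f.hom) hh'
        exact ⟨h'.hom, by rw [← Category.assoc, hh, Category.assoc, e.inv_hom_id, Category.comp_id]⟩
    refine hT.not_retraction (IsSplitEpi.mk' ⟨(isFG k A).homMk (e.hom ≫ s),
      (isFG k A).hom_ext ?_⟩)
    change (e.hom ≫ s) ≫ T.g.hom = 𝟙 _
    rw [← Category.comp_id ((e.hom ≫ s) ≫ T.g.hom), ← e.hom_inv_id, Category.assoc,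
      Category.assoc, ← Category.assoc T.g.hom, ← Category.assoc s, hs, Category.id_comp]

end SimpleNotInARSequence

/-- The intervals in an almost split sequence: the closed interval `U` with the end points
`p ⪯ q` in the interior of a segment, the intervals `I₁` and `I₃` without `q` and `p`,
and the open interval `W`. -/
structure ContinuousQuiverA.IsSquare (A : ContinuousQuiverA) (p q : ℝ) (I₁ U W I₃ : Set ℝ) :
    Prop where
  left_notMem : p ∉ A.S
  right_notMem : q ∉ A.S
  ne : p ≠ q
  le : A.le p q
  mem_closed : ∀ z, z ∈ U ↔ A.le p z ∧ A.le z q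
  mem_left : ∀ z, z ∈ I₁ ↔ z ∈ U ∧ z ≠ q
  mem_right : ∀ z, z ∈ I₃ ↔ z ∈ U ∧ z ≠ p
  mem_open : ∀ z, z ∈ W ↔ z ∈ U ∧ z ≠ p ∧ z ≠ q

/-! ### Almost split squares of intervals -/

namespace ContinuousQuiverA.IsSquare

variable {A : ContinuousQuiverA} {p q : ℝ} {I₁ U W I₃ : Set ℝ} (h : A.IsSquare p q I₁ U W I₃)

include h

lemma left_mem_closed : p ∈ U := (h.mem_closed p).2 ⟨A.le_refl _, h.le⟩

lemma right_mem_closed : q ∈ U := (h.mem_closed q).2 ⟨h.le, A.le_refl _⟩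

lemma left_mem_left : p ∈ I₁ := (h.mem_left p).2 ⟨h.left_mem_closed, h.ne⟩

lemma right_mem_right : q ∈ I₃ := (h.mem_right q).2 ⟨h.right_mem_closed, h.ne.symm⟩

lemma right_notMem_left : q ∉ I₁ := fun h' => ((h.mem_left q).1 h').2 rfl

lemma left_notMem_open : p ∉ W := fun h' => ((h.mem_open p).1 h').2.1 rfl

lemma right_notMem_open : q ∉ W := fun h' => ((h.mem_open q).1 h').2.2 rfl

lemma left_subset : I₁ ⊆ U := fun z hz => ((h.mem_left z).1 hz).1

lemma right_subset : I₃ ⊆ U := fun z hz => ((h.mem_right z).1 hz).1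

lemma open_subset_left : W ⊆ I₁ := fun z hz =>
  (h.mem_left z).2 ⟨((h.mem_open z).1 hz).1, ((h.mem_open z).1 hz).2.2⟩

lemma open_subset_right : W ⊆ I₃ := fun z hz =>
  (h.mem_right z).2 ⟨((h.mem_open z).1 hz).1, ((h.mem_open z).1 hz).2.1⟩

lemma open_eq : W = I₁ \ {p} := by
  ext z
  rw [Set.mem_sdiff, h.mem_left, h.mem_open, Set.mem_singleton_iff]
  tauto

lemma right_eq : I₃ = U \ {p} := by
  ext z
  rw [Set.mem_sdiff, h.mem_right, Set.mem_singleton_iff]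

lemma closed_eq_uIcc : U = Set.uIcc p q := by
  ext z
  rw [h.mem_closed, mem_uIcc_iff_of_le h.le]

lemma isLower_singleton : ∀ x ∈ ({p} : Set ℝ), ∀ y ∈ U, A.le y x → y ∈ ({p} : Set ℝ) := by
  rintro x rfl y hy hyx
  exact le_antisymm_real hyx ((h.mem_closed y).1 hy).1

lemma canonicalHom_left_closed : HasCanonicalHom A I₁ U :=
  hasCanonicalHom_sub h.left_subset fun x hx y hy hyx => (h.mem_left y).2 ⟨hy, by
    rintro rfl
    have hx' := (h.mem_left x).1 hx
    exact hx'.2 (le_antisymm_real ((h.mem_closed x).1 hx'.1).2 hyx)⟩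

lemma canonicalHom_left_open : HasCanonicalHom A I₁ W :=
  hasCanonicalHom_quot h.open_eq fun x hx y hy => h.isLower_singleton x hx y (h.left_subset hy)

lemma canonicalHom_closed_right : HasCanonicalHom A U I₃ :=
  hasCanonicalHom_quot h.right_eq h.isLower_singleton

lemma canonicalHom_open_right : HasCanonicalHom A W I₃ :=
  hasCanonicalHom_sub h.open_subset_right fun x hx y hy hyx => (h.mem_open y).2
    ⟨h.right_subset hy, ((h.mem_right y).1 hy).2, by
      rintro rfl
      have hx' := (h.mem_open x).1 hx
      exact hx'.2.2 (le_antisymm_real ((h.mem_closed x).1 hx'.1).2 hyx)⟩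

/-- An interval that contains `I₁` but not `q` and is larger than `I₁` contains
points properly below `p`. -/
lemma exists_lt_left {K : Set ℝ} [hK : K.OrdConnected] (hIK : I₁ ⊆ K) (hne : K ≠ I₁) (hq : q ∉ K) :
    ∃ y ∈ K, y ≠ p ∧ A.le y p := by
  obtain ⟨z, hz, hzI⟩ := Set.exists_of_ssubset (lt_of_le_of_ne hIK hne.symm)
  have hpK := hIK h.left_mem_left
  have hzp : z ≠ p := fun h' => hzI (h' ▸ h.left_mem_left)
  -- The point d marks the side of p away from q. The extra point z of K lies on that side as well,
  -- since q is not in K; a point close enough to p lies between p and both of them.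
  obtain ⟨d, hdp, hd⟩ := exists_lt_of_notMem h.left_notMem
  have hpd : p ∈ Set.uIcc d q := A.mem_uIcc_of_le_real hd h.le
  rcases mem_uIcc_cases z p q with h1 | h1 | h1
  · obtain ⟨y, hy, hyz, hyd⟩ := exists_mem_uIcc_inter h.ne hpd hdp h1 hzp
    exact ⟨y, hK.uIcc_subset hz hpK hyz, hy, (A.le_of_mem_uIcc_real hd hyd).2⟩
  · exact absurd (hK.uIcc_subset hz hpK h1) hq
  · rw [← h.closed_eq_uIcc] at h1
    exact absurd ((h.mem_left z).2 ⟨h1, fun h' => hq (h' ▸ hz)⟩) hzI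

/-- An interval that contains `I₃` but not `p` and is larger than `I₃` contains
points properly above `q`. -/
lemma exists_gt_right {K : Set ℝ} [hK : K.OrdConnected] (hIK : I₃ ⊆ K) (hne : K ≠ I₃) (hp : p ∉ K) :
    ∃ y ∈ K, y ≠ q ∧ A.le q y := by
  obtain ⟨z, hz, hzI⟩ := Set.exists_of_ssubset (lt_of_le_of_ne hIK hne.symm)
  have hqK := hIK h.right_mem_right
  have hzq : z ≠ q := fun h' => hzI (h' ▸ h.right_mem_right)
  obtain ⟨d, hdq, hd⟩ := exists_gt_of_notMem h.right_notMem
  have hqd : q ∈ Set.uIcc d p := Set.uIcc_comm p d ▸ A.mem_uIcc_of_le_real h.le hd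
  rcases mem_uIcc_cases z q p with h1 | h1 | h1
  · obtain ⟨y, hy, hyz, hyd⟩ := exists_mem_uIcc_inter h.ne.symm hqd hdq h1 hzq
    exact ⟨y, hK.uIcc_subset hz hqK hyz, hy,
      (A.le_of_mem_uIcc_real hd (Set.uIcc_comm d q ▸ hyd)).1⟩
  · exact absurd (hK.uIcc_subset hz hqK h1) hp
  · rw [Set.uIcc_comm, ← h.closed_eq_uIcc] at h1
    exact absurd ((h.mem_right z).2 ⟨h1, fun h' => hp (h' ▸ hz)⟩) hzI

variable {k : Type u} [Field k]

/-- If t vanishes at p it kills the simple subobject there and factors through `M_W`. Otherwise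
naturality forces K to contain I₁ and no point properly below p, so K ≠ I₁ forces q into K. Then K
contains U, the canonical morphism from `M_U` to `M_K` exists, and t is a multiple of its
restriction. -/
lemma exists_factor_left [I₁.OrdConnected] [U.OrdConnected] [W.OrdConnected]
    {K : Set ℝ} [hK : K.OrdConnected] (hne : K ≠ I₁)
    (t : intervalRep k A I₁ ⟶ intervalRep k A K) :
    (∃ t' : intervalRep k A U ⟶ intervalRep k A K,
      canonicalHom h.canonicalHom_left_closed ≫ t' = t) ∨
    (∃ t' : intervalRep k A W ⟶ intervalRep k A K,
      canonicalHom h.canonicalHom_left_open ≫ t' = t) := by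
  let p' : A.Vertex := p
  have hp1 : p'.val ∈ I₁ := h.left_mem_left
  by_cases h0 : (t.app p').hom (stdVec k I₁ p') = 0
  · right
    have hsub : HasCanonicalHom A {p} I₁ := hasCanonicalHom_sub
      (Set.singleton_subset_iff.2 h.left_mem_left)
      fun x hx y hy => h.isLower_singleton x hx y (h.left_subset hy)
    obtain ⟨w, hw⟩ := shortExact_intervalRep (k := k)
      (Set.singleton_subset_iff.2 h.left_mem_left) h.open_eq hsub h.canonicalHom_left_open
    have := hw.epi_g
    refine ⟨hw.exact.desc t ?_, hw.exact.g_desc t _⟩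
    refine intervalRep_hom_ext fun x hx => ?_
    obtain rfl : p' = x := Eq.symm hx
    rw [qrep_comp_app]
    erw [canonicalHom_stdVec hsub hx]
    exact h0
  left
  have hpK : p'.val ∈ K := by
    by_contra hpK
    exact h0 (coord_injective p' (by rw [coord_of_notMem hpK, map_zero]))
  have hc : coord K p' ((t.app p').hom (stdVec k I₁ p')) ≠ 0 := fun hc =>
    h0 (coord_injective p' (by rw [hc, map_zero]))
  have hIK : I₁ ⊆ K := by
    intro x hx
    by_contra hxK
    let x' : A.Vertex := x
    have hxp : A.le p x := ((h.mem_closed x).1 (h.left_subset hx)).1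
    have h1 := nat_apply t (⟨hxp⟩ : x' ⟶ p') (stdVec k I₁ x')
    have h2 : (t.app x').hom (stdVec k I₁ x') = 0 :=
      coord_injective x' (by rw [coord_of_notMem (x := x') hxK, map_zero])
    rw [map_stdVec (x := x') _ hx hp1, h2, map_zero] at h1
    exact h0 h1
  have hbelow : ∀ y : A.Vertex, A.le y.val p → y.val ≠ p → y.val ∉ K := by
    intro y hy hyp hyK
    have h1 := nat_apply t (⟨hy⟩ : p' ⟶ y) (stdVec k I₁ p')
    have hyI : y.val ∉ I₁ := fun hyI =>
      hyp (le_antisymm_real hy ((h.mem_closed _).1 (h.left_subset hyI)).1)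
    rw [map_stdVec_of_notMem _ hyI, map_zero] at h1
    have h2 := congrArg (coord K y) h1
    rw [coord_map, if_pos hyK, map_zero] at h2
    exact hc h2.symm
  have hqK : q ∈ K := by
    by_contra hqK
    obtain ⟨y, hyK, hyp, hy⟩ := h.exists_lt_left hIK hne hqK
    exact hbelow (show A.Vertex from y) hy hyp hyK
  have hUK : U ⊆ K := fun x hx => by
    by_cases hxq : x = q
    · exact hxq ▸ hqK
    · exact hIK ((h.mem_left x).2 ⟨hx, hxq⟩)
  have hcan : HasCanonicalHom A U K := fun x y a hx hy => by
    refine ⟨fun _ => ?_, fun _ => hUK hx⟩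
    have hyq := A.le_trans a.down ((h.mem_closed _).1 hx).2
    refine (h.mem_closed _).2 ⟨?_, hyq⟩
    rcases total_of_le h.right_notMem h.le hyq with h1 | h1
    · exact h1
    · by_cases hyp : y.val = p
      · exact hyp ▸ A.le_refl _
      · exact absurd hy (hbelow y h1 hyp)
  refine ⟨coord K p' ((t.app p').hom (stdVec k I₁ p')) • canonicalHom hcan, ?_⟩
  rw [← sub_eq_zero]
  refine intervalRep_hom_eq_zero hp1 hpK ?_
  rw [qrep_sub_app, qrep_comp_app, canonicalHom_stdVec _ hp1, qrep_smul_app,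
    canonicalHom_stdVec (x := p') _ h.left_mem_closed, coord_smul_stdVec, sub_self]

/-- Dually, if t vanishes at q it lands in the kernel `M_W` of the projection to the simple at q.
Otherwise K contains I₃ and no point properly above q, so K ≠ I₃ forces p into K, and t is a
multiple of a composite through `M_U`. -/
lemma exists_factor_right [U.OrdConnected] [W.OrdConnected] [I₃.OrdConnected]
    {K : Set ℝ} [hK : K.OrdConnected] (hne : K ≠ I₃)
    (t : intervalRep k A K ⟶ intervalRep k A I₃) :
    (∃ t' : intervalRep k A K ⟶ intervalRep k A U,
      t' ≫ canonicalHom h.canonicalHom_closed_right = t) ∨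
    (∃ t' : intervalRep k A K ⟶ intervalRep k A W,
      t' ≫ canonicalHom h.canonicalHom_open_right = t) := by
  let q' : A.Vertex := q
  have hq3 : q'.val ∈ I₃ := h.right_mem_right
  by_cases h0 : (t.app q').hom (stdVec k K q') = 0
  · right
    have hE : ({q} : Set ℝ) = I₃ \ W := by
      ext z
      rw [Set.mem_sdiff, h.mem_right, h.mem_open, Set.mem_singleton_iff]
      refine ⟨?_, by tauto⟩
      rintro rfl
      exact ⟨⟨h.right_mem_closed, h.ne.symm⟩, fun h' => h'.2.2 rfl⟩
    have hquot : HasCanonicalHom A I₃ {q} := by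
      rintro x y a hx rfl
      exact ⟨fun _ => h.right_mem_right,
        fun _ => le_antisymm_real ((h.mem_closed _).1 (h.right_subset hx)).2 a.down⟩
    obtain ⟨w, hw⟩ := shortExact_intervalRep (k := k) h.open_subset_right hE
      h.canonicalHom_open_right hquot
    have := hw.mono_f
    refine ⟨hw.exact.lift t ?_, hw.exact.lift_f t _⟩
    refine intervalRep_hom_ext fun x hx => coord_injective x ?_
    by_cases hxq : x.val = q
    · obtain rfl : q' = x := Eq.symm hxq
      rw [qrep_comp_app, h0, map_zero]
      rfl
    · rw [coord_of_notMem (I := {q}) hxq, coord_of_notMem (I := {q}) hxq]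
  left
  have hqK : q'.val ∈ K := by
    by_contra hqK
    exact h0 (by rw [stdVec_of_notMem hqK, map_zero])
  have hc : coord I₃ q' ((t.app q').hom (stdVec k K q')) ≠ 0 := fun hc =>
    h0 (coord_injective q' (by rw [hc, map_zero]))
  have hIK : I₃ ⊆ K := by
    intro x hx
    by_contra hxK
    let x' : A.Vertex := x
    have hxq : A.le x q := ((h.mem_closed x).1 (h.right_subset hx)).2
    have h1 := nat_apply t (⟨hxq⟩ : q' ⟶ x') (stdVec k K q')
    rw [map_stdVec_of_notMem (y := x') _ hxK, map_zero] at h1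
    have h2 := congrArg (coord I₃ x') h1
    rw [coord_map, if_pos (show x'.val ∈ I₃ from hx), map_zero] at h2
    exact hc h2.symm
  have habove : ∀ y : A.Vertex, A.le q y.val → y.val ≠ q → y.val ∉ K := by
    intro y hy hyq hyK
    have h1 := nat_apply t (⟨hy⟩ : y ⟶ q') (stdVec k K y)
    have hyI : y.val ∉ I₃ := fun hyI =>
      hyq (le_antisymm_real ((h.mem_closed _).1 (h.right_subset hyI)).2 hy)
    have h2 : (t.app y).hom (stdVec k K y) = 0 :=
      coord_injective y (by rw [coord_of_notMem hyI, map_zero])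
    rw [map_stdVec _ hyK hqK, h2, map_zero] at h1
    exact h0 h1
  have hpK : p ∈ K := by
    by_contra hpK
    obtain ⟨y, hyK, hyq, hy⟩ := h.exists_gt_right hIK hne hpK
    exact habove (show A.Vertex from y) hy hyq hyK
  have hUK : U ⊆ K := fun x hx => by
    by_cases hxp : x = p
    · exact hxp ▸ hpK
    · exact hIK ((h.mem_right x).2 ⟨hx, hxp⟩)
  have hcan : HasCanonicalHom A K U := fun x y a hx hy => by
    refine ⟨fun _ => hUK hy, fun _ => ?_⟩
    have hpx := A.le_trans ((h.mem_closed _).1 hy).1 a.down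
    refine (h.mem_closed _).2 ⟨hpx, ?_⟩
    rcases total_of_ge h.left_notMem h.le hpx with h1 | h1
    · by_cases hxq : x.val = q
      · exact hxq ▸ A.le_refl _
      · exact absurd hx (habove x h1 hxq)
    · exact h1
  refine ⟨coord I₃ q' ((t.app q').hom (stdVec k K q')) • canonicalHom hcan, ?_⟩
  rw [← sub_eq_zero]
  refine intervalRep_hom_eq_zero hqK hq3 ?_
  rw [qrep_sub_app, qrep_comp_app, qrep_smul_app, canonicalHom_stdVec _ hqK, map_smul,
    canonicalHom_stdVec (x := q') _ h.right_mem_closed, coord_smul_stdVec, sub_self]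

end ContinuousQuiverA.IsSquare

/-! ### Auslander-Reiten sequences -/

section ARSequences

variable {k : Type u} [Field k] {A : ContinuousQuiverA}

/-- A criterion for a sequence with a decomposed middle term to be an Auslander-Reiten
sequence. -/
theorem isARSequence_of {X₁ X₂ X₂' X₃ : RepFG k A} {f : X₁ ⟶ X₂} {f' : X₁ ⟶ X₂'} {g : X₂ ⟶ X₃}
    {g' : X₂' ⟶ X₃} (zero : biprod.lift f f' ≫ biprod.desc g (-g') = 0)
    (h1 : Indecomposable X₁) (h3 : Indecomposable X₃) (hmono : Mono f ∨ Mono f')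
    (hepi : Epi g ∨ Epi g')
    (hex : ∀ x u w, (g.hom.app x).hom u = (g'.hom.app x).hom w →
      ∃ n, (f.hom.app x).hom n = u ∧ (f'.hom.app x).hom n = w)
    (hns : ∀ (r : X₂ ⟶ X₁) (r' : X₂' ⟶ X₁), f ≫ r + f' ≫ r' ≠ 𝟙 X₁)
    (hl : ∀ X, Indecomposable X → ¬ Nonempty (X₁ ≅ X) → ∀ t : X₁ ⟶ X,
      (∃ t', f ≫ t' = t) ∨ (∃ t', f' ≫ t' = t))
    (hr : ∀ X, Indecomposable X → ¬ Nonempty (X ≅ X₃) → ∀ t : X ⟶ X₃,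
      (∃ t', t' ≫ g = t) ∨ (∃ t', t' ≫ g' = t)) :
    IsARSequence (ShortComplex.mk (biprod.lift f f') (biprod.desc g (-g')) zero) := by
  let := (hasKernelsCokernelsImages_of_isClosed (isFG k A)).abelian
  have hm : Mono (biprod.lift f f') := by
    rcases hmono with h | h
    · exact mono_of_mono_fac (biprod.lift_fst f f')
    · exact mono_of_mono_fac (biprod.lift_snd f f')
  have he : Epi (biprod.desc g (-g')) := by
    rcases hepi with h | h
    · exact epi_of_epi_fac (biprod.inl_desc g (-g'))
    · exact epi_of_epi_fac (biprod.inr_desc g (-g'))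
  have hS : (ShortComplex.mk (biprod.lift f f') (biprod.desc g (-g')) zero).Exact := by
    rw [← ShortComplex.exact_map_iff_of_faithful _ (isFG k A).ι, qrep_exact_iff]
    intro x m hm
    have htot : ∀ m, ((biprod.inl : X₂ ⟶ X₂ ⊞ X₂').hom.app x).hom
        (((biprod.fst : X₂ ⊞ X₂' ⟶ X₂).hom.app x).hom m) +
        ((biprod.inr : X₂' ⟶ X₂ ⊞ X₂').hom.app x).hom
        (((biprod.snd : X₂ ⊞ X₂' ⟶ X₂').hom.app x).hom m) = m := fun m => by
      have := congrArg (fun F => (F.hom.app x).hom m) (biprod.total (X := X₂) (Y := X₂'))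
      exact this
    have hdesc : ∀ m, ((biprod.desc g (-g')).hom.app x).hom m =
        (g.hom.app x).hom (((biprod.fst : X₂ ⊞ X₂' ⟶ X₂).hom.app x).hom m) -
        (g'.hom.app x).hom (((biprod.snd : X₂ ⊞ X₂' ⟶ X₂').hom.app x).hom m) := fun m => by
      have h1 : biprod.desc g (-g') = biprod.fst ≫ g - biprod.snd ≫ g' := by
        rw [biprod.desc_eq, Preadditive.comp_neg, sub_eq_add_neg]
      rw [h1]
      rfl
    obtain ⟨n, hn, hn'⟩ := hex x _ _ (sub_eq_zero.1 ((hdesc m).symm.trans hm))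
    refine ⟨n, ?_⟩
    change ((biprod.lift f f').hom.app x).hom n = m
    rw [← htot (((biprod.lift f f').hom.app x).hom n), ← htot m, ← hn, ← hn']
    congr 2
    · exact congrArg (fun F => (F.hom.app x).hom n) (biprod.lift_fst f f')
    · exact congrArg (fun F => (F.hom.app x).hom n) (biprod.lift_snd f f')
  have hsec : ¬ IsSplitMono (biprod.lift f f') := fun ⟨⟨r⟩⟩ => by
    refine hns (biprod.inl ≫ r.retraction) (biprod.inr ≫ r.retraction) ?_
    rw [← Category.assoc, ← Category.assoc, ← Preadditive.add_comp]
    exact (congrArg (· ≫ r.retraction) biprod.lift_eq.symm).trans r.id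
  exact
    { shortExact := ⟨hS⟩
      not_section := hsec
      -- A section of the epimorphism splits the exact sequence and so provides a retraction of the
      -- monomorphism, which has just been excluded.
      not_retraction := fun ⟨⟨s⟩⟩ => hsec (by
        let σ := ShortComplex.Splitting.ofExactOfSection _ hS s.section_ s.id hm
        exact IsSplitMono.mk' ⟨σ.r, σ.f_r⟩)
      indecomposable_left := h1
      indecomposable_right := h3
      left_almost_split := fun X t hX _ hiso => by
        rcases hl X hX hiso t with ⟨t', rfl⟩ | ⟨t', rfl⟩
        · exact ⟨biprod.desc t' 0, by simp⟩
        · exact ⟨biprod.desc 0 t', by simp⟩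
      right_almost_split := fun X t hX _ hiso => by
        rcases hr X hX hiso t with ⟨t', rfl⟩ | ⟨t', rfl⟩
        · exact ⟨biprod.lift t' 0, by simp⟩
        · exact ⟨biprod.lift 0 (-t'), by simp⟩ }

variable {p q : ℝ} {I₁ U W I₃ : Set ℝ} [I₁.OrdConnected] [U.OrdConnected] [W.OrdConnected]
  [I₃.OrdConnected]

lemma repFG_iso_of_eq {K L : Set ℝ} [K.OrdConnected] [L.OrdConnected] (hKL : K = L)
    {X : RepFG k A} (e : X.obj ≅ intervalRep k A K) (hL : isFG k A (intervalRep k A L)) :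
    Nonempty (X ≅ ⟨_, hL⟩) := by
  subst hKL
  exact ⟨⟨(isFG k A).homMk e.hom, (isFG k A).homMk e.inv, (isFG k A).hom_ext e.hom_inv_id,
    (isFG k A).hom_ext e.inv_hom_id⟩⟩

/-- Both orders of the middle terms are needed, the closed interval coming first for even n and
second for odd n; the argument is symmetric in them. -/
theorem ContinuousQuiverA.IsSquare.isIntervalARSequence (h : A.IsSquare p q I₁ U W I₃) :
    IsIntervalARSequence k A I₁ U W I₃ ∧ IsIntervalARSequence k A I₁ W U I₃ := by
  have hU : isFG k A (intervalRep k A U) :=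
    isFG_intervalRep ((A.finite_inter_supp q).subset (Set.inter_subset_inter_right _
      fun z hz => ((h.mem_closed z).1 hz).2))
  have hsub : ∀ (D : Set ℝ) [D.OrdConnected], D ⊆ U → isFG k A (intervalRep k A D) :=
    fun D _ hD => isFG_intervalRep ((isFG_intervalRep_iff.1 hU).subset
      (Set.inter_subset_inter_right _ hD))
  have h1 := hsub I₁ h.left_subset
  have h3 := hsub I₃ h.right_subset
  have hW := hsub W (h.open_subset_left.trans h.left_subset)
  let f : (⟨_, h1⟩ : RepFG k A) ⟶ ⟨_, hU⟩ :=
    (isFG k A).homMk (canonicalHom h.canonicalHom_left_closed)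
  let f' : (⟨_, h1⟩ : RepFG k A) ⟶ ⟨_, hW⟩ :=
    (isFG k A).homMk (canonicalHom h.canonicalHom_left_open)
  let g : (⟨_, hU⟩ : RepFG k A) ⟶ ⟨_, h3⟩ :=
    (isFG k A).homMk (canonicalHom h.canonicalHom_closed_right)
  let g' : (⟨_, hW⟩ : RepFG k A) ⟶ ⟨_, h3⟩ :=
    (isFG k A).homMk (canonicalHom h.canonicalHom_open_right)
  have hcomm : f ≫ g = f' ≫ g' := by
    refine (isFG k A).hom_ext (intervalRep_hom_ext fun x hx => ?_)
    change ((canonicalHom h.canonicalHom_closed_right).app x).hom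
      (((canonicalHom h.canonicalHom_left_closed).app x).hom _) =
        ((canonicalHom h.canonicalHom_open_right).app x).hom
          (((canonicalHom h.canonicalHom_left_open).app x).hom _)
    rw [canonicalHom_stdVec _ hx, canonicalHom_stdVec _ hx,
      canonicalHom_stdVec _ (h.left_subset hx)]
    by_cases hxW : x.val ∈ W
    · rw [canonicalHom_stdVec _ hxW]
    · rw [stdVec_of_notMem hxW, map_zero, stdVec_of_notMem fun hx3 =>
        hxW ((h.mem_open _).2 ⟨h.left_subset hx, ((h.mem_right _).1 hx3).2,
          ((h.mem_left _).1 hx).2⟩)]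
  have hf : Mono f := (isFG k A).ι.mono_of_mono_map 
    (mono_canonicalHom h.canonicalHom_left_closed h.left_subset)
  have hg : Epi g := (isFG k A).ι.epi_of_epi_map 
    (epi_canonicalHom h.canonicalHom_closed_right h.right_subset)
  -- The preimage has the coordinate of u. Only q needs care, where I₁ has no generator: the
  -- coordinate of u there equals that of w, which is 0 as q is not in W.
  have hex : ∀ x u w, (g.hom.app x).hom u = (g'.hom.app x).hom w →
      ∃ n, (f.hom.app x).hom n = u ∧ (f'.hom.app x).hom n = w := by
    intro x u w huw
    replace huw : ((canonicalHom h.canonicalHom_closed_right).app x).hom u =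
      ((canonicalHom h.canonicalHom_open_right).app x).hom w := huw
    have hc : ∀ hx : x.val ∈ I₃, coord U x u = coord W x w := fun hx => by
      rw [← coord_canonicalHom h.canonicalHom_closed_right hx, huw,
        coord_canonicalHom h.canonicalHom_open_right hx]
    refine ⟨coord U x u • stdVec k I₁ x, coord_injective x ?_, coord_injective x ?_⟩
    · change coord U x (((canonicalHom h.canonicalHom_left_closed).app x).hom _) = _
      by_cases hxU : x.val ∈ U
      · rw [coord_canonicalHom _ hxU, map_smul]
        by_cases hx : x.val ∈ I₁
        · rw [coord_stdVec hx, smul_eq_mul, mul_one]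
        · have hxq : x.val = q := by
            by_contra hxq
            exact hx ((h.mem_left _).2 ⟨hxU, hxq⟩)
          rw [hc (hxq ▸ h.right_mem_right), coord_of_notMem (hxq ▸ h.right_notMem_open), zero_smul]
      · rw [coord_of_notMem hxU, coord_of_notMem hxU]
    · change coord W x (((canonicalHom h.canonicalHom_left_open).app x).hom _) = _
      by_cases hxW : x.val ∈ W
      · rw [coord_canonicalHom _ hxW, map_smul, coord_stdVec (h.open_subset_left hxW),
          smul_eq_mul, mul_one, hc (h.open_subset_right hxW)]
      · rw [coord_of_notMem hxW, coord_of_notMem hxW]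
  let p' : A.Vertex := p
  let q' : A.Vertex := q
  have hp1 : p'.val ∈ I₁ := h.left_mem_left
  -- Both composites vanish at p: W does not contain p, and the generator of `M_U` at p comes from
  -- the one at q, where `M_{I₁}` is zero.
  have hns : ∀ (r : (⟨_, hU⟩ : RepFG k A) ⟶ ⟨_, h1⟩) (r' : (⟨_, hW⟩ : RepFG k A) ⟶ ⟨_, h1⟩),
      f ≫ r + f' ≫ r' ≠ 𝟙 _ := by
    intro r r' hrr
    let ρ : intervalRep k A U ⟶ intervalRep k A I₁ := r.hom
    let ρ' : intervalRep k A W ⟶ intervalRep k A I₁ := r'.hom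
    have h0 : canonicalHom h.canonicalHom_left_closed ≫ ρ +
        canonicalHom h.canonicalHom_left_open ≫ ρ' = 𝟙 (intervalRep k A I₁) :=
      congrArg (fun F => F.hom) hrr
    refine intervalRep_id_ne_zero (k := k) (A := A) ⟨p, h.left_mem_left⟩ ?_
    rw [← h0]
    refine intervalRep_hom_eq_zero hp1 hp1 ?_
    rw [qrep_add_app, qrep_comp_app, qrep_comp_app, canonicalHom_stdVec _ hp1,
      canonicalHom_stdVec _ hp1, stdVec_of_notMem (x := p') h.left_notMem_open, map_zero, add_zero,
      ← map_stdVec (⟨h.le⟩ : q' ⟶ p') h.right_mem_closed h.left_mem_closed, nat_apply]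
    have h2 : (ρ.app q').hom (stdVec k U q') = 0 := coord_injective q' (by
      rw [coord_of_notMem (x := q') h.right_notMem_left, map_zero])
    rw [h2, map_zero]
  have hl : ∀ X : RepFG k A, Indecomposable X → ¬ Nonempty ((⟨_, h1⟩ : RepFG k A) ≅ X) →
      ∀ t : (⟨_, h1⟩ : RepFG k A) ⟶ X, (∃ t', f ≫ t' = t) ∨ (∃ t', f' ≫ t' = t) := by
    intro X hX hiso t
    obtain ⟨K, _, -, ⟨e⟩⟩ := (indecomposablesAreIntervals (isFG k A) (fun _ h => h.1) X).1 hX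
    have hK : K ≠ I₁ := fun hK => hiso ((repFG_iso_of_eq hK e h1).map Iso.symm)
    refine (h.exists_factor_left hK (t.hom ≫ e.hom)).imp ?_ ?_
    · rintro ⟨t', ht'⟩
      refine ⟨(isFG k A).homMk (t' ≫ e.inv), (isFG k A).hom_ext ?_⟩
      change canonicalHom h.canonicalHom_left_closed ≫ t' ≫ e.inv = t.hom
      rw [← Category.assoc, ht', Category.assoc, e.hom_inv_id, Category.comp_id]
    · rintro ⟨t', ht'⟩
      refine ⟨(isFG k A).homMk (t' ≫ e.inv), (isFG k A).hom_ext ?_⟩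
      change canonicalHom h.canonicalHom_left_open ≫ t' ≫ e.inv = t.hom
      rw [← Category.assoc, ht', Category.assoc, e.hom_inv_id, Category.comp_id]
  have hr : ∀ X : RepFG k A, Indecomposable X → ¬ Nonempty (X ≅ (⟨_, h3⟩ : RepFG k A)) →
      ∀ t : X ⟶ (⟨_, h3⟩ : RepFG k A), (∃ t', t' ≫ g = t) ∨ (∃ t', t' ≫ g' = t) := by
    intro X hX hiso t
    obtain ⟨K, _, -, ⟨e⟩⟩ := (indecomposablesAreIntervals (isFG k A) (fun _ h => h.1) X).1 hX
    have hK : K ≠ I₃ := fun hK => hiso (repFG_iso_of_eq hK e h3)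
    refine (h.exists_factor_right hK (e.inv ≫ t.hom)).imp ?_ ?_
    · rintro ⟨t', ht'⟩
      refine ⟨(isFG k A).homMk (e.hom ≫ t'), (isFG k A).hom_ext ?_⟩
      change (e.hom ≫ t') ≫ canonicalHom h.canonicalHom_closed_right = t.hom
      rw [Category.assoc, ht', e.hom_inv_id_assoc]
    · rintro ⟨t', ht'⟩
      refine ⟨(isFG k A).homMk (e.hom ≫ t'), (isFG k A).hom_ext ?_⟩
      change (e.hom ≫ t') ≫ canonicalHom h.canonicalHom_open_right = t.hom
      rw [Category.assoc, ht', e.hom_inv_id_assoc]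
  have i1 : Indecomposable (⟨_, h1⟩ : RepFG k A) :=
    indecomposable_repFG_intervalRep ⟨p, h.left_mem_left⟩ h1
  have i3 : Indecomposable (⟨_, h3⟩ : RepFG k A) :=
    indecomposable_repFG_intervalRep ⟨q, h.right_mem_right⟩ h3
  constructor
  · have zero : biprod.lift f f' ≫ biprod.desc g (-g') = 0 := by simp [hcomm]
    exact ⟨h1, hU, hW, h3, f, f', g, g', zero,
      isCanonicalHom_canonicalHom h.canonicalHom_left_closed,
      isCanonicalHom_canonicalHom h.canonicalHom_left_open,
      isCanonicalHom_canonicalHom h.canonicalHom_closed_right,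
      isCanonicalHom_canonicalHom h.canonicalHom_open_right,
      isARSequence_of zero i1 i3 (Or.inl hf) (Or.inl hg) hex hns hl hr⟩
  · have zero : biprod.lift f' f ≫ biprod.desc g' (-g) = 0 := by simp [hcomm]
    exact ⟨h1, hW, hU, h3, f', f, g', g, zero,
      isCanonicalHom_canonicalHom h.canonicalHom_left_open,
      isCanonicalHom_canonicalHom h.canonicalHom_left_closed,
      isCanonicalHom_canonicalHom h.canonicalHom_open_right,
      isCanonicalHom_canonicalHom h.canonicalHom_closed_right,
      isARSequence_of zero i1 i3 (Or.inr hf) (Or.inr hg)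
        (fun x u w huw => (hex x w u huw.symm).imp fun _ => And.symm)
        (fun r r' => by rw [add_comm]; exact hns r' r)
        (fun X hX hi t => (hl X hX hi t).symm) (fun X hX hi t => (hr X hX hi t).symm)⟩

end ARSequences

namespace ContinuousQuiverA

variable {A : ContinuousQuiverA}

lemma isSquare_of_even {n : ℤ} {hn : ExtInt.ofInt n ∈ A.index}
    {hn' : ExtInt.ofInt (n + 1) ∈ A.index} {a b : ℝ} (ha : (A.s ⟨_, hn⟩ : EReal) < a) (hab : a < b)
    (hb : (b : EReal) < A.s ⟨_, hn'⟩) (e : Even n) :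
    A.IsSquare a b (Set.Ico a b) (Set.Icc a b) (Set.Ioo a b) (Set.Ioc a b) := by
  have hab' := EReal.coe_lt_coe_iff.2 hab
  have hle := (A.le_of_mem_segment ha.le hab'.le hb.le).1 e
  refine ⟨A.notMem_S_of_mem_segment ha (hab'.trans hb),
    A.notMem_S_of_mem_segment (ha.trans hab') hb,
    hab.ne, hle, fun z => ?_, fun z => ?_, fun z => ?_, fun z => ?_⟩
  · rw [← mem_uIcc_iff_of_le hle, Set.uIcc_of_le hab.le]
  · simp only [Set.mem_Ico, Set.mem_Icc, lt_iff_le_and_ne, ne_eq, and_assoc]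
  · simp only [Set.mem_Ioc, Set.mem_Icc, lt_iff_le_and_ne, ne_eq, eq_comm (a := a)]
    tauto
  · simp only [Set.mem_Ioo, Set.mem_Icc, lt_iff_le_and_ne, ne_eq, eq_comm (a := a)]
    tauto

lemma isSquare_of_odd {n : ℤ} {hn : ExtInt.ofInt n ∈ A.index}
    {hn' : ExtInt.ofInt (n + 1) ∈ A.index} {a b : ℝ} (ha : (A.s ⟨_, hn⟩ : EReal) < a) (hab : a < b)
    (hb : (b : EReal) < A.s ⟨_, hn'⟩) (e : Odd n) :
    A.IsSquare b a (Set.Ioc a b) (Set.Icc a b) (Set.Ioo a b) (Set.Ico a b) := by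
  have hab' := EReal.coe_lt_coe_iff.2 hab
  have hle := (A.le_of_mem_segment ha.le hab'.le hb.le).2 e
  refine ⟨A.notMem_S_of_mem_segment (ha.trans hab') hb,
    A.notMem_S_of_mem_segment ha (hab'.trans hb),
    hab.ne', hle, fun z => ?_, fun z => ?_, fun z => ?_, fun z => ?_⟩
  · rw [← mem_uIcc_iff_of_le hle, Set.uIcc_of_ge hab.le]
  · simp only [Set.mem_Ioc, Set.mem_Icc, lt_iff_le_and_ne, ne_eq, eq_comm (a := a)]
    tauto
  · simp only [Set.mem_Ico, Set.mem_Icc, lt_iff_le_and_ne, ne_eq, and_assoc]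
  · simp only [Set.mem_Ioo, Set.mem_Icc, lt_iff_le_and_ne, ne_eq, eq_comm (a := a)]
    tauto

end ContinuousQuiverA

theorem mainTheorem5 (k : Type u) [Field k] (A : ContinuousQuiverA) :
    (IndecomposablesAreIntervals k A (isPwf k A) ∧
      IndecomposablesAreIntervals k A (isBounded k A) ∧
      IndecomposablesAreIntervals k A (isFG k A)) ∧
    (HomLineOrZero (RepPwf k A) k ∧ HomLineOrZero (RepB k A) k ∧ HomLineOrZero (RepFG k A) k) ∧
    (∃ (hp : HasKernelsCokernelsImages (RepPwf k A)) (hb : HasKernelsCokernelsImages (RepB k A))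
        (hf : HasKernelsCokernelsImages (RepFG k A)),
      (letI := hf.abelian; globalDimension (RepFG k A) = 1) ∧
      (letI := hp.abelian; ExtLineOrZero (RepPwf k A) k) ∧
      (letI := hb.abelian; ExtLineOrZero (RepB k A) k) ∧
      (letI := hf.abelian; ExtLineOrZero (RepFG k A) k)) ∧
    IsKrullSchmidt (RepFG k A) ∧
    ¬ IsArtinianCategory (RepFG k A) ∧
    (∀ (n : ℤ) (hn : ExtInt.ofInt n ∈ A.index) (hn' : ExtInt.ofInt (n + 1) ∈ A.index) (a b : ℝ),
      (A.s ⟨_, hn⟩ : EReal) < a → a < b → (b : EReal) < A.s ⟨_, hn'⟩ →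
        (Even n → IsIntervalARSequence k A
          (Set.Ico a b) (Set.Icc a b) (Set.Ioo a b) (Set.Ioc a b)) ∧
        (Odd n → IsIntervalARSequence k A
          (Set.Ioc a b) (Set.Ioo a b) (Set.Icc a b) (Set.Ico a b))) ∧
    (∀ a : ℝ, a ∉ A.S → NoARSequence k A {a}) := by
  have hb : ∀ V, isBounded k A V → isPwf k A V := fun _ h => h.1
  have hf : ∀ V, isFG k A V → isPwf k A V := fun _ h => h.1
  refine ⟨⟨indecomposablesAreIntervals _ fun _ h => h, indecomposablesAreIntervals _ hb,
    indecomposablesAreIntervals _ hf⟩, ⟨homLineOrZero _ fun _ h => h, homLineOrZero _ hb,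
    homLineOrZero _ hf⟩, ⟨hasKernelsCokernelsImages_of_isClosed _,
    hasKernelsCokernelsImages_of_isClosed _, hasKernelsCokernelsImages_of_isClosed _,
    globalDimension_repFG _, extLineOrZero _ (fun _ h => h) _, extLineOrZero _ hb _,
    extLineOrZero _ hf _⟩, isKrullSchmidt_repFG, not_isArtinianCategory_repFG,
    fun n _ _ a b h1 h2 h3 => ⟨fun e => ?_, fun e => ?_⟩, fun a ha => noARSequence_singleton ha⟩
  · exact (isSquare_of_even h1 h2 h3 e).isIntervalARSequence.1
  · exact (isSquare_of_odd h1 h2 h3 e).isIntervalARSequence.2
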